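/- Let $W=(W(t))_{t\ge 0}$ be a real Brownian motion on a probability space $(\Omega,P)$ and let $(\mathcal F_t)_{t\ge0}$ be the usual augmentation of its natural filtration. Let $M\ge 1$ be an integer and $\Delta>0$. Let $F=g(W(\Delta),W(2\Delta),\dots,W(M\Delta))$ almost surely, where $g:\mathbb R^M\to\mathbb R$ is infinitely differentiable. For $s\ge 0$ the Malliavin derivative of such a variable at time $s$ is $$D_sF=\sum_{i=1}^{M}\partial_i g(W(\Delta),\dots,W(M\Delta))\,\chi_{[0,i\Delta]}(s),$$ which is again of this form; $D_s^l$ denotes its $l$-fold iteration. Assume that $F\in\mathbb D_\infty([0,M\Delta])$, that is, $F\in L^2(\Omega)$ and $\big\|\sup_{s_1,\dots,s_n\in[0,M\Delta]}|D_{s_n}\cdots D_{s_1}F|\big\|_{L^2(\Omega)}<\infty$ for every $n\ge1$. Let $h_n(x)=(-1)^n e^{x^2/2}\frac{d^n}{dx^n}e^{-x^2/2}$ be the Hermite polynomials, and for integers $m,l\ge0$ put $$\gamma(m,l)=(-1)^l\Delta^{l/2}\sum_{j=0}^{\lfloor l/2\rfloor}\frac{1}{j!\,(l-2j)!}\,h_{l-2j}\!\left(\frac{W((m+1)\Delta)-W(m\Delta)}{\sqrt\Delta}\right)$$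 (so $\gamma(m,0)=1$). Suppose that for every $m\in\{0,\dots,M-1\}$ $$\sum_{i=0}^{L}\big\|D^{2L-i}_{(m+1)\Delta}F\big\|_{L^2(\Omega)}^2\binom{L}{i}^4\frac{i!}{(L!)^2}\,\Delta^{2L-i}\longrightarrow 0\qquad(L\to\infty).$$ Then for every $m\in\{0,\dots,M-1\}$ $$E[F\mid\mathcal F_{m\Delta}]=\sum_{j_{m+1}=0}^{\infty}\cdots\sum_{j_M=0}^{\infty}\Big(\prod_{k=m+1}^{M}\gamma(k-1,j_k)\Big)D_{(m+1)\Delta}^{j_{m+1}}\cdots D_{M\Delta}^{j_M}F ,$$ where the right-hand side is an iterated series (the sum over $j_M$ is the innermost one), all of its terms lie in $L^2(\Omega)$, and each of the nested series converges in $L^2(\Omega)$, i.e. its partial sums converge in the $L^2(\Omega)$-norm. -/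

import Mathlib

open MeasureTheory ProbabilityTheory Filter Topology
open scoped NNReal ENNReal

noncomputable section

namespace BTE

variable {Ω : Type*} [mΩ : MeasurableSpace Ω]

/-- The filtration generated by `W`, enlarged at every time by the null sets of `P`
(on a complete space: by all null sets). -/
def nullFiltration (W : ℝ≥0 → Ω → ℝ) (hW : ∀ t, Measurable (W t)) (P : Measure Ω) :
    Filtration ℝ≥0 mΩ where
  seq t := (⨆ s ≤ t, MeasurableSpace.comap (W s) inferInstance) ⊔
    MeasurableSpace.generateFrom {A : Set Ω | MeasurableSet A ∧ P A = 0}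
  mono' _ _ h := sup_le_sup_right (biSup_mono fun _ => ge_trans h) _
  le' _ := sup_le (iSup₂_le fun s _ => (hW s).comap_le)
    (MeasurableSpace.generateFrom_le fun _ hA => hA.1)

/-- The usual augmentation of the filtration generated by `W`: null sets are added, and then the
right-continuous version is taken. -/
def brownianFiltration (W : ℝ≥0 → Ω → ℝ) (hW : ∀ t, Measurable (W t)) (P : Measure Ω) :
    Filtration ℝ≥0 mΩ :=
  (nullFiltration W hW P).rightCont

/-- The cylindrical random variable `g (W Δ, W (2 Δ), …, W (M Δ))`. -/
def cyl (W : ℝ≥0 → Ω → ℝ) (Δ : ℝ≥0) {M : ℕ} (g : (Fin M → ℝ) → ℝ) : Ω → ℝ :=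
  fun ω => g fun i => W (((i : ℕ) + 1 : ℝ≥0) * Δ) ω

/-- The Malliavin derivative at time `s` of a smooth cylindrical random variable
`F = g (W Δ, …, W (M Δ))` is `D_s F = ∑ i, ∂ᵢg (W Δ, …, W (M Δ)) χ_{[0, i Δ]}(s)`.
It is again cylindrical; this is the function that represents it. (For smooth `g` and a Brownian
motion `W`, `g` is determined by the almost sure equivalence class of `F`.) -/
def malliavin (Δ : ℝ≥0) {M : ℕ} (s : ℝ≥0) (g : (Fin M → ℝ) → ℝ) : (Fin M → ℝ) → ℝ :=
  fun x => ∑ i : Fin M,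
    if s ≤ ((i : ℕ) + 1 : ℝ≥0) * Δ then fderiv ℝ g x (Pi.single i 1) else 0

/-- `D_{s_n} ⋯ D_{s_1} F` for the list of times `[s_1, …, s_n]`. -/
def malliavinList (Δ : ℝ≥0) {M : ℕ} (s : List ℝ≥0) (g : (Fin M → ℝ) → ℝ) : (Fin M → ℝ) → ℝ :=
  s.foldl (fun h t => malliavin Δ t h) g

/-- Membership of `F = g (W Δ, …, W (M Δ))`, `g` smooth, in `𝔻_∞([0, M Δ])`: `F ∈ L²`, and for
every `n ≥ 1` the random variable `sup_{s_1, …, s_n ∈ [0, M Δ]} |D_{s_n} ⋯ D_{s_1} F|` has a finite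
`L²`-norm. -/
structure IsInfMalliavinDiff (W : ℝ≥0 → Ω → ℝ) (P : Measure Ω) (Δ : ℝ≥0) {M : ℕ}
    (g : (Fin M → ℝ) → ℝ) : Prop where
  memLp : MemLp (cyl W Δ g) 2 P
  sup_lt_top : ∀ n : ℕ, 1 ≤ n →
    ∫⁻ ω, (⨆ s : Fin n → Set.Icc (0 : ℝ≥0) (M * Δ),
      ‖cyl W Δ (malliavinList Δ (List.ofFn fun i => (s i : ℝ≥0)) g) ω‖ₑ) ^ 2 ∂P < ∞

/-- The growth condition at the time step `m`:
`∑_{i=0}^{L} ‖D^{2L-i}_{(m+1)Δ} F‖²_{L²} (L choose i)⁴ i! / (L!)² Δ^{2L-i} → 0` as `L → ∞`. -/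
def GrowthCondition (W : ℝ≥0 → Ω → ℝ) (P : Measure Ω) (Δ : ℝ≥0) {M : ℕ}
    (g : (Fin M → ℝ) → ℝ) (m : ℕ) : Prop :=
  Tendsto (fun L : ℕ => ∑ i ∈ Finset.range (L + 1),
      (eLpNorm (cyl W Δ ((malliavin Δ ((m + 1 : ℝ≥0) * Δ))^[2 * L - i] g)) 2 P).toReal ^ 2 *
        (L.choose i : ℝ) ^ 4 * ((i.factorial : ℝ) / (L.factorial : ℝ) ^ 2) *
        (Δ : ℝ) ^ (2 * L - i))
    atTop (𝓝 0)

/-- `γ(m, l) = (-1)^l Δ^{l/2} ∑_{j=0}^{⌊l/2⌋} h_{l-2j}((W((m+1)Δ) - W(mΔ)) / √Δ) / (j! (l-2j)!)`,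
with the Hermite polynomials `h_n` of the weight `exp (-x² / 2)`. -/
def gamma (W : ℝ≥0 → Ω → ℝ) (Δ : ℝ≥0) (m l : ℕ) : Ω → ℝ :=
  fun ω => (-1) ^ l * (Δ : ℝ) ^ ((l : ℝ) / 2) * ∑ j ∈ Finset.range (l / 2 + 1),
    1 / ((j.factorial : ℝ) * ((l - 2 * j).factorial : ℝ)) *
      Polynomial.aeval ((W ((m + 1 : ℝ≥0) * Δ) ω - W (m * Δ) ω) / √(Δ : ℝ))
        (Polynomial.hermite (l - 2 * j))

/-- `mixedDeriv Δ m n J g` represents `D^{J 0}_{(m+1)Δ} D^{J 1}_{(m+2)Δ} ⋯ D^{J (n-1)}_{(m+n)Δ} F`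
(the rightmost derivative is taken first). -/
def mixedDeriv (Δ : ℝ≥0) {M : ℕ} :
    ℕ → (n : ℕ) → (Fin n → ℕ) → ((Fin M → ℝ) → ℝ) → (Fin M → ℝ) → ℝ
  | _, 0, _, g => g
  | m, n + 1, J, g =>
      (malliavin Δ ((m + 1 : ℝ≥0) * Δ))^[J 0] (mixedDeriv Δ (m + 1) n (Fin.tail J) g)

/-- `S = ∑_{j=0}^∞ a j` in `L²(P)`: all terms and `S` are in `L²`, and the partial sums converge
to `S` in the `L²`-norm. -/
structure HasL2Sum (P : Measure Ω) (a : ℕ → Ω → ℝ) (S : Ω → ℝ) : Prop where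
  memLp_term : ∀ j, MemLp (a j) 2 P
  memLp_sum : MemLp S 2 P
  tendsto : Tendsto (fun N : ℕ => eLpNorm (fun ω => ∑ j ∈ Finset.range N, a j ω - S ω) 2 P)
    atTop (𝓝 0)

/-- `S = ∑_{j_0=0}^∞ ∑_{j_1=0}^∞ ⋯ ∑_{j_{n-1}=0}^∞ a (j_0, …, j_{n-1})` as an iterated series, the
innermost one over `j_{n-1}`, in which every one of the nested series converges in `L²(P)`. -/
def HasIteratedL2Sum (P : Measure Ω) :
    (n : ℕ) → ((Fin n → ℕ) → Ω → ℝ) → (Ω → ℝ) → Prop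
  | 0, a, S => S =ᵐ[P] a Fin.elim0
  | n + 1, a, S => ∃ s : ℕ → Ω → ℝ,
      (∀ j, HasIteratedL2Sum P n (fun J => a (Fin.cons j J)) (s j)) ∧ HasL2Sum P s S

end BTE

end

/-! The normalised increments x_k = (W((k+1)Δ) - W(kΔ))/√Δ, k < M, are independent standard
Gaussians, and F = u(x) almost surely with u = `g ∘ gridPath Δ M`. Moving x_k shifts exactly the
values W((i+1)Δ) with i ≥ k, so D_{(k+1)Δ} acts as Δ^{-1/2} ∂_k, while γ(k, l) = Δ^{l/2} `gam l`
(x_k). The powers of Δ cancel, and the claim concerns the operators `gam l` (x_k) ∂_k^l on Gaussian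
space.

Conditioning on the past of mΔ averages over x_m, …, x_{M-1}: in the Hermite basis it keeps the
coefficients c_α with α_k = 0 for all k ≥ m. In one variable, ∑ gam_l t^l = exp(t²) exp(-xt - t²/2)
is the inverse of ∑ he_n t^n/n! = exp(xt - t²/2). Since ∂^l he_n = n!/(n-l)! he_{n-l}, the sum ∑_l
gam_l ∂^l maps he_n to 0 for n ≥ 1 and fixes he_0 = 1; formally it is the expectation
(`sum_gam_mul_he`, `sum_Mx`).

For convergence, the partial sum over l < N is exact on degrees n < N. On degrees n ≥ N the squares
of its matrix entries are at most (n+1)^4 8^n, by the explicit triple products of Hermite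
polynomials (`tau_eq`, `sq_sum_Mx_le`). Hence the error vanishes in L² once ∑ 8.1^{α_k} c_α² is
finite (`tendsto_sum_Gam`).

This finiteness comes from the term i = r of the growth condition at L = 2r. It bounds ‖∂_k^{3r} u‖²
= (3r)! ∑ C(α_k, 3r) c_α², so that ∑ C(α_k, 3r) c_α² = O(1/`wt r`), where the ratios of `wt` tend to
432. As 7.23³ < 379 < 432, the sums with weights ∑_r 7.23^{3r} C(α_k, 3r) are finite, and by the
binomial theorem these weights are comparable to 8.23^{α_k} up to polynomial factors
(`good_of_growth`).

With extra polynomial weights, the class `Good` is stable under the operators. Operators in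
different coordinates commute, so induction on the number of coordinates yields the nested series
(`hasIteratedL2Sum_of_coef`). Independence of the later increments from the usual augmentation
(`indep_brownianFiltration`) identifies the sum with the conditional expectation. -/

namespace BTE

/-! ### Hermite polynomials of one variable and their triple products -/

section OneDim

open Polynomial

/-- The Hermite polynomial `hermite n` with real coefficients. -/
noncomputable def hePoly (n : ℕ) : ℝ[X] := (hermite n).map (Int.castRingHom ℝ)

/-- The Hermite function `x ↦ hₙ(x)`. -/
noncomputable def he (n : ℕ) (x : ℝ) : ℝ := (hePoly n).eval x

lemma aeval_hermite (n : ℕ) (x : ℝ) : aeval x (hermite n) = he n x := by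
  simp [he, hePoly, aeval_def, eval_map]

lemma derivative_hermite_succ (n : ℕ) :
    derivative (hermite (n + 1)) = ((n + 1 : ℕ) : ℤ[X]) * hermite n := by
  induction n with
  | zero => simp
  | succ n ih =>
    rw [hermite_succ (n + 1), derivative_sub, derivative_mul, ih, derivative_mul, hermite_succ n]
    simp only [derivative_X, derivative_natCast]
    push_cast
    ring

lemma derivative_hePoly_succ (n : ℕ) :
    derivative (hePoly (n + 1)) = ((n + 1 : ℕ) : ℝ[X]) * hePoly n := by
  rw [hePoly, derivative_map, derivative_hermite_succ]
  simp [hePoly]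

lemma hePoly_succ (n : ℕ) : hePoly (n + 1) = X * hePoly n - derivative (hePoly n) := by
  simp [hePoly, hermite_succ, derivative_map]

lemma hePoly_add_two (n : ℕ) :
    hePoly (n + 2) = X * hePoly (n + 1) - ((n + 1 : ℕ) : ℝ[X]) * hePoly n := by
  rw [hePoly_succ (n + 1), derivative_hePoly_succ]

@[simp] lemma hePoly_zero : hePoly 0 = 1 := by simp [hePoly]

@[simp] lemma he_zero (x : ℝ) : he 0 x = 1 := by simp [he]

@[simp] lemma he_one (x : ℝ) : he 1 x = x := by simp [he, hePoly]

lemma he_add_two (n : ℕ) (x : ℝ) : he (n + 2) x = x * he (n + 1) x - (n + 1) * he n x := by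
  simp [he, hePoly_add_two]

lemma mul_he (n : ℕ) (x : ℝ) : x * he n x = he (n + 1) x + n * he (n - 1) x := by
  cases n with
  | zero => simp
  | succ n => rw [he_add_two]; simp

lemma hasDerivAt_he (n : ℕ) (x : ℝ) : HasDerivAt (he n) (n * he (n - 1) x) x := by
  have h := (hePoly n).hasDerivAt x
  cases n with
  | zero => simpa [funext he_zero] using hasDerivAt_const x (1 : ℝ)
  | succ n =>
    rw [derivative_hePoly_succ] at h
    change HasDerivAt (fun x => (hePoly (n + 1)).eval x) _ x
    simpa [he] using h

lemma contDiff_he (n : ℕ) {N : WithTop ℕ∞} : ContDiff ℝ N (he n) := by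
  unfold he; simpa using (hePoly n).contDiff_aeval (𝕜 := ℝ) N

@[fun_prop] lemma continuous_he (n : ℕ) : Continuous (he n) := (hePoly n).continuous

lemma norm_pow_le_exp (n : ℕ) (x : ℝ) : |x| ^ n ≤ n.factorial * Real.exp |x| := by
  have := Real.pow_div_factorial_le_exp |x| (abs_nonneg x) n
  rwa [div_le_iff₀ (by positivity), mul_comm] at this

lemma exists_eval_le_exp (p : ℝ[X]) : ∃ C : ℝ, 0 ≤ C ∧ ∀ x, |p.eval x| ≤ C * Real.exp |x| := by
  induction p using Polynomial.induction_on' with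
  | add p q hp hq =>
    obtain ⟨C, hC, h⟩ := hp
    obtain ⟨D, hD, h'⟩ := hq
    refine ⟨C + D, by positivity, fun x => ?_⟩
    rw [eval_add, add_mul]
    exact (abs_add_le _ _).trans (add_le_add (h x) (h' x))
  | monomial n a =>
    refine ⟨|a| * n.factorial, by positivity, fun x => ?_⟩
    rw [eval_monomial, abs_mul, abs_pow, mul_assoc]
    exact mul_le_mul_of_nonneg_left (norm_pow_le_exp n x) (abs_nonneg a)

lemma integrable_exp_abs (t : ℝ) :
    Integrable (fun x : ℝ => Real.exp (t * |x|)) (gaussianReal 0 1) := by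
  refine ((integrable_exp_mul_gaussianReal (μ := 0) (v := 1) t).add
    (integrable_exp_mul_gaussianReal (μ := 0) (v := 1) (-t))).mono' (by fun_prop) ?_
  refine Eventually.of_forall fun x => ?_
  rw [Real.norm_eq_abs, abs_of_pos (Real.exp_pos _)]
  simp only [Pi.add_apply]
  rcases le_total 0 x with h | h
  · rw [abs_of_nonneg h]; linarith [Real.exp_pos (-t * x)]
  · rw [abs_of_nonpos h, mul_neg, ← neg_mul]; linarith [Real.exp_pos (t * x)]

lemma integrable_eval (p : ℝ[X]) : Integrable (fun x => p.eval x) (gaussianReal 0 1) := by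
  obtain ⟨C, hC, h⟩ := exists_eval_le_exp p
  refine ((integrable_exp_abs 1).const_mul C).mono' p.continuous.aestronglyMeasurable ?_
  exact Eventually.of_forall fun x => by simpa using h x

lemma hasDerivAt_gaussianPDFReal (x : ℝ) :
    HasDerivAt (gaussianPDFReal 0 1) (-x * gaussianPDFReal 0 1 x) x := by
  have h : HasDerivAt (fun x : ℝ => -(x - 0) ^ 2 / (2 * ((1 : ℝ≥0) : ℝ))) (-x) x := by
    have := ((((hasDerivAt_id x).sub_const 0).pow 2).neg).div_const (2 * ((1 : ℝ≥0) : ℝ))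
    exact this.congr_deriv (by simp; ring)
  have := h.exp.const_mul (√(2 * Real.pi * ((1 : ℝ≥0) : ℝ)))⁻¹
  refine this.congr_deriv ?_
  simp only [gaussianPDFReal]
  ring

lemma integrable_gaussianReal_iff (f : ℝ → ℝ) :
    Integrable f (gaussianReal 0 1) ↔ Integrable (fun x => f x * gaussianPDFReal 0 1 x) := by
  rw [gaussianReal_of_var_ne_zero 0 one_ne_zero, gaussianPDF_def]
  rw [integrable_withDensity_iff_integrable_smul' (by fun_prop) (by simp)]
  refine integrable_congr (Eventually.of_forall fun x => ?_)
  simp only [smul_eq_mul]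
  rw [ENNReal.toReal_ofReal (gaussianPDFReal_nonneg 0 1 x), mul_comm]

/-- Gaussian integration by parts for polynomials. -/
lemma integral_mul_eval (p : ℝ[X]) :
    ∫ x, x * p.eval x ∂gaussianReal 0 1 = ∫ x, (derivative p).eval x ∂gaussianReal 0 1 := by
  have h1 := (integrable_gaussianReal_iff _).1 (integrable_eval p)
  have h2 := (integrable_gaussianReal_iff _).1 (integrable_eval (derivative p))
  have h3 := (integrable_gaussianReal_iff _).1 (integrable_eval (-(X * p)))
  have := integral_mul_deriv_eq_deriv_mul_of_integrable (u := fun x => p.eval x)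
    (v := gaussianPDFReal 0 1) (fun x _ => p.hasDerivAt x)
    (fun x _ => hasDerivAt_gaussianPDFReal x)
    (h3.congr (Eventually.of_forall fun x => by simp only [eval_neg, eval_mul, eval_X, Pi.mul_apply]; ring)) h2 h1
  rw [integral_gaussianReal_eq_integral_smul one_ne_zero,
    integral_gaussianReal_eq_integral_smul one_ne_zero, ← neg_inj,
    ← integral_neg, ← integral_neg]
  simp only [smul_eq_mul]
  rw [integral_neg (f := fun x => gaussianPDFReal 0 1 x * (derivative p).eval x)]
  simp only [mul_comm (gaussianPDFReal 0 1 _)]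
  rw [← this]
  congr with x
  ring

lemma integral_hePoly_succ_mul (n : ℕ) (p : ℝ[X]) :
    ∫ x, he (n + 1) x * p.eval x ∂gaussianReal 0 1
      = ∫ x, he n x * (derivative p).eval x ∂gaussianReal 0 1 := by
  have h := integral_mul_eval (hePoly n * p)
  rw [derivative_mul] at h
  have e1 : ∀ x, he (n + 1) x * p.eval x
      = (X * (hePoly n * p)).eval x - (derivative (hePoly n) * p).eval x := fun x => by
    simp [he, hePoly_succ]; ring
  simp_rw [e1]
  rw [integral_sub (integrable_eval _) (integrable_eval _)]
  have e2 : ∀ x : ℝ, (X * (hePoly n * p)).eval x = x * (hePoly n * p).eval x := by simp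
  simp_rw [e2]
  rw [h, ← integral_sub (integrable_eval _) (integrable_eval _)]
  congr with x
  simp [he]

/-- The normalised triple products of Hermite polynomials. -/
noncomputable def tau (a k m : ℕ) : ℝ :=
  (∫ x, he a x * (he k x * he m x) ∂gaussianReal 0 1)
    / (a.factorial * k.factorial * m.factorial)

lemma integral_triple_succ (a k m : ℕ) :
    ∫ x, he (a + 1) x * (he k x * he m x) ∂gaussianReal 0 1
      = k * (∫ x, he a x * (he (k - 1) x * he m x) ∂gaussianReal 0 1)
        + m * (∫ x, he a x * (he k x * he (m - 1) x) ∂gaussianReal 0 1) := by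
  have hd : ∀ n x, (derivative (hePoly n)).eval x = n * he (n - 1) x := fun n x => by
    cases n <;> simp [derivative_hePoly_succ, he]
  have h := integral_hePoly_succ_mul a (hePoly k * hePoly m)
  simp only [derivative_mul, eval_add, eval_mul, hd] at h
  change ∫ x, he (a + 1) x * (he k x * he m x) ∂_ = ∫ x, he a x *
    (k * he (k - 1) x * he m x + he k x * (m * he (m - 1) x)) ∂_ at h
  rw [h, ← integral_const_mul, ← integral_const_mul, ← integral_add]
  · congr with x; ring
  · exact (integrable_eval (hePoly a * (hePoly (k - 1) * hePoly m))).const_mul (k : ℝ) |>.congr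
      (Eventually.of_forall fun x => by simp [he])
  · exact (integrable_eval (hePoly a * (hePoly k * hePoly (m - 1)))).const_mul (m : ℝ) |>.congr
      (Eventually.of_forall fun x => by simp [he])

lemma integral_he_mul_he (k m : ℕ) :
    ∫ x, he k x * he m x ∂gaussianReal 0 1 = if k = m then (k.factorial : ℝ) else 0 := by
  induction k generalizing m with
  | zero =>
    cases m with
    | zero => simp
    | succ m =>
      have := integral_hePoly_succ_mul m 1
      simpa using this
  | succ k ih =>
    have := integral_triple_succ k 0 m
    simp only [he_zero, one_mul, CharP.cast_eq_zero, zero_mul, zero_add] at this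
    rw [this, ih]
    cases m with
    | zero => simp
    | succ m =>
      by_cases h : k = m
      · subst h; simp [Nat.factorial_succ]
      · simp [h]

lemma tau_zero (k m : ℕ) : tau 0 k m = if k = m then 1 / (k.factorial : ℝ) else 0 := by
  simp only [tau, he_zero, one_mul, integral_he_mul_he]
  split_ifs with h
  · subst h
    simp [field]
  · simp

/-- Under the Gaussian, he_{a+1} integrates by parts to he_a with a derivative on the remaining
product. The factors k and m produced by the Leibniz rule are absorbed by the factorials in `tau`.
-/
lemma tau_succ (a k m : ℕ) : (a + 1) * tau (a + 1) k m
    = (if k = 0 then 0 else tau a (k - 1) m) + (if m = 0 then 0 else tau a k (m - 1)) := by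
  simp only [tau]
  rw [integral_triple_succ]
  rcases k with _ | k <;> rcases m with _ | m <;>
    simp [Nat.factorial_succ] <;> field_simp

/-- The triangle and parity conditions hold at a = 0 by orthogonality, and a violation of one of
them at (a+1, k, m) persists in both terms of the recursion. -/
lemma tau_eq_zero {a k m : ℕ} (h : a + k < m ∨ a + m < k ∨ k + m < a ∨ Odd (a + k + m)) :
    tau a k m = 0 := by
  induction a generalizing k m with
  | zero =>
    rw [tau_zero, if_neg]
    rintro rfl
    rcases h with h | h | h | h <;> grind
  | succ a ih =>
    have hne : ((a : ℝ) + 1) ≠ 0 := by positivity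
    refine mul_left_cancel₀ hne ?_
    rw [tau_succ, mul_zero]
    have h1 : (if k = 0 then 0 else tau a (k - 1) m) = 0 := by
      split_ifs with hk
      · rfl
      · obtain ⟨k, rfl⟩ := Nat.exists_eq_succ_of_ne_zero hk
        apply ih
        grind
    have h2 : (if m = 0 then 0 else tau a k (m - 1)) = 0 := by
      split_ifs with hk
      · rfl
      · obtain ⟨m, rfl⟩ := Nat.exists_eq_succ_of_ne_zero hk
        apply ih
        grind
    rw [h1, h2, add_zero]

/-- The right-hand side solves the recursion `tau_succ`: its multiple by a + c splits into the
multiples by c and by a, which are the values with c or a lowered by one. -/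
lemma tau_eq (a c d : ℕ) : tau (a + c) (c + d) (a + d)
    = 1 / (a.factorial * c.factorial * d.factorial) := by
  obtain ⟨s, hs⟩ : ∃ s, s = a + c := ⟨_, rfl⟩
  induction s generalizing a c with
  | zero =>
    obtain ⟨rfl, rfl⟩ : a = 0 ∧ c = 0 := by omega
    simp [tau_zero]
  | succ s ih =>
    have h := tau_succ s (c + d) (a + d)
    rw [← hs]
    have hs' : ((s : ℝ) + 1) = a + c := by exact_mod_cast hs
    have hne : ((s : ℝ) + 1) ≠ 0 := by positivity
    refine mul_left_cancel₀ hne ?_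
    rw [h]
    have t1 : (if c + d = 0 then 0 else tau s (c + d - 1) (a + d))
        = c / (a.factorial * c.factorial * d.factorial) := by
      rcases c with _ | c
      · rw [tau_eq_zero (by omega)]
        simp
      · have e : s = a + c := by omega
        have := ih a c e
        rw [if_neg (by omega), show c + 1 + d - 1 = c + d by omega, e, this, Nat.factorial_succ]
        push_cast
        field_simp
    have t2 : (if a + d = 0 then 0 else tau s (c + d) (a + d - 1))
        = a / (a.factorial * c.factorial * d.factorial) := by
      rcases a with _ | a
      · rcases d with _ | d
        · simp
        · rw [tau_eq_zero (by omega)]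
          simp
      · have e : s = a + c := by omega
        have := ih a c e
        rw [if_neg (by omega), show a + 1 + d - 1 = a + d by omega, e, this, Nat.factorial_succ]
        push_cast
        field_simp
    rw [t1, t2, hs']
    ring

end OneDim
-- Generating functions: `gam` as an inverse series
section GenFun

/-- The random variable `γ(m, l)` as a function of the normalised increment, without its power of
the step size. -/
noncomputable def gam (l : ℕ) (x : ℝ) : ℝ :=
  (-1) ^ l * ∑ j ∈ Finset.range (l / 2 + 1),
    1 / ((j.factorial : ℝ) * ((l - 2 * j).factorial : ℝ)) * he (l - 2 * j) x

lemma contDiff_gam (l : ℕ) {N : WithTop ℕ∞} : ContDiff ℝ N (gam l) := by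
  unfold gam
  exact contDiff_const.mul (ContDiff.sum fun j _ => contDiff_const.mul (contDiff_he _))

open PowerSeries

/-- The differential equation of exp(s x t - t²/2) as a formal power series in t; both signs s = ±1
are needed. -/
lemma derivative_mk_he (x s : ℝ) (hs : s ^ 2 = 1) :
    derivative ℝ (PowerSeries.mk fun n => s ^ n * he n x / n.factorial)
      = (C (s * x) - X) * PowerSeries.mk fun n => s ^ n * he n x / n.factorial := by
  ext n
  rw [coeff_derivative, sub_mul, map_sub, coeff_C_mul]
  cases n with
  | zero => simp
  | succ n =>
    rw [coeff_succ_X_mul]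
    simp only [coeff_mk, he_add_two, Nat.factorial_succ]
    push_cast
    field_simp
    have : s ^ (n + 1 + 1) = s ^ n := by rw [add_assoc, pow_add]; simp [hs]
    have h2 : s ^ (n + 1) = s ^ n * s := pow_succ _ _
    rw [this, h2]
    linear_combination (-x * he (n + 1) x * s ^ n) * hs

/-- The differential equation of exp(t²), the factor that produces the sum over j in `gam`. -/
lemma derivative_mk_even :
    derivative ℝ (PowerSeries.mk fun n => if Even n then 1 / ((n / 2).factorial : ℝ) else 0)
      = (2 * X) * PowerSeries.mk fun n => if Even n then 1 / ((n / 2).factorial : ℝ) else 0 := by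
  ext n
  rw [coeff_derivative, mul_assoc, ← map_ofNat C, coeff_C_mul]
  cases n with
  | zero => simp
  | succ n =>
    rw [coeff_succ_X_mul]
    simp only [coeff_mk]
    rcases Nat.even_or_odd n with h | h
    · have h' : Even (n + 1 + 1) := by grind
      obtain ⟨k, rfl⟩ := h
      rw [if_pos h', if_pos ⟨k, rfl⟩, show (k + k + 1 + 1) / 2 = k + 1 by omega,
        show (k + k) / 2 = k by omega, Nat.factorial_succ]
      push_cast
      field_simp
      ring
    · have h' : ¬ Even (n + 1 + 1) := by grind
      rw [if_neg h', if_neg (by grind)]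
      simp

lemma gam_eq_coeff (l : ℕ) (x : ℝ) :
    gam l x = coeff l ((PowerSeries.mk fun n => if Even n then 1 / ((n / 2).factorial : ℝ) else 0)
      * PowerSeries.mk fun n => (-1 : ℝ) ^ n * he n x / n.factorial) := by
  rw [coeff_mul, Finset.Nat.sum_antidiagonal_eq_sum_range_succ_mk]
  simp only [coeff_mk, gam, Finset.mul_sum]
  symm
  have hinj : Set.InjOn (fun j => 2 * j) (Finset.range (l / 2 + 1) : Set ℕ) := by
    intro a _ b _ h; simpa using h
  rw [← Finset.sum_subset (s₁ := (Finset.range (l / 2 + 1)).image fun j => 2 * j),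
    Finset.sum_image hinj]
  · refine Finset.sum_congr rfl fun j hj => ?_
    have hj' : 2 * j ≤ l := by have := Finset.mem_range.1 hj; omega
    have : (-1 : ℝ) ^ (l - 2 * j) = (-1) ^ l := by
      obtain ⟨k, rfl⟩ := Nat.exists_eq_add_of_le hj'
      rw [Nat.add_sub_cancel_left, pow_add, pow_mul]; simp
    rw [if_pos (even_two_mul j), this, show 2 * j / 2 = j by omega]
    field_simp
  · intro i hi
    simp only [Finset.mem_image, Finset.mem_range] at hi ⊢
    omega
  · intro i hi hi'
    rw [if_neg, zero_mul]
    rintro ⟨k, rfl⟩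
    apply hi'
    simp only [Finset.mem_image, Finset.mem_range] at hi ⊢
    exact ⟨k, by omega, by omega⟩

/-- The generating functions of `gam` and of `he / !` are inverse to each other. -/
lemma sum_gam_mul_he (n : ℕ) (x : ℝ) :
    ∑ l ∈ Finset.range (n + 1), gam l x * (he (n - l) x / (n - l).factorial)
      = if n = 0 then 1 else 0 := by
  set E : ℝ⟦X⟧ := PowerSeries.mk fun n => (1 : ℝ) ^ n * he n x / n.factorial with hE
  set F : ℝ⟦X⟧ := PowerSeries.mk fun n => (-1 : ℝ) ^ n * he n x / n.factorial with hF
  set Q : ℝ⟦X⟧ := PowerSeries.mk fun n => if Even n then 1 / ((n / 2).factorial : ℝ) else 0 with hQ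
  have dE : derivative ℝ E = (C (1 * x) - X) * E := derivative_mk_he x 1 (by norm_num)
  have dF : derivative ℝ F = (C (-1 * x) - X) * F := derivative_mk_he x (-1) (by norm_num)
  have dQ : derivative ℝ Q = (2 * X) * Q := derivative_mk_even
  -- The logarithmic derivatives 2t, -x - t and x - t add up to zero, and the constant term is 1.
  have key : Q * F * E = 1 := by
    apply derivative.ext
    · rw [Derivation.leibniz, Derivation.leibniz, dE, dF, dQ, Derivation.map_one_eq_zero]
      simp only [smul_eq_mul, one_mul, neg_mul, map_neg]
      ring
    · rw [map_mul, map_mul]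
      simp only [← coeff_zero_eq_constantCoeff_apply]
      simp [hE, hF, hQ]
  have := congrArg (coeff n) key
  rw [coeff_mul, Finset.Nat.sum_antidiagonal_eq_sum_range_succ_mk, coeff_one] at this
  rw [← this]
  refine Finset.sum_congr rfl fun l _ => ?_
  rw [← gam_eq_coeff]
  simp [hE]

end GenFun

/-! ### The matrix entries of `gam l * ∂ˡ` and their bounds -/

section Matrix

/-- The matrix of `u ↦ gam l * u⁽ˡ⁾` in the basis of normalised Hermite polynomials. -/
noncomputable def Mx (l m n : ℕ) : ℝ :=
  if l ≤ n then √(n.factorial : ℝ) / (n - l).factorial * (1 / √(m.factorial : ℝ)) *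
    ∫ x, gam l x * (he (n - l) x * he m x) ∂gaussianReal 0 1 else 0

lemma integrable_he_mul (a k m : ℕ) :
    Integrable (fun x => he a x * (he k x * he m x)) (gaussianReal 0 1) :=
  (integrable_eval (hePoly a * (hePoly k * hePoly m))).congr
    (Eventually.of_forall fun x => by simp [he])

lemma Mx_eq {l n : ℕ} (h : l ≤ n) (m : ℕ) : Mx l m n = (-1) ^ l * ∑ j ∈ Finset.range (l / 2 + 1),
    √(n.factorial : ℝ) * √(m.factorial : ℝ) * (tau (l - 2 * j) (n - l) m / j.factorial) := by
  have e : ∀ x, gam l x * (he (n - l) x * he m x) = ∑ j ∈ Finset.range (l / 2 + 1),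
      (-1) ^ l * (1 / ((j.factorial : ℝ) * ((l - 2 * j).factorial : ℝ))) *
        (he (l - 2 * j) x * (he (n - l) x * he m x)) := fun x => by
    rw [gam, Finset.mul_sum, Finset.sum_mul]
    exact Finset.sum_congr rfl fun j _ => by ring
  rw [Mx, if_pos h]
  simp_rw [e]
  rw [integral_finsetSum _ fun j _ => (integrable_he_mul _ _ _).const_mul _, Finset.mul_sum,
    Finset.mul_sum]
  refine Finset.sum_congr rfl fun j _ => ?_
  rw [integral_const_mul, tau]
  have h1 : √(m.factorial : ℝ) ≠ 0 := by positivity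
  have h2 : (m.factorial : ℝ) = √(m.factorial : ℝ) * √(m.factorial : ℝ) :=
    (Real.mul_self_sqrt (by positivity)).symm
  rw [h2]
  simp only [Real.sqrt_mul_self (Real.sqrt_nonneg _)]
  field_simp

/-- The triangle conditions for the degrees l - 2j, n - l and m. In particular the operators never
raise the degree, and each row has finitely many entries. -/
lemma Mx_support {l m n : ℕ} (h : Mx l m n ≠ 0) : l ≤ n ∧ m ≤ n ∧ n ≤ m + 2 * l := by
  have hl : l ≤ n := by
    by_contra hl
    exact h (by rw [Mx, if_neg hl])
  refine ⟨hl, ?_⟩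
  by_contra hc
  apply h
  rw [Mx_eq hl, Finset.sum_eq_zero, mul_zero]
  intro j hj
  have := Finset.mem_range.1 hj
  rw [tau_eq_zero (by omega), zero_div, mul_zero]

lemma tau_cases (a k m : ℕ) : tau a k m = 0 ∨
    ∃ A C D, a = A + C ∧ k = C + D ∧ m = A + D := by
  by_cases h : a + k < m ∨ a + m < k ∨ k + m < a ∨ Odd (a + k + m)
  · exact Or.inl (tau_eq_zero h)
  · refine Or.inr ⟨(a + m - k) / 2, (a + k - m) / 2, (k + m - a) / 2, ?_⟩
    simp only [not_or, not_lt, Nat.not_odd_iff_even] at h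
    obtain ⟨h1, h2, h3, t, ht⟩ := h
    omega

/-- With s = A + D and t = B + C, the left side is (A! B! C! D!)² times six binomial coefficients
counted with multiplicity, bounded by 2^(s+2t), 2^(2t), (2^s)² and (2^t)². The exponents add up to
3(s + 2t). -/
lemma factorial_mul_le (A B C D : ℕ) :
    (A + D + 2 * (B + C)).factorial * (A + D).factorial
      ≤ 8 ^ (A + D + 2 * (B + C)) * (A.factorial * B.factorial * C.factorial * D.factorial) ^ 2 := by
  set s := A + D with hs
  set t := B + C with ht
  have e1 : s.factorial = s.choose A * A.factorial * D.factorial := by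
    rw [← Nat.choose_mul_factorial_mul_factorial (show A ≤ s by omega), show s - A = D by omega]
  have e2 : t.factorial = t.choose B * B.factorial * C.factorial := by
    rw [← Nat.choose_mul_factorial_mul_factorial (show B ≤ t by omega), show t - B = C by omega]
  have e3 : (s + 2 * t).factorial = (s + 2 * t).choose s * s.factorial * (2 * t).factorial := by
    rw [← Nat.choose_mul_factorial_mul_factorial (show s ≤ s + 2 * t by omega),
      show s + 2 * t - s = 2 * t by omega]
  have e4 : (2 * t).factorial = (2 * t).choose t * t.factorial * t.factorial := by
    rw [← Nat.choose_mul_factorial_mul_factorial (show t ≤ 2 * t by omega),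
      show 2 * t - t = t by omega]
  have b1 : (s + 2 * t).choose s ≤ 2 ^ (s + 2 * t) := Nat.choose_le_two_pow _ _
  have b2 : (2 * t).choose t ≤ 2 ^ (2 * t) := Nat.choose_le_two_pow _ _
  have b3 : s.choose A ≤ 2 ^ s := Nat.choose_le_two_pow _ _
  have b4 : t.choose B ≤ 2 ^ t := Nat.choose_le_two_pow _ _
  calc (s + 2 * t).factorial * s.factorial
      = (s + 2 * t).choose s * (2 * t).choose t * (s.choose A) ^ 2 * (t.choose B) ^ 2 *
        (A.factorial * B.factorial * C.factorial * D.factorial) ^ 2 := by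
        rw [e3, e4, e1, e2]; ring
    _ ≤ 2 ^ (s + 2 * t) * 2 ^ (2 * t) * (2 ^ s) ^ 2 * (2 ^ t) ^ 2 *
        (A.factorial * B.factorial * C.factorial * D.factorial) ^ 2 := by gcongr
    _ = _ := by
        rw [show (8 : ℕ) = 2 ^ 3 by norm_num]
        simp only [← pow_mul, ← pow_add]
        congr 2
        ring

lemma factorial_add_le (d i : ℕ) : (d + i).factorial ≤ d.factorial * (d + i) ^ i := by
  induction i with
  | zero => simp
  | succ i ih =>
    rw [← add_assoc, Nat.factorial_succ, pow_succ]
    calc (d + i + 1) * (d + i).factorial ≤ (d + i + 1) * (d.factorial * (d + i + 1) ^ i) := by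
          gcongr
          exact ih.trans (Nat.mul_le_mul_left _ (Nat.pow_le_pow_left (Nat.le_succ _) _))
      _ = _ := by ring

/-- For fixed l = A + 2B + C, both factorials on the left exceed D! only by polynomial factors in n,
of total degree 2(A + B + C) ≤ 3l. -/
lemma factorial_mul_le' (A B C D : ℕ) :
    (A + D + 2 * (B + C)).factorial * (A + D).factorial
      ≤ (A + D + 2 * (B + C) + 1) ^ (3 * (A + 2 * B + C)) *
        (A.factorial * B.factorial * C.factorial * D.factorial) ^ 2 := by
  have h1 := factorial_add_le D (A + 2 * (B + C))
  have h2 := factorial_add_le D A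
  rw [show D + (A + 2 * (B + C)) = A + D + 2 * (B + C) by ring] at h1
  rw [show D + A = A + D by ring] at h2
  set n := A + D + 2 * (B + C) with hn
  have hA := A.factorial_pos
  have hB := B.factorial_pos
  have hC := C.factorial_pos
  have h3 : D.factorial ≤ A.factorial * B.factorial * C.factorial * D.factorial :=
    Nat.le_mul_of_pos_left _ (by positivity)
  calc n.factorial * (A + D).factorial
      ≤ (D.factorial * n ^ (A + 2 * (B + C))) * (D.factorial * (A + D) ^ A) := by gcongr
    _ ≤ (D.factorial * (n + 1) ^ (A + 2 * (B + C))) * (D.factorial * (n + 1) ^ A) := by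
        have e1 : n ^ (A + 2 * (B + C)) ≤ (n + 1) ^ (A + 2 * (B + C)) :=
          Nat.pow_le_pow_left (by omega) _
        have e2 : (A + D) ^ A ≤ (n + 1) ^ A := Nat.pow_le_pow_left (by omega) _
        gcongr
    _ = (n + 1) ^ (A + 2 * (B + C) + A) * D.factorial ^ 2 := by ring
    _ ≤ (n + 1) ^ (3 * (A + 2 * B + C)) *
        (A.factorial * B.factorial * C.factorial * D.factorial) ^ 2 := by
        refine Nat.mul_le_mul (Nat.pow_le_pow_right (by omega) (by omega)) ?_
        exact Nat.pow_le_pow_left h3 2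

lemma sq_term_le {l n j : ℕ} (h : l ≤ n) (hj : j ∈ Finset.range (l / 2 + 1)) (m : ℕ) :
    (√(n.factorial : ℝ) * √(m.factorial : ℝ) * (tau (l - 2 * j) (n - l) m / j.factorial)) ^ 2
      ≤ min ((8 : ℝ) ^ n) (((n : ℝ) + 1) ^ (3 * l)) := by
  have hj' := Finset.mem_range.1 hj
  rcases tau_cases (l - 2 * j) (n - l) m with h0 | ⟨A, C, D, h1, h2, h3⟩
  · rw [h0]
    simp only [zero_div, mul_zero, ne_eq, OfNat.ofNat_ne_zero, not_false_eq_true, zero_pow]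
    positivity
  · rw [h1, h2, h3, tau_eq, mul_pow, mul_pow, Real.sq_sqrt (by positivity),
      Real.sq_sqrt (by positivity), div_div, div_pow, one_pow, mul_one_div]
    -- The relations l - 2j = A + C, n - l = C + D and m = A + D bring n! m! / (A! C! D! j!)² to the
    -- form of the two factorial estimates with B = j.
    have hn : n = A + D + 2 * (j + C) := by omega
    have hl : l = A + 2 * j + C := by omega
    have b1 := factorial_mul_le A j C D
    have b2 := factorial_mul_le' A j C D
    rw [← hn] at b1 b2
    rw [← hl] at b2
    have e : ((A.factorial : ℝ) * C.factorial * D.factorial * j.factorial) ^ 2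
      = ((A.factorial * j.factorial * C.factorial * D.factorial) ^ 2 : ℕ) := by push_cast; ring
    rw [e]
    have hp : (0 : ℝ) < ((A.factorial * j.factorial * C.factorial * D.factorial) ^ 2 : ℕ) := by
      have hA := A.factorial_pos
      have hB := j.factorial_pos
      have hC := C.factorial_pos
      have hD := D.factorial_pos
      exact_mod_cast (by positivity)
    refine le_min ?_ ?_
    · rw [div_le_iff₀ hp]
      exact_mod_cast b1
    · rw [div_le_iff₀ hp]
      exact_mod_cast b2

/-- The first bound is uniform in l and controls the tail of the series; the second is polynomial in
n for fixed l and shows that a single operator costs only polynomial weights. -/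
lemma sq_Mx_le (l m n : ℕ) :
    Mx l m n ^ 2 ≤ (n + 1) ^ 2 * 8 ^ n ∧ Mx l m n ^ 2 ≤ (l + 1) ^ 2 * (n + 1) ^ (3 * l) := by
  by_cases h : l ≤ n
  · have key : Mx l m n ^ 2 ≤ (l + 1) ^ 2 * min ((8 : ℝ) ^ n) (((n : ℝ) + 1) ^ (3 * l)) := by
      rw [Mx_eq h, mul_pow, ← pow_mul, mul_comm l, pow_mul]
      simp only [even_two, Even.neg_pow, one_pow, one_mul]
      refine (sq_sum_le_card_mul_sum_sq (s := Finset.range (l / 2 + 1))).trans ?_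
      have hc : ((Finset.range (l / 2 + 1)).card : ℝ) ≤ l + 1 := by
        rw [Finset.card_range]
        exact_mod_cast (by omega : l / 2 + 1 ≤ l + 1)
      have hs := Finset.sum_le_card_nsmul _ _ _ fun j hj => sq_term_le h hj m
      rw [nsmul_eq_mul] at hs
      calc _ ≤ ((Finset.range (l / 2 + 1)).card : ℝ) * (((Finset.range (l / 2 + 1)).card : ℝ) *
            min ((8 : ℝ) ^ n) (((n : ℝ) + 1) ^ (3 * l))) := by gcongr
        _ ≤ (l + 1) * ((l + 1) * min ((8 : ℝ) ^ n) (((n : ℝ) + 1) ^ (3 * l))) := by gcongr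
        _ = _ := by ring
    have hl : ((l : ℝ) + 1) ≤ n + 1 := by exact_mod_cast (by omega : l + 1 ≤ n + 1)
    constructor
    · refine key.trans ?_
      gcongr
      exact min_le_left _ _
    · refine key.trans ?_
      gcongr
      exact min_le_right _ _
  · rw [Mx, if_neg h]
    simp only [ne_eq, OfNat.ofNat_ne_zero, not_false_eq_true, zero_pow]
    constructor <;> positivity

/-- Once all l ≤ n are included, the generating-function identity collapses the sum to the
expectation; the entries with l > n vanish because ∂^l kills degree n. -/
lemma sum_Mx {N n : ℕ} (h : n < N) (m : ℕ) :
    ∑ l ∈ Finset.range N, Mx l m n = if m = 0 ∧ n = 0 then 1 else 0 := by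
  have e : ∑ l ∈ Finset.range N, Mx l m n = ∑ l ∈ Finset.range (n + 1), Mx l m n := by
    symm
    apply Finset.sum_subset
    · intro l; simp; omega
    · intro l _ hl
      rw [Mx, if_neg]
      simpa using hl
  have e2 : ∀ l ∈ Finset.range (n + 1), Mx l m n = √(n.factorial : ℝ) * (1 / √(m.factorial : ℝ)) *
      ∫ x, gam l x * (he (n - l) x / (n - l).factorial) * he m x ∂gaussianReal 0 1 := by
    intro l hl
    rw [Mx, if_pos (by simpa [Nat.lt_succ_iff] using hl)]
    have : ∀ x, gam l x * (he (n - l) x / (n - l).factorial) * he m x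
      = (1 / ((n - l).factorial : ℝ)) * (gam l x * (he (n - l) x * he m x)) := fun x => by
      field_simp
    simp_rw [this]
    rw [integral_const_mul]
    field_simp
  rw [e, Finset.sum_congr rfl e2, ← Finset.mul_sum, ← integral_finsetSum]
  · simp_rw [← Finset.sum_mul, sum_gam_mul_he]
    rw [integral_const_mul]
    have := integral_he_mul_he m 0
    simp only [he_zero, mul_one] at this
    rw [this]
    by_cases hn : n = 0 <;> by_cases hm : m = 0 <;> simp [hn, hm]
  · intro l _
    have e : ∀ x, gam l x * (he (n - l) x / (n - l).factorial) * he m x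
        = ∑ j ∈ Finset.range (l / 2 + 1),
      (-1) ^ l * (1 / ((j.factorial : ℝ) * ((l - 2 * j).factorial : ℝ))) *
        (1 / ((n - l).factorial : ℝ)) * (he (l - 2 * j) x * (he (n - l) x * he m x)) := fun x => by
      rw [gam, Finset.mul_sum, Finset.sum_mul, Finset.sum_mul]
      exact Finset.sum_congr rfl fun j _ => by field_simp
    simp_rw [e]
    exact integrable_finsetSum _ fun j _ => (integrable_he_mul _ _ _).const_mul _

end Matrix

/-! ### Operators on coefficient families and convergence of one series -/

section Family

variable {M : ℕ}

/-- The action of `u ↦ gam l (x k) * ∂ₖˡ u` on Hermite coefficients. -/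
noncomputable def Gam (l : ℕ) (k : Fin M) (c : (Fin M → ℕ) → ℝ) (α : Fin M → ℕ) : ℝ :=
  ∑ n ∈ Finset.Icc (α k) (α k + 2 * l), Mx l (α k) n * c (Function.update α k n)

/-- The action of averaging over the coordinates `κ i` on Hermite coefficients. -/
noncomputable def Qop {n : ℕ} (κ : Fin n → Fin M) (c : (Fin M → ℕ) → ℝ) (α : Fin M → ℕ) : ℝ :=
  if ∀ i, α (κ i) = 0 then c α else 0

/-- The composition of the operators `Gam (J i) (κ i)`. -/
noncomputable def opIter : (n : ℕ) → (Fin n → Fin M) → (Fin n → ℕ) → ((Fin M → ℕ) → ℝ) →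
    (Fin M → ℕ) → ℝ
  | 0, _, _, c => c
  | n + 1, κ, J, c => Gam (J 0) (κ 0) (opIter n (Fin.tail κ) (Fin.tail J) c)

lemma Gam_eq_sum_range {l R : ℕ} (k : Fin M) (c : (Fin M → ℕ) → ℝ) (α : Fin M → ℕ)
    (hR : α k + 2 * l < R) :
    Gam l k c α = ∑ n ∈ Finset.range R, Mx l (α k) n * c (Function.update α k n) := by
  apply Finset.sum_subset
  · intro n; simp; omega
  · intro n _ hn
    by_contra h
    have := Mx_support (left_ne_zero_of_mul h)
    simp at hn
    omega

lemma Gam_comm {k k' : Fin M} (h : k ≠ k') (l l' : ℕ) (c : (Fin M → ℕ) → ℝ) :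
    Gam l k (Gam l' k' c) = Gam l' k' (Gam l k c) := by
  ext α
  simp only [Gam, Finset.mul_sum, Function.update_of_ne h, Function.update_of_ne h.symm]
  rw [Finset.sum_comm]
  refine Finset.sum_congr rfl fun n _ => Finset.sum_congr rfl fun n' _ => ?_
  rw [Function.update_comm h]
  ring

lemma Gam_Qop {n : ℕ} {κ : Fin n → Fin M} {k : Fin M} (h : ∀ i, κ i ≠ k) (l : ℕ)
    (c : (Fin M → ℕ) → ℝ) : Gam l k (Qop κ c) = Qop κ (Gam l k c) := by
  ext α
  simp only [Gam, Qop, Function.update_of_ne (h _)]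
  split_ifs <;> simp

lemma Gam_opIter {n : ℕ} {κ : Fin n → Fin M} {k : Fin M} (h : ∀ i, κ i ≠ k) (l : ℕ)
    (J : Fin n → ℕ) (c : (Fin M → ℕ) → ℝ) :
    Gam l k (opIter n κ J c) = opIter n κ J (Gam l k c) := by
  induction n with
  | zero => rfl
  | succ n ih =>
    rw [opIter, opIter, Gam_comm (h 0).symm, ih (κ := Fin.tail κ) fun i => h i.succ]

lemma Qop_succ {n : ℕ} (κ : Fin (n + 1) → Fin M) (c : (Fin M → ℕ) → ℝ) :
    Qop κ c = Qop (fun _ : Fin 1 => κ 0) (Qop (Fin.tail κ) c) := by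
  ext α
  simp only [Qop, Fin.forall_fin_succ, Fin.tail]
  split_ifs <;> grind

/-- Exchanging the entry of a multi-index at `k` with a free variable. -/
lemma tsum_update_swap (k : Fin M) (f : (Fin M → ℕ) → ℕ → ℝ≥0∞) :
    ∑' α, ∑' n, f α n = ∑' α, ∑' n, f (Function.update α k n) (α k) := by
  rw [← ENNReal.tsum_prod, ← ENNReal.tsum_prod (f := fun α n => f (Function.update α k n) (α k))]
  have hinv : Function.Involutive
      (fun p : (Fin M → ℕ) × ℕ => (Function.update p.1 k p.2, p.1 k)) := fun p => by simp
  exact ((hinv.toPerm).tsum_eq fun p : (Fin M → ℕ) × ℕ => f p.1 p.2).symm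

/-- The coefficient families for which all weighted norms used in the sequel are finite. -/
def Good (c : (Fin M → ℕ) → ℝ) : Prop :=
  ∀ (p : ℕ) (k : Fin M), ∑' α : Fin M → ℕ, ENNReal.ofReal
    ((1 + ∑ i, (α i : ℝ)) ^ p * (81 / 10 : ℝ) ^ α k * c α ^ 2) < ∞

lemma sq_Gam_le (l : ℕ) (k : Fin M) (c : (Fin M → ℕ) → ℝ) (α : Fin M → ℕ) :
    Gam l k c α ^ 2 ≤ (2 * l + 1) * (l + 1) ^ 2 * ∑ n ∈ Finset.Icc (α k) (α k + 2 * l),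
      ((n : ℝ) + 1) ^ (3 * l) * c (Function.update α k n) ^ 2 := by
  refine (sq_sum_le_card_mul_sum_sq (s := Finset.Icc (α k) (α k + 2 * l))).trans ?_
  have hc : ((Finset.Icc (α k) (α k + 2 * l)).card : ℝ) = 2 * l + 1 := by
    rw [Nat.card_Icc, show α k + 2 * l + 1 - α k = 2 * l + 1 by omega]
    push_cast; ring
  rw [hc, mul_assoc]
  refine mul_le_mul_of_nonneg_left ?_ (by positivity)
  rw [Finset.mul_sum]
  refine Finset.sum_le_sum fun n _ => ?_
  rw [mul_pow, ← mul_assoc]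
  exact mul_le_mul_of_nonneg_right (sq_Mx_le l (α k) n).2 (sq_nonneg _)

/-- The operator moves mass from degree n to degrees at most n, so the increasing weights do not
grow. The entries cost (n+1)^(3l) and the count of targets one more factor n + 1, both absorbed by a
larger polynomial power. -/
lemma Good.gam {c : (Fin M → ℕ) → ℝ} (hc : Good c) (l : ℕ) (k : Fin M) : Good (Gam l k c) := by
  intro p k'
  set w : (Fin M → ℕ) → ℝ := fun α => (1 + ∑ i, (α i : ℝ)) ^ p * (81 / 10 : ℝ) ^ α k' with hw
  have hw0 : ∀ α, 0 ≤ w α := fun α => by positivity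
  have hmono : ∀ (β : Fin M → ℕ) m, m ≤ β k → w (Function.update β k m) ≤ w β := by
    intro β m hm
    have hle : ∀ i, Function.update β k m i ≤ β i := by
      intro i
      by_cases hi : i = k
      · subst hi; simpa using hm
      · simp [hi]
    have h1 : ∑ i, ((Function.update β k m i : ℕ) : ℝ) ≤ ∑ i, (β i : ℝ) :=
      Finset.sum_le_sum fun i _ => by exact_mod_cast hle i
    simp only [hw]
    gcongr
    · norm_num
    · exact hle k'
  set K : ℝ := (2 * l + 1) * (l + 1) ^ 2 with hK
  -- The constraint α k ≤ n is kept in the summand below: after the exchange of indices it restricts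
  -- the free variable m to m ≤ β k and makes the inner sum finite.
  have hK0 : 0 ≤ K := by positivity
  set g : (Fin M → ℕ) → ℕ → ℝ≥0∞ := fun α n => if α k ≤ n then
    ENNReal.ofReal (w α * ((n + 1) ^ (3 * l) * c (Function.update α k n) ^ 2)) else 0 with hg
  have step1 : ∀ α, ENNReal.ofReal (w α * Gam l k c α ^ 2)
      ≤ ENNReal.ofReal K * ∑' n, g α n := by
    intro α
    calc ENNReal.ofReal (w α * Gam l k c α ^ 2)
        ≤ ENNReal.ofReal (K * ∑ n ∈ Finset.Icc (α k) (α k + 2 * l),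
            w α * (((n : ℝ) + 1) ^ (3 * l) * c (Function.update α k n) ^ 2)) := by
          apply ENNReal.ofReal_le_ofReal
          rw [← Finset.mul_sum]
          calc w α * Gam l k c α ^ 2 ≤ w α * (K * _) :=
                mul_le_mul_of_nonneg_left (sq_Gam_le l k c α) (hw0 α)
            _ = _ := by ring
      _ = ENNReal.ofReal K * ∑ n ∈ Finset.Icc (α k) (α k + 2 * l), g α n := by
          rw [ENNReal.ofReal_mul hK0, ENNReal.ofReal_sum_of_nonneg]
          · congr 1
            refine Finset.sum_congr rfl fun n hn => ?_
            rw [hg]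
            simp only
            rw [if_pos (Finset.mem_Icc.1 hn).1]
          · intro n _
            have := hw0 α
            positivity
      _ ≤ _ := by gcongr; exact ENNReal.sum_le_tsum _
  have step2 : ∀ β, ∑' m, g (Function.update β k m) (β k) ≤
      ENNReal.ofReal ((1 + ∑ i, (β i : ℝ)) ^ (p + (3 * l + 1)) * (81 / 10 : ℝ) ^ β k' *
        c β ^ 2) := by
    intro β
    have hle : ((β k : ℝ) + 1) ≤ 1 + ∑ i, (β i : ℝ) := by
      have := Finset.single_le_sum (f := fun i => (β i : ℝ)) (fun i _ => Nat.cast_nonneg _)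
        (Finset.mem_univ k)
      linarith
    have e1 : ∀ m, g (Function.update β k m) (β k) ≤ if m ∈ Finset.range (β k + 1) then
        ENNReal.ofReal (w β * (((β k : ℝ) + 1) ^ (3 * l) * c β ^ 2)) else 0 := by
      intro m
      simp only [hg, Function.update_self, Function.update_idem, Function.update_eq_self,
        Finset.mem_range, Nat.lt_succ_iff]
      split_ifs with h
      · apply ENNReal.ofReal_le_ofReal
        exact mul_le_mul_of_nonneg_right (hmono β m h) (by positivity)
      · exact le_rfl
    refine (ENNReal.tsum_le_tsum e1).trans ?_
    rw [tsum_eq_sum (s := Finset.range (β k + 1)) (fun m hm => if_neg hm),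
      Finset.sum_congr rfl (fun m hm => if_pos hm), Finset.sum_const, Finset.card_range,
      nsmul_eq_mul, ← ENNReal.ofReal_natCast, ← ENNReal.ofReal_mul (by positivity)]
    apply ENNReal.ofReal_le_ofReal
    push_cast
    calc ((β k : ℝ) + 1) * (w β * (((β k : ℝ) + 1) ^ (3 * l) * c β ^ 2))
        = w β * ((β k : ℝ) + 1) ^ (3 * l + 1) * c β ^ 2 := by ring
      _ ≤ w β * (1 + ∑ i, (β i : ℝ)) ^ (3 * l + 1) * c β ^ 2 := by
          have := hw0 β
          gcongr
      _ = _ := by simp only [hw]; ring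
  calc _ ≤ ∑' α, ENNReal.ofReal K * ∑' n, g α n := ENNReal.tsum_le_tsum step1
    _ = ENNReal.ofReal K * ∑' β, ∑' m, g (Function.update β k m) (β k) := by
        rw [ENNReal.tsum_mul_left, tsum_update_swap k]
    _ ≤ ENNReal.ofReal K * ∑' β : Fin M → ℕ, ENNReal.ofReal ((1 + ∑ i, (β i : ℝ)) ^
        (p + (3 * l + 1)) * (81 / 10 : ℝ) ^ β k' * c β ^ 2) := by
        gcongr with β; exact step2 β
    _ < ∞ := ENNReal.mul_lt_top ENNReal.ofReal_lt_top (hc _ _)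

lemma Good.qop {c : (Fin M → ℕ) → ℝ} (hc : Good c) {n : ℕ} (κ : Fin n → Fin M) :
    Good (Qop κ c) := by
  intro p k
  refine lt_of_le_of_lt (ENNReal.tsum_le_tsum fun α => ?_) (hc p k)
  apply ENNReal.ofReal_le_ofReal
  refine mul_le_mul_of_nonneg_left ?_ (by positivity)
  simp only [Qop]
  split_ifs
  · exact le_rfl
  · simpa using sq_nonneg (c α)

/-- On input degrees n < N the partial sum is already the averaging operator, so the error sees only
n ≥ N; triangularity adds α k ≤ n. -/
lemma sum_Gam_sub_Qop {N : ℕ} (hN : 0 < N) (k : Fin M) (c : (Fin M → ℕ) → ℝ) (α : Fin M → ℕ) :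
    ∑ l ∈ Finset.range N, Gam l k c α - Qop (fun _ : Fin 1 => k) c α
      = ∑ n ∈ (Finset.range (α k + 2 * N + 1)).filter (fun n => N ≤ n ∧ α k ≤ n),
        (∑ l ∈ Finset.range N, Mx l (α k) n) * c (Function.update α k n) := by
  have e : ∑ l ∈ Finset.range N, Gam l k c α = ∑ n ∈ Finset.range (α k + 2 * N + 1),
      (∑ l ∈ Finset.range N, Mx l (α k) n) * c (Function.update α k n) := by
    simp only [Finset.sum_mul]
    rw [Finset.sum_comm]
    refine Finset.sum_congr rfl fun l hl => ?_
    have := Finset.mem_range.1 hl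
    exact Gam_eq_sum_range k c α (by omega)
  rw [e, ← Finset.sum_filter_add_sum_filter_not (Finset.range (α k + 2 * N + 1)) (fun n => n < N)]
  have e1 : ∑ n ∈ (Finset.range (α k + 2 * N + 1)).filter (fun n => n < N),
      (∑ l ∈ Finset.range N, Mx l (α k) n) * c (Function.update α k n)
      = Qop (fun _ : Fin 1 => k) c α := by
    rw [Finset.sum_eq_single 0]
    · rw [sum_Mx hN]
      simp only [Qop, and_true]
      by_cases h : α k = 0
      · have : Function.update α k 0 = α := by rw [← h, Function.update_eq_self]
        simp [h, this]
      · simp [h]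
    · intro n hn hn0
      rw [sum_Mx (Finset.mem_filter.1 hn).2, if_neg (by tauto), zero_mul]
    · intro h
      exfalso; apply h
      simp [hN]
  rw [e1, add_sub_cancel_left]
  symm
  apply Finset.sum_subset
  · intro n
    simp only [Finset.mem_filter, Finset.mem_range]
    omega
  · intro n hn hn'
    rw [Finset.sum_eq_zero, zero_mul]
    intro l _
    by_contra h
    have := Mx_support h
    simp only [Finset.mem_filter, Finset.mem_range] at hn hn'
    omega

lemma sq_sum_Mx_le {N n : ℕ} (h : N ≤ n) (m : ℕ) :
    (∑ l ∈ Finset.range N, Mx l m n) ^ 2 ≤ (n + 1) ^ 4 * 8 ^ n := by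
  refine (sq_sum_le_card_mul_sum_sq (s := Finset.range N)).trans ?_
  have hs := Finset.sum_le_card_nsmul (Finset.range N) _ _ fun l _ => (sq_Mx_le l m n).1
  rw [nsmul_eq_mul, Finset.card_range] at hs
  rw [Finset.card_range]
  have hN : (N : ℝ) ≤ n + 1 := by exact_mod_cast (by omega : N ≤ n + 1)
  calc (N : ℝ) * ∑ l ∈ Finset.range N, Mx l m n ^ 2
      ≤ (n + 1) * ((n + 1) * ((n + 1) ^ 2 * 8 ^ n)) := by
        refine mul_le_mul hN (hs.trans ?_) (Finset.sum_nonneg fun _ _ => sq_nonneg _) (by positivity)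
        gcongr
    _ = _ := by ring

lemma tsum_tail_tendsto : Tendsto (fun N : ℕ => ∑' n : ℕ, ENNReal.ofReal
    ((((n + N : ℕ) : ℝ) + 1) ^ 5 * (80 / 81) ^ (n + N))) atTop (𝓝 0) := by
  apply ENNReal.tendsto_sum_nat_add (fun n => ENNReal.ofReal (((n : ℝ) + 1) ^ 5 * (80 / 81) ^ n))
  have hs0 : Summable fun n : ℕ => ((n : ℝ) ^ 5 * (80 / 81 : ℝ) ^ n) :=
    summable_pow_mul_geometric_of_norm_lt_one 5
      (by rw [Real.norm_eq_abs, abs_of_pos] <;> norm_num)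
  have hs := (summable_nat_add_iff 1).2 hs0
  have hs' : Summable fun n : ℕ => ((n : ℝ) + 1) ^ 5 * (80 / 81 : ℝ) ^ n := by
    refine (hs.mul_left (81 / 80)).congr fun n => ?_
    push_cast
    rw [pow_succ (80 / 81 : ℝ)]
    ring
  exact hs'.tsum_ofReal_ne_top

/-- Cauchy–Schwarz with the weight 8.1^n, which exceeds the growth 8^n of the squared entries by the
ratio 81/80. Summing over the output degree m ≤ n raises (n+1)^4 to (n+1)^5 and leaves the tail of a
convergent series times the finite weighted norm `A`. -/
lemma tendsto_sum_Gam {c : (Fin M → ℕ) → ℝ} (hc : Good c) (k : Fin M) :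
    Tendsto (fun N => ∑' α, ENNReal.ofReal
      ((∑ l ∈ Finset.range N, Gam l k c α - Qop (fun _ : Fin 1 => k) c α) ^ 2)) atTop (𝓝 0) := by
  set A : ℝ≥0∞ := ∑' α : Fin M → ℕ, ENNReal.ofReal ((81 / 10 : ℝ) ^ α k * c α ^ 2) with hA
  have hAtop : A ≠ ∞ := by
    have := (hc 0 k).ne
    simpa using this
  set f : ℕ → ℕ → ℕ → ℝ≥0∞ := fun N m n => if N ≤ n ∧ m ≤ n then
    ENNReal.ofReal (((n : ℝ) + 1) ^ 4 * (80 / 81) ^ n) else 0 with hf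
  have key : ∀ N, 0 < N → ∑' α, ENNReal.ofReal
      ((∑ l ∈ Finset.range N, Gam l k c α - Qop (fun _ : Fin 1 => k) c α) ^ 2)
      ≤ (∑' n : ℕ, ENNReal.ofReal ((((n + N : ℕ) : ℝ) + 1) ^ 5 * (80 / 81) ^ (n + N))) * A := by
    intro N hN
    have h1 : ∀ α, ENNReal.ofReal
        ((∑ l ∈ Finset.range N, Gam l k c α - Qop (fun _ : Fin 1 => k) c α) ^ 2)
        ≤ (∑' n, f N (α k) n) *
          ∑' n : ℕ, ENNReal.ofReal ((81 / 10 : ℝ) ^ n * c (Function.update α k n) ^ 2) := by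
      intro α
      rw [sum_Gam_sub_Qop hN]
      set T := (Finset.range (α k + 2 * N + 1)).filter (fun n => N ≤ n ∧ α k ≤ n) with hT
      have cs : (∑ n ∈ T, (∑ l ∈ Finset.range N, Mx l (α k) n) * c (Function.update α k n)) ^ 2
          ≤ (∑ n ∈ T, ((n : ℝ) + 1) ^ 4 * (80 / 81) ^ n) *
            ∑ n ∈ T, (81 / 10 : ℝ) ^ n * c (Function.update α k n) ^ 2 := by
        apply Finset.sum_sq_le_sum_mul_sum_of_sq_le_mul
        · intro n _; positivity
        · intro n _; positivity
        · intro n hn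
          rw [mul_pow]
          refine (mul_le_mul_of_nonneg_right (sq_sum_Mx_le (Finset.mem_filter.1 hn).2.1 _)
            (sq_nonneg _)).trans (le_of_eq ?_)
          rw [show (8 : ℝ) = 80 / 81 * (81 / 10) by norm_num, mul_pow]
          ring
      refine (ENNReal.ofReal_le_ofReal cs).trans ?_
      rw [ENNReal.ofReal_mul (Finset.sum_nonneg fun _ _ => by positivity),
        ENNReal.ofReal_sum_of_nonneg (fun _ _ => by positivity),
        ENNReal.ofReal_sum_of_nonneg (fun _ _ => by positivity)]
      gcongr
      · refine le_trans (le_of_eq ?_) (ENNReal.sum_le_tsum T)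
        refine Finset.sum_congr rfl fun n hn => ?_
        simp only [hf]
        rw [if_pos (Finset.mem_filter.1 hn).2]
      · exact ENNReal.sum_le_tsum T
    have h2 : ∑' m, ∑' n, f N m n
        ≤ ∑' n : ℕ, ENNReal.ofReal ((((n + N : ℕ) : ℝ) + 1) ^ 5 * (80 / 81) ^ (n + N)) := by
      rw [ENNReal.tsum_comm]
      have e : ∀ n, ∑' m, f N m n
          = if N ≤ n then ENNReal.ofReal (((n : ℝ) + 1) ^ 5 * (80 / 81) ^ n) else 0 := by
        intro n
        rw [tsum_eq_sum (s := Finset.range (n + 1))]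
        · simp only [hf]
          split_ifs with h
          · rw [Finset.sum_congr rfl (fun m hm => if_pos ⟨h, by simpa [Nat.lt_succ_iff] using hm⟩),
              Finset.sum_const, Finset.card_range, nsmul_eq_mul, ← ENNReal.ofReal_natCast,
              ← ENNReal.ofReal_mul (by positivity)]
            congr 1
            push_cast
            ring
          · exact Finset.sum_eq_zero fun m _ => if_neg fun hh => h hh.1
        · intro m hm
          simp only [hf]
          rw [if_neg]
          simp at hm
          omega
      simp_rw [e]
      rw [← ENNReal.summable.sum_add_tsum_nat_add' (k := N), Finset.sum_eq_zero, zero_add]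
      · refine ENNReal.tsum_le_tsum fun n => ?_
        rw [if_pos (by omega)]
      · intro n hn
        rw [if_neg (by simpa using hn)]
    calc _ ≤ ∑' α, (∑' n, f N (α k) n) *
          ∑' n : ℕ, ENNReal.ofReal ((81 / 10 : ℝ) ^ n * c (Function.update α k n) ^ 2) :=
          ENNReal.tsum_le_tsum h1
      _ = ∑' α, ∑' n : ℕ, (∑' n, f N (α k) n) *
          ENNReal.ofReal ((81 / 10 : ℝ) ^ n * c (Function.update α k n) ^ 2) := by
          simp_rw [ENNReal.tsum_mul_left]
      _ = ∑' β : Fin M → ℕ, ∑' m : ℕ, (∑' n, f N m n) *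
          ENNReal.ofReal ((81 / 10 : ℝ) ^ β k * c β ^ 2) := by
          -- The first factor depends on the output degree only and the second on the input index
          -- only, so after the exchange the double sum is a product.
          rw [tsum_update_swap k]
          simp
      _ = (∑' m, ∑' n, f N m n) * A := by
          simp_rw [ENNReal.tsum_mul_right, ENNReal.tsum_mul_left, hA]
      _ ≤ _ := by gcongr
  have lim := ENNReal.Tendsto.mul_const (b := A) tsum_tail_tendsto (Or.inr hAtop)
  rw [zero_mul] at lim
  refine tendsto_of_tendsto_of_tendsto_of_le_of_le' tendsto_const_nhds lim
    (Eventually.of_forall fun _ => zero_le) ?_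
  filter_upwards [eventually_gt_atTop 0] with N hN using key N hN

end Family

/-! ### The Hermite basis of L² of the Gaussian measure on ℝ^M -/

section MultiDim

/-- The standard Gaussian measure on `Fin M → ℝ`. -/
noncomputable abbrev gau (M : ℕ) : Measure (Fin M → ℝ) := Measure.pi fun _ => gaussianReal 0 1

/-- The normalised Hermite functions. -/
noncomputable def hb1 (n : ℕ) (x : ℝ) : ℝ := he n x / √(n.factorial : ℝ)

variable {M : ℕ}

/-- The products of normalised Hermite functions. -/
noncomputable def hb (α : Fin M → ℕ) (x : Fin M → ℝ) : ℝ := ∏ i, hb1 (α i) (x i)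

/-- The coefficients of a function in the Hermite basis. -/
noncomputable def coef (u : (Fin M → ℝ) → ℝ) (α : Fin M → ℕ) : ℝ := ∫ x, u x * hb α x ∂gau M

@[fun_prop] lemma continuous_hb1 (n : ℕ) : Continuous (hb1 n) := by unfold hb1; fun_prop

@[fun_prop] lemma continuous_hb (α : Fin M → ℕ) : Continuous (hb α) := by unfold hb; fun_prop

lemma hb1_zero (x : ℝ) : hb1 0 x = 1 := by simp [hb1]

lemma mul_hb1 (n : ℕ) (x : ℝ) :
    x * hb1 n x = √(n + 1 : ℝ) * hb1 (n + 1) x + √(n : ℝ) * hb1 (n - 1) x := by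
  have h := mul_he n x
  simp only [hb1]
  rw [← mul_div_assoc, h, Nat.factorial_succ]
  push_cast
  rw [Real.sqrt_mul (by positivity)]
  have h1 : √((n : ℝ) + 1) ≠ 0 := by positivity
  cases n with
  | zero => simp
  | succ n =>
    rw [Nat.factorial_succ]
    push_cast
    rw [Real.sqrt_mul (by positivity)]
    have h2 : √((n : ℝ) + 1) ≠ 0 := by positivity
    have h3 : √(n.factorial : ℝ) ≠ 0 := by positivity
    have h4 : √((n : ℝ) + 1) * √((n : ℝ) + 1) = n + 1 := Real.mul_self_sqrt (by positivity)
    push_cast at h1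
    field_simp
    rw [pow_two, h4]
    ring

lemma hb_update (α : Fin M → ℕ) (k : Fin M) (n : ℕ) (x : Fin M → ℝ) :
    hb (Function.update α k n) x = hb1 n (x k) * ∏ i ∈ Finset.univ.erase k, hb1 (α i) (x i) := by
  rw [hb, ← Finset.mul_prod_erase _ _ (Finset.mem_univ k), Function.update_self]
  congr 1
  refine Finset.prod_congr rfl fun i hi => ?_
  rw [Function.update_of_ne (Finset.ne_of_mem_erase hi)]

lemma hb_eq (α : Fin M → ℕ) (k : Fin M) (x : Fin M → ℝ) :
    hb α x = hb1 (α k) (x k) * ∏ i ∈ Finset.univ.erase k, hb1 (α i) (x i) := by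
  rw [← hb_update, Function.update_eq_self]

lemma mul_hb (k : Fin M) (α : Fin M → ℕ) (x : Fin M → ℝ) :
    x k * hb α x = √(α k + 1 : ℝ) * hb (Function.update α k (α k + 1)) x
      + √(α k : ℝ) * hb (Function.update α k (α k - 1)) x := by
  rw [hb_eq α k, hb_update, hb_update, ← mul_assoc, mul_hb1]
  ring

lemma integral_hb1_mul (m n : ℕ) :
    ∫ x, hb1 m x * hb1 n x ∂gaussianReal 0 1 = if m = n then 1 else 0 := by
  have : ∀ x, hb1 m x * hb1 n x = (1 / (√(m.factorial : ℝ) * √(n.factorial : ℝ))) *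
      (he m x * he n x) := fun x => by simp only [hb1]; field_simp
  simp_rw [this]
  rw [integral_const_mul, integral_he_mul_he]
  split_ifs with h
  · subst h
    rw [Real.mul_self_sqrt (by positivity)]
    field_simp
  · simp

lemma integral_hb_mul (α β : Fin M → ℕ) :
    ∫ x, hb α x * hb β x ∂gau M = if α = β then 1 else 0 := by
  simp only [hb, ← Finset.prod_mul_distrib]
  rw [integral_fintype_prod_eq_prod (μ := fun _ => gaussianReal 0 1)
    (fun i x => hb1 (α i) x * hb1 (β i) x)]
  simp_rw [integral_hb1_mul]
  rw [Finset.prod_ite_zero]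
  simp [funext_iff]

/-- Functions bounded by a multiple of `exp (t * ∑ |x i|)`. -/
def ExpBdd (f : (Fin M → ℝ) → ℝ) : Prop :=
  Continuous f ∧ ∃ C t : ℝ, ∀ x, |f x| ≤ C * Real.exp (t * ∑ i, |x i|)

lemma ExpBdd.mul {f g : (Fin M → ℝ) → ℝ} (hf : ExpBdd f) (hg : ExpBdd g) :
    ExpBdd fun x => f x * g x := by
  obtain ⟨hf, C, t, h⟩ := hf
  obtain ⟨hg, D, s, h'⟩ := hg
  refine ⟨hf.mul hg, C * D, t + s, fun x => ?_⟩
  rw [abs_mul, add_mul, Real.exp_add]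
  calc |f x| * |g x| ≤ (C * Real.exp (t * ∑ i, |x i|)) * (D * Real.exp (s * ∑ i, |x i|)) :=
        mul_le_mul (h x) (h' x) (abs_nonneg _) ((abs_nonneg _).trans (h x))
    _ = _ := by ring

lemma ExpBdd.const (c : ℝ) : ExpBdd fun _ : Fin M → ℝ => c :=
  ⟨continuous_const, |c|, 0, fun x => by simp⟩

lemma ExpBdd.prod {s : Finset (Fin M)} {f : Fin M → (Fin M → ℝ) → ℝ} (hf : ∀ i, ExpBdd (f i)) :
    ExpBdd fun x => ∏ i ∈ s, f i x := by
  induction s using Finset.induction_on with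
  | empty => simpa using ExpBdd.const 1
  | insert i s hi ih =>
    simp_rw [Finset.prod_insert hi]
    exact (hf i).mul ih

lemma ExpBdd.of_eval (p : Polynomial ℝ) (k : Fin M) : ExpBdd fun x : Fin M → ℝ => p.eval (x k) := by
  obtain ⟨C, hC, h⟩ := exists_eval_le_exp p
  refine ⟨p.continuous.comp (continuous_apply k), C, 1, fun x => (h (x k)).trans ?_⟩
  gcongr
  rw [one_mul]
  exact Finset.single_le_sum (f := fun i => |x i|) (fun i _ => abs_nonneg _) (Finset.mem_univ k)

lemma ExpBdd.coord (k : Fin M) : ExpBdd fun x : Fin M → ℝ => x k := by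
  simpa using ExpBdd.of_eval Polynomial.X k

lemma ExpBdd.hb1 (n : ℕ) (k : Fin M) : ExpBdd fun x : Fin M → ℝ => hb1 n (x k) := by
  have := (ExpBdd.of_eval (hePoly n) k).mul (ExpBdd.const (√(n.factorial : ℝ))⁻¹)
  simpa [BTE.hb1, he, div_eq_mul_inv] using this

lemma ExpBdd.hb (α : Fin M → ℕ) : ExpBdd (hb α) := ExpBdd.prod fun i => ExpBdd.hb1 (α i) i

lemma integrable_exp_sum_abs (t : ℝ) :
    Integrable (fun x : Fin M → ℝ => Real.exp (t * ∑ i, |x i|)) (gau M) := by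
  simp_rw [Finset.mul_sum, Real.exp_sum]
  exact Integrable.fintype_prod (f := fun _ x => Real.exp (t * |x|)) fun _ => integrable_exp_abs t

lemma ExpBdd.integrable {f : (Fin M → ℝ) → ℝ} (hf : ExpBdd f) : Integrable f (gau M) := by
  obtain ⟨hf, C, t, h⟩ := hf
  exact ((integrable_exp_sum_abs t).const_mul C).mono' hf.aestronglyMeasurable
    (Eventually.of_forall h)

lemma ExpBdd.memLp {f : (Fin M → ℝ) → ℝ} (hf : ExpBdd f) : MemLp f 2 (gau M) := by
  rw [memLp_two_iff_integrable_sq hf.1.aestronglyMeasurable]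
  simp_rw [pow_two]
  exact (hf.mul hf).integrable

lemma ExpBdd.integrable_mul {f u : (Fin M → ℝ) → ℝ} (hf : ExpBdd f) (hu : MemLp u 2 (gau M)) :
    Integrable (fun x => u x * f x) (gau M) := hu.integrable_mul hf.memLp

/-- The span of the Hermite products. -/
noncomputable def hbSpan (M : ℕ) : Submodule ℝ ((Fin M → ℝ) → ℝ) :=
  Submodule.span ℝ (Set.range hb)

lemma coord_mul_mem_hbSpan (k : Fin M) {v : (Fin M → ℝ) → ℝ} (hv : v ∈ hbSpan M) :
    (fun x => x k * v x) ∈ hbSpan M := by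
  induction hv using Submodule.span_induction with
  | mem v h =>
    obtain ⟨α, rfl⟩ := h
    have : (fun x => x k * hb α x) = √(α k + 1 : ℝ) • hb (Function.update α k (α k + 1))
      + √(α k : ℝ) • hb (Function.update α k (α k - 1)) := by
      ext x; simp [mul_hb]
    rw [this]
    exact add_mem (Submodule.smul_mem _ _ (Submodule.subset_span ⟨_, rfl⟩))
      (Submodule.smul_mem _ _ (Submodule.subset_span ⟨_, rfl⟩))
  | zero =>
    have : (fun x : Fin M → ℝ => x k * (0 : (Fin M → ℝ) → ℝ) x) = 0 := by ext x; simp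
    rw [this]
    exact (hbSpan M).zero_mem
  | add v w _ _ hv hw =>
    have : (fun x : Fin M → ℝ => x k * (v + w) x) = (fun x => x k * v x) + fun x => x k * w x := by
      ext x; simp [mul_add]
    rw [this]
    exact add_mem hv hw
  | smul a v _ hv =>
    have : (fun x => x k * (a • v) x) = a • fun x => x k * v x := by
      ext x; simp; ring
    rw [this]
    exact Submodule.smul_mem _ _ hv

lemma dual_pow_mem_hbSpan (L : StrongDual ℝ (Fin M → ℝ)) (n : ℕ) :
    (fun x => L x ^ n) ∈ hbSpan M := by
  induction n with
  | zero =>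
    refine Submodule.subset_span ⟨0, ?_⟩
    ext x
    simp [hb, hb1_zero]
  | succ n ih =>
    have : (fun x => L x ^ (n + 1)) = ∑ k, L (Pi.single k 1) • fun x : Fin M → ℝ =>
        x k * L x ^ n := by
      ext x
      have hx : L x = ∑ k, L (Pi.single k 1) * x k := by
        conv_lhs => rw [pi_eq_sum_univ' x]
        simp [map_sum, mul_comm]
      rw [pow_succ']
      conv_lhs => rw [hx]
      simp [Finset.sum_mul, Finset.sum_apply, mul_assoc]
      simp [hx]
    rw [this]
    exact Submodule.sum_mem _ fun k _ => Submodule.smul_mem _ _ (coord_mul_mem_hbSpan k ih)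

lemma abs_dual_le (L : StrongDual ℝ (Fin M → ℝ)) (x : Fin M → ℝ) :
    |L x| ≤ ‖L‖ * ∑ i, |x i| := by
  refine (L.le_opNorm x).trans ?_
  gcongr
  exact (pi_norm_le_iff_of_nonneg (Finset.sum_nonneg fun _ _ => abs_nonneg _)).2 fun i =>
    Finset.single_le_sum (f := fun i => |x i|) (fun i _ => abs_nonneg _) (Finset.mem_univ i)

lemma integral_mul_hbSpan {f : (Fin M → ℝ) → ℝ}
    (hf : ∀ g, ExpBdd g → Integrable (fun x => f x * g x) (gau M)) (h0 : ∀ α, coef f α = 0) :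
    ∀ v ∈ hbSpan M, Integrable (fun x => f x * v x) (gau M) ∧ ∫ x, f x * v x ∂gau M = 0 := by
  intro v hv
  induction hv using Submodule.span_induction with
  | mem v h =>
    obtain ⟨α, rfl⟩ := h
    exact ⟨hf _ (ExpBdd.hb α), h0 α⟩
  | zero => simp
  | add v w _ _ hv hw =>
    simp only [Pi.add_apply, mul_add]
    exact ⟨hv.1.add hw.1, by rw [integral_add hv.1 hw.1, hv.2, hw.2, add_zero]⟩
  | smul a v _ hv =>
    have : ∀ x, f x * (a • v) x = a * (f x * v x) := fun x => by simp; ring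
    simp_rw [this]
    exact ⟨hv.1.const_mul a, by rw [integral_const_mul, hv.2, mul_zero]⟩

/-- Powers of a linear form lie in the span of the Hermite products, so every term of the
exponential series integrates to zero; the exponential moments of f allow termwise integration. -/
lemma integral_mul_exp_dual {f : (Fin M → ℝ) → ℝ}
    (hf : ∀ g, ExpBdd g → Integrable (fun x => f x * g x) (gau M)) (h0 : ∀ α, coef f α = 0)
    (L : StrongDual ℝ (Fin M → ℝ)) :
    ∫ x, (f x : ℂ) * Complex.exp (L x * Complex.I) ∂gau M = 0 := by
  have hfi : Integrable f (gau M) := by simpa using hf _ (ExpBdd.const 1)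
  have hexp : Integrable (fun x => |f x| * Real.exp |L x|) (gau M) := by
    have := (hf _ ⟨by fun_prop, 1, ‖L‖, fun x => by
      rw [abs_of_pos (Real.exp_pos _), one_mul]⟩ : Integrable
        (fun x => f x * Real.exp (‖L‖ * ∑ i, |x i|)) (gau M)).abs
    refine this.mono' (hfi.1.norm.mul (by fun_prop)) (Eventually.of_forall fun x => ?_)
    rw [Real.norm_eq_abs, abs_mul, abs_abs, abs_mul, abs_of_pos (Real.exp_pos _),
      abs_of_pos (Real.exp_pos _)]
    gcongr
    exact abs_dual_le L x
  have hnorm : ∀ (n : ℕ) (x : Fin M → ℝ), ‖(f x : ℂ) * ((L x * Complex.I) ^ n / n.factorial)‖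
      = |f x| * (|L x| ^ n / n.factorial) := fun n x => by simp
  have hmeas : ∀ n : ℕ, AEStronglyMeasurable
      (fun x => (f x : ℂ) * ((L x * Complex.I) ^ n / n.factorial)) (gau M) := fun n =>
    (Complex.continuous_ofReal.comp_aestronglyMeasurable hfi.1).mul
      (Continuous.aestronglyMeasurable (by fun_prop))
  have hbsum : ∀ x : Fin M → ℝ, Summable fun n : ℕ => |f x| * (|L x| ^ n / n.factorial) :=
    fun x => (Real.summable_pow_div_factorial |L x|).mul_left |f x|
  have hbint : Integrable (fun x => ∑' n : ℕ, |f x| * (|L x| ^ n / n.factorial)) (gau M) := by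
    refine hexp.congr (Eventually.of_forall fun x => ?_)
    simp only
    rw [tsum_mul_left, Real.exp_eq_exp_ℝ, NormedSpace.exp_eq_tsum_div]
  have hlim : ∀ x : Fin M → ℝ, HasSum
      (fun n : ℕ => (f x : ℂ) * ((L x * Complex.I) ^ n / n.factorial))
      ((f x : ℂ) * Complex.exp (L x * Complex.I)) := fun x => by
    have := NormedSpace.expSeries_div_hasSum_exp (L x * Complex.I : ℂ)
    rw [← Complex.exp_eq_exp_ℂ] at this
    exact HasSum.mul_left (f x : ℂ) this
  have hsum : HasSum (fun n : ℕ => ∫ x, (f x : ℂ) * ((L x * Complex.I) ^ n / n.factorial) ∂gau M)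
      (∫ x, (f x : ℂ) * Complex.exp (L x * Complex.I) ∂gau M) := by
    obtain ⟨b, hb⟩ : ∃ b : ℕ → (Fin M → ℝ) → ℝ,
      b = fun n x => |f x| * (|L x| ^ n / n.factorial) := ⟨_, rfl⟩
    obtain ⟨F, hF⟩ : ∃ F : ℕ → (Fin M → ℝ) → ℂ,
      F = fun n x => (f x : ℂ) * ((L x * Complex.I) ^ n / n.factorial) := ⟨_, rfl⟩
    have hF' : ∀ n x, (f x : ℂ) * ((L x * Complex.I) ^ n / n.factorial) = F n x := by simp [hF]
    have hb' : ∀ n x, |f x| * (|L x| ^ n / n.factorial) = b n x := by simp [hb]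
    simp only [hF', hb'] at hmeas hnorm hbsum hbint hlim ⊢
    exact hasSum_integral_of_dominated_convergence b hmeas
      (fun n => Eventually.of_forall fun x => (hnorm n x).le)
      (Eventually.of_forall hbsum) hbint (Eventually.of_forall hlim)
  have hz : ∀ n : ℕ, ∫ x, (f x : ℂ) * ((L x * Complex.I) ^ n / n.factorial) ∂gau M = 0 := by
    intro n
    have e : ∀ x, (f x : ℂ) * ((L x * Complex.I) ^ n / n.factorial)
        = (Complex.I ^ n / n.factorial) * ((f x * L x ^ n : ℝ) : ℂ) := fun x => by
      push_cast; ring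
    simp_rw [e]
    rw [integral_const_mul, integral_complex_ofReal, (integral_mul_hbSpan hf h0 _ (dual_pow_mem_hbSpan L n)).2]
    simp
  simp_rw [hz] at hsum
  exact hsum.unique hasSum_zero

/-- A function with exponential moments against the Gaussian measure which is orthogonal to all
Hermite products vanishes almost everywhere. -/
lemma ae_eq_zero_of_coef_eq_zero {f : (Fin M → ℝ) → ℝ}
    (hf : ∀ g, ExpBdd g → Integrable (fun x => f x * g x) (gau M)) (h0 : ∀ α, coef f α = 0) :
    f =ᵐ[gau M] 0 := by
  have hfi : Integrable f (gau M) := by simpa using hf _ (ExpBdd.const 1)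
  have hchar := integral_mul_exp_dual hf h0
  have hf1 : AEMeasurable (fun x => ENNReal.ofReal (f x)) (gau M) := hfi.1.aemeasurable.ennreal_ofReal
  have hf2 : AEMeasurable (fun x => ENNReal.ofReal (-f x)) (gau M) :=
    hfi.1.aemeasurable.neg.ennreal_ofReal
  have fin1 : ∫⁻ x, ENNReal.ofReal (f x) ∂gau M ≠ ∞ := hfi.lintegral_lt_top.ne
  have fin2 : ∫⁻ x, ENNReal.ofReal (-f x) ∂gau M ≠ ∞ := hfi.neg.lintegral_lt_top.ne
  have := isFiniteMeasure_withDensity fin1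
  have := isFiniteMeasure_withDensity fin2
  -- The vanishing Fourier transform says that the finite measures with densities f⁺ and f⁻ have
  -- equal characteristic functions, hence coincide.
  have hmeas : (gau M).withDensity (fun x => ENNReal.ofReal (f x))
      = (gau M).withDensity fun x => ENNReal.ofReal (-f x) := by
    apply Measure.ext_of_charFunDual
    ext L
    rw [charFunDual_apply, charFunDual_apply,
      integral_withDensity_eq_integral_toReal_smul₀ hf1 (by simp),
      integral_withDensity_eq_integral_toReal_smul₀ hf2 (by simp), ← sub_eq_zero, ← integral_sub]
    · rw [← hchar L]
      congr with x
      rw [← sub_smul, ENNReal.toReal_ofReal', ENNReal.toReal_ofReal', max_zero_sub_max_neg_zero_eq_self]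
      simp
    · refine (hfi.norm).mono' ?_ (Eventually.of_forall fun x => ?_)
      · exact (hf1.ennreal_toReal.aestronglyMeasurable).smul (by fun_prop)
      · rw [norm_smul, Complex.norm_exp_ofReal_mul_I, mul_one, ENNReal.toReal_ofReal']
        simp only [Real.norm_eq_abs]
        rw [abs_of_nonneg (le_max_right _ _)]
        exact max_le (le_abs_self _) (abs_nonneg _)
    · refine (hfi.norm).mono' ?_ (Eventually.of_forall fun x => ?_)
      · exact (hf2.ennreal_toReal.aestronglyMeasurable).smul (by fun_prop)
      · rw [norm_smul, Complex.norm_exp_ofReal_mul_I, mul_one, ENNReal.toReal_ofReal']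
        simp only [Real.norm_eq_abs]
        rw [abs_of_nonneg (le_max_right _ _)]
        exact max_le (neg_le_abs _) (abs_nonneg _)
  rw [withDensity_eq_iff hf1 hf2 fin1] at hmeas
  filter_upwards [hmeas] with x hx
  rcases lt_trichotomy (f x) 0 with h | h | h
  · rw [ENNReal.ofReal_of_nonpos h.le] at hx
    have := ENNReal.ofReal_pos.2 (neg_pos.2 h)
    rw [← hx] at this
    exact absurd this (lt_irrefl _)
  · exact h
  · rw [ENNReal.ofReal_of_nonpos (neg_nonpos.2 h.le)] at hx
    have := ENNReal.ofReal_pos.2 h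
    rw [hx] at this
    exact absurd this (lt_irrefl _)

lemma memLp_hb (α : Fin M → ℕ) : MemLp (hb α) 2 (gau M) := (ExpBdd.hb α).memLp

lemma inner_toLp_hb {u : (Fin M → ℝ) → ℝ} (hu : MemLp u 2 (gau M)) (α : Fin M → ℕ) :
    inner ℝ ((memLp_hb α).toLp (hb α)) (hu.toLp u) = coef u α := by
  rw [L2.inner_def, coef]
  apply integral_congr_ae
  filter_upwards [hu.coeFn_toLp, (memLp_hb α).coeFn_toLp] with x h1 h2
  rw [h1, h2]
  simp

lemma orthonormal_hb : Orthonormal ℝ fun α : Fin M → ℕ => (memLp_hb α).toLp (hb α) := by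
  rw [orthonormal_iff_ite]
  intro α β
  rw [inner_toLp_hb (memLp_hb β), coef, integral_hb_mul]
  simp [eq_comm]

/-- The Hilbert basis of Hermite products. -/
noncomputable def hbBasis (M : ℕ) : HilbertBasis (Fin M → ℕ) ℝ (Lp ℝ 2 (gau M)) :=
  HilbertBasis.mkOfOrthogonalEqBot orthonormal_hb (by
    rw [Submodule.eq_bot_iff]
    intro f hf
    rw [Submodule.mem_orthogonal] at hf
    have hc : ∀ α, coef f α = 0 := by
      intro α
      have := hf _ (Submodule.subset_span ⟨α, rfl⟩)
      rw [← Lp.toLp_coeFn f (Lp.memLp f), inner_toLp_hb] at this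
      exact this
    have := ae_eq_zero_of_coef_eq_zero (fun g hg => hg.integrable_mul (Lp.memLp f)) hc
    exact (Lp.eq_zero_iff_ae_eq_zero).2 this)

lemma hbBasis_apply (α : Fin M → ℕ) : hbBasis M α = (memLp_hb α).toLp (hb α) := by
  simp [hbBasis]

lemma hbBasis_repr {u : (Fin M → ℝ) → ℝ} (hu : MemLp u 2 (gau M)) (α : Fin M → ℕ) :
    (hbBasis M).repr (hu.toLp u) α = coef u α := by
  rw [HilbertBasis.repr_apply_apply, hbBasis_apply, inner_toLp_hb]

/-- Parseval's identity. -/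
lemma eLpNorm_sq_eq {u : (Fin M → ℝ) → ℝ} (hu : MemLp u 2 (gau M)) :
    eLpNorm u 2 (gau M) ^ 2 = ∑' α, ENNReal.ofReal (coef u α ^ 2) := by
  have h := (hbBasis M).hasSum_inner_mul_inner (hu.toLp u) (hu.toLp u)
  have e : ∀ α, inner ℝ (hu.toLp u) (hbBasis M α) * inner ℝ (hbBasis M α) (hu.toLp u)
      = coef u α ^ 2 := fun α => by
    rw [real_inner_comm, hbBasis_apply, inner_toLp_hb, pow_two]
  simp_rw [e] at h
  rw [← ENNReal.ofReal_tsum_of_nonneg (fun α => sq_nonneg _) h.summable, h.tsum_eq,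
    real_inner_self_eq_norm_sq, Lp.norm_toLp, ← ENNReal.toReal_pow,
    ENNReal.ofReal_toReal (ENNReal.pow_ne_top hu.2.ne)]

/-- The Riesz–Fischer theorem for the Hermite basis. -/
lemma exists_memLp_coef_eq {c : (Fin M → ℕ) → ℝ} (hc : ∑' α, ENNReal.ofReal (c α ^ 2) < ∞) :
    ∃ u, MemLp u 2 (gau M) ∧ coef u = c := by
  have hs : Summable fun α => c α ^ 2 := by
    have := ENNReal.summable_toReal hc.ne
    simpa [ENNReal.toReal_ofReal, sq_nonneg] using this
  have hm : Memℓp c 2 := by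
    rw [memℓp_gen_iff (by norm_num)]
    simpa using hs
  set f := (hbBasis M).repr.symm ⟨c, hm⟩ with hf
  refine ⟨f, Lp.memLp f, ?_⟩
  ext α
  rw [← hbBasis_repr (Lp.memLp f), Lp.toLp_coeFn, hf, LinearIsometryEquiv.apply_symm_apply]

end MultiDim

/-! ### Gaussian integration by parts and square-integrable smooth functions -/

section Parts

variable {M : ℕ}

/-- The partial derivative in the direction of the `k`-th coordinate. -/
noncomputable def pd (k : Fin M) (u : (Fin M → ℝ) → ℝ) : (Fin M → ℝ) → ℝ :=
  fun x => fderiv ℝ u x (Pi.single k 1)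

/-- The density of the standard Gaussian measure. -/
noncomputable def dens (x : Fin M → ℝ) : ℝ := ∏ i, gaussianPDFReal 0 1 (x i)

lemma dens_nonneg (x : Fin M → ℝ) : 0 ≤ dens x :=
  Finset.prod_nonneg fun _ _ => gaussianPDFReal_nonneg 0 1 _

lemma measurable_dens : Measurable (dens : (Fin M → ℝ) → ℝ) :=
  Finset.measurable_prod _ fun i _ => (measurable_gaussianPDFReal 0 1).comp (measurable_pi_apply i)

lemma gau_eq_withDensity : gau M = volume.withDensity fun x => ENNReal.ofReal (dens x) := by
  apply Measure.pi_eq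
  intro s hs
  rw [withDensity_apply _ (MeasurableSet.univ_pi hs), volume_pi, Measure.restrict_pi_pi,
    ← ofReal_integral_eq_lintegral_ofReal]
  · simp only [dens]
    rw [integral_fintype_prod_eq_prod (fun _ x => gaussianPDFReal 0 1 x),
      ENNReal.ofReal_prod_of_nonneg]
    · exact Finset.prod_congr rfl fun i _ => (gaussianReal_apply_eq_integral 0 one_ne_zero _).symm
    · intro i _
      exact integral_nonneg fun x => gaussianPDFReal_nonneg 0 1 x
  · exact Integrable.fintype_prod (f := fun _ x => gaussianPDFReal 0 1 x)
      fun i => (integrable_gaussianPDFReal 0 1).restrict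
  · exact Eventually.of_forall dens_nonneg

lemma integrable_gau_iff (f : (Fin M → ℝ) → ℝ) :
    Integrable f (gau M) ↔ Integrable fun x => f x * dens x := by
  rw [gau_eq_withDensity, integrable_withDensity_iff_integrable_smul'
    measurable_dens.ennreal_ofReal (by simp)]
  refine integrable_congr (Eventually.of_forall fun x => ?_)
  simp only [smul_eq_mul]
  rw [ENNReal.toReal_ofReal (dens_nonneg x), mul_comm]

lemma integral_gau_eq (f : (Fin M → ℝ) → ℝ) : ∫ x, f x ∂gau M = ∫ x, f x * dens x := by
  rw [gau_eq_withDensity, integral_withDensity_eq_integral_toReal_smul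
    measurable_dens.ennreal_ofReal (by simp)]
  congr with x
  rw [ENNReal.toReal_ofReal (dens_nonneg x), smul_eq_mul, mul_comm]

lemma hasDerivAt_hb1_mul_pdf (n : ℕ) (x : ℝ) :
    HasDerivAt (fun x => hb1 n x * gaussianPDFReal 0 1 x)
      (-(√(n + 1 : ℝ) * hb1 (n + 1) x * gaussianPDFReal 0 1 x)) x := by
  have h1 : HasDerivAt (hb1 n) (n * he (n - 1) x / √(n.factorial : ℝ)) x :=
    (hasDerivAt_he n x).div_const _
  refine (h1.mul (hasDerivAt_gaussianPDFReal x)).congr_deriv ?_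
  have h2 := mul_he n x
  have h3 : √(n + 1 : ℝ) * hb1 (n + 1) x = he (n + 1) x / √(n.factorial : ℝ) := by
    rw [hb1, Nat.factorial_succ]
    push_cast
    rw [Real.sqrt_mul (by positivity)]
    have h1 : √((n : ℝ) + 1) ≠ 0 := by positivity
    field_simp
  rw [h3, hb1]
  have h4 : √(n.factorial : ℝ) ≠ 0 := by positivity
  field_simp
  linear_combination (-gaussianPDFReal 0 1 x) * h2

lemma hb_mul_dens_eq (α : Fin M → ℕ) (x : Fin M → ℝ) :
    hb α x * dens x = ∏ i, hb1 (α i) (x i) * gaussianPDFReal 0 1 (x i) := by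
  rw [hb, dens, Finset.prod_mul_distrib]

lemma differentiable_hb_mul_dens (α : Fin M → ℕ) :
    Differentiable ℝ fun x : Fin M → ℝ => hb α x * dens x := by
  simp_rw [hb_mul_dens_eq]
  have h : ∀ i, Differentiable ℝ fun x : Fin M → ℝ => hb1 (α i) (x i) * gaussianPDFReal 0 1 (x i) :=
    fun i x => (hasDerivAt_hb1_mul_pdf (α i) (x i)).differentiableAt.comp
      (f := fun x : Fin M → ℝ => x i) x (by fun_prop)
  fun_prop

lemma fderiv_hb_mul_dens (α : Fin M → ℕ) (k : Fin M) (x : Fin M → ℝ) :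
    fderiv ℝ (fun x : Fin M → ℝ => hb α x * dens x) x (Pi.single k 1)
      = -(√(α k + 1 : ℝ) * hb (Function.update α k (α k + 1)) x * dens x) := by
  have h1 := ((differentiable_hb_mul_dens α) x).hasFDerivAt.hasLineDerivAt (Pi.single k 1)
  refine h1.unique ?_
  have e : ∀ t : ℝ, hb α (x + t • Pi.single k 1) * dens (x + t • Pi.single k 1)
      = (hb1 (α k) (x k + t) * gaussianPDFReal 0 1 (x k + t)) *
        ∏ i ∈ Finset.univ.erase k, hb1 (α i) (x i) * gaussianPDFReal 0 1 (x i) := by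
    intro t
    rw [hb_mul_dens_eq, ← Finset.mul_prod_erase _ _ (Finset.mem_univ k)]
    congr 1
    · simp
    · refine Finset.prod_congr rfl fun i hi => ?_
      simp [Finset.ne_of_mem_erase hi]
  unfold HasLineDerivAt
  simp_rw [e]
  have h2 := (hasDerivAt_hb1_mul_pdf (α k) (x k + 0)).comp_const_add (x k) 0
  refine (h2.mul_const _).congr_deriv ?_
  rw [hb_update, dens, ← Finset.mul_prod_erase _ _ (Finset.mem_univ k), Finset.prod_mul_distrib,
    add_zero]
  ring

/-- Gaussian integration by parts on the level of Hermite coefficients. -/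
lemma coef_pd {u : (Fin M → ℝ) → ℝ} (hd : Differentiable ℝ u) (k : Fin M)
    (hu : MemLp u 2 (gau M)) (hu' : MemLp (pd k u) 2 (gau M)) (α : Fin M → ℕ) :
    coef (pd k u) α = √(α k + 1 : ℝ) * coef u (Function.update α k (α k + 1)) := by
  have i1 := (integrable_gau_iff _).1 ((ExpBdd.hb α).integrable_mul hu')
  have i2 := (integrable_gau_iff _).1 ((ExpBdd.hb α).integrable_mul hu)
  have i3 := ((integrable_gau_iff _).1
    ((ExpBdd.hb (Function.update α k (α k + 1))).integrable_mul hu)).const_mul (-√(α k + 1 : ℝ))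
  have := integral_mul_fderiv_eq_neg_fderiv_mul_of_integrable (μ := volume) (f := u)
    (g := fun x : Fin M → ℝ => hb α x * dens x) (v := Pi.single k 1)
    (i1.congr (Eventually.of_forall fun x => by simp only [pd]; ring))
    (i3.congr (Eventually.of_forall fun x => by
      simp only [fderiv_hb_mul_dens]; ring))
    (i2.congr (Eventually.of_forall fun x => by ring))
    (fun x _ => hd x) (fun x _ => differentiable_hb_mul_dens α x)
  rw [coef, coef, integral_gau_eq, integral_gau_eq, ← integral_const_mul, ← neg_inj, ← integral_neg]
  have e1 : ∀ x, -(√(α k + 1 : ℝ) * (u x * hb (Function.update α k (α k + 1)) x * dens x))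
      = u x * fderiv ℝ (fun x : Fin M → ℝ => hb α x * dens x) x (Pi.single k 1) := fun x => by
    rw [fderiv_hb_mul_dens]; ring
  rw [← integral_neg (f := fun x => √(α k + 1 : ℝ) * _)]
  simp_rw [e1]
  rw [this, ← integral_neg]
  congr with x
  simp only [pd]
  ring

lemma tsum_eq_update_add (k : Fin M) (p : ℕ) (F : (Fin M → ℕ) → ℝ≥0∞)
    (h0 : ∀ α, α k < p → F α = 0) :
    ∑' α, F α = ∑' α, F (Function.update α k (α k + p)) := by
  have hinj : Function.Injective (fun α : Fin M → ℕ => Function.update α k (α k + p)) := by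
    intro α β h
    ext i
    have := congrFun h i
    by_cases hi : i = k
    · subst hi; simpa using this
    · simpa [hi] using this
  refine (hinj.tsum_eq fun α hα => ?_).symm
  have : p ≤ α k := not_lt.1 fun h => hα (h0 α h)
  refine ⟨Function.update α k (α k - p), ?_⟩
  simp [Nat.sub_add_cancel this]

lemma coef_coord_mul {u : (Fin M → ℝ) → ℝ} (hu : MemLp u 2 (gau M)) (k : Fin M) (α : Fin M → ℕ) :
    coef (fun x => x k * u x) α = √(α k + 1 : ℝ) * coef u (Function.update α k (α k + 1))
      + √(α k : ℝ) * coef u (Function.update α k (α k - 1)) := by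
  simp only [coef]
  rw [← integral_const_mul, ← integral_const_mul, ← integral_add]
  · congr with x
    have := mul_hb k α x
    linear_combination u x * this
  · exact ((ExpBdd.hb _).integrable_mul hu).const_mul _
  · exact ((ExpBdd.hb _).integrable_mul hu).const_mul _

lemma coef_sub {u v : (Fin M → ℝ) → ℝ} {α : Fin M → ℕ}
    (hu : Integrable (fun x => u x * hb α x) (gau M))
    (hv : Integrable (fun x => v x * hb α x) (gau M)) :
    coef (fun x => u x - v x) α = coef u α - coef v α := by
  simp only [coef, sub_mul]
  exact integral_sub hu hv

/-- The formal coefficients of x_k u are √(α_k+1) c_{α+e_k} + √α_k c_{α-e_k}. They are square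
summable because those of ∂_k u are. Riesz–Fischer gives v in L² with these coefficients, and x_k u
= v almost everywhere by the uniqueness statement, which asks only for integrability against
exponentially bounded functions and not for x_k u to be in L². -/
lemma memLp_coord_mul {u : (Fin M → ℝ) → ℝ} (hd : Differentiable ℝ u) (k : Fin M)
    (hu : MemLp u 2 (gau M)) (hu' : MemLp (pd k u) 2 (gau M)) :
    MemLp (fun x => x k * u x) 2 (gau M) := by
  have s0 : ∑' α, ENNReal.ofReal (coef u α ^ 2) < ∞ := by
    rw [← eLpNorm_sq_eq hu]; exact ENNReal.pow_lt_top hu.2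
  have s1 : ∑' α, ENNReal.ofReal (coef (pd k u) α ^ 2) < ∞ := by
    rw [← eLpNorm_sq_eq hu']; exact ENNReal.pow_lt_top hu'.2
  set A : (Fin M → ℕ) → ℝ := fun α => √(α k + 1 : ℝ) * coef u (Function.update α k (α k + 1)) with hA
  set B : (Fin M → ℕ) → ℝ := fun α => √(α k : ℝ) * coef u (Function.update α k (α k - 1)) with hB
  have hA1 : ∑' α, ENNReal.ofReal (A α ^ 2) < ∞ := by
    simp only [hA, ← coef_pd hd k hu hu']; exact s1
  have hn : ∑' α : Fin M → ℕ, ENNReal.ofReal ((α k : ℝ) * coef u α ^ 2) < ∞ := by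
    rw [tsum_eq_update_add k 1 _ (fun α h => by simp [Nat.lt_one_iff.1 h])]
    refine lt_of_le_of_lt (ENNReal.tsum_le_tsum fun α => ?_) hA1
    simp only [hA, Function.update_self, mul_pow]
    rw [Real.sq_sqrt (by positivity)]
    push_cast
    exact le_rfl
  have hB1 : ∑' α, ENNReal.ofReal (B α ^ 2) < ∞ := by
    rw [tsum_eq_update_add k 1 _ (fun α h => by simp [hB, Nat.lt_one_iff.1 h])]
    have e : ∀ α : Fin M → ℕ, ENNReal.ofReal (B (Function.update α k (α k + 1)) ^ 2)
        = ENNReal.ofReal ((α k : ℝ) * coef u α ^ 2) + ENNReal.ofReal (coef u α ^ 2) := by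
      intro α
      rw [← ENNReal.ofReal_add (by positivity) (by positivity)]
      simp only [hB, Function.update_self, Function.update_idem, Nat.add_sub_cancel,
        Function.update_eq_self, mul_pow]
      rw [Real.sq_sqrt (by positivity)]
      push_cast
      congr 1; ring
    simp_rw [e]
    rw [ENNReal.tsum_add]
    exact ENNReal.add_lt_top.2 ⟨hn, s0⟩
  have hd2 : ∑' α, ENNReal.ofReal ((A α + B α) ^ 2) < ∞ := by
    have e : ∀ α, ENNReal.ofReal ((A α + B α) ^ 2)
        ≤ 2 * ENNReal.ofReal (A α ^ 2) + 2 * ENNReal.ofReal (B α ^ 2) := by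
      intro α
      rw [← ENNReal.ofReal_ofNat 2, ← ENNReal.ofReal_mul (by norm_num),
        ← ENNReal.ofReal_mul (by norm_num), ← ENNReal.ofReal_add (by positivity) (by positivity)]
      apply ENNReal.ofReal_le_ofReal
      nlinarith [sq_nonneg (A α - B α)]
    refine lt_of_le_of_lt (ENNReal.tsum_le_tsum e) ?_
    rw [ENNReal.tsum_add, ENNReal.tsum_mul_left, ENNReal.tsum_mul_left]
    exact ENNReal.add_lt_top.2 ⟨ENNReal.mul_lt_top (by simp) hA1, ENNReal.mul_lt_top (by simp) hB1⟩
  obtain ⟨v, hv, hvc⟩ := exists_memLp_coef_eq hd2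
  have hint : ∀ g, ExpBdd g → Integrable (fun x => (x k * u x) * g x) (gau M) := fun g hg =>
    (((ExpBdd.coord k).mul hg).integrable_mul hu).congr (Eventually.of_forall fun x => by ring)
  have key : (fun x => x k * u x - v x) =ᵐ[gau M] 0 := by
    apply ae_eq_zero_of_coef_eq_zero
    · intro g hg
      simp only [sub_mul]
      exact (hint g hg).sub (hg.integrable_mul hv)
    · intro α
      rw [coef_sub (hint _ (ExpBdd.hb α)) ((ExpBdd.hb α).integrable_mul hv), hvc,
        coef_coord_mul hu]
      simp [hA, hB]
  refine hv.ae_eq ?_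
  filter_upwards [key] with x hx
  simp only [Pi.zero_apply] at hx
  linarith

/-- Smooth functions all of whose iterated partial derivatives are square integrable. -/
def SmoothL2 (u : (Fin M → ℝ) → ℝ) : Prop :=
  ContDiff ℝ (⊤ : ℕ∞) u ∧ ∀ l : List (Fin M), MemLp (l.foldl (fun h k => pd k h) u) 2 (gau M)

lemma contDiff_pd {u : (Fin M → ℝ) → ℝ} (hu : ContDiff ℝ (⊤ : ℕ∞) u) (k : Fin M) :
    ContDiff ℝ (⊤ : ℕ∞) (pd k u) :=
  (hu.fderiv_right (m := (⊤ : ℕ∞)) (by simp)).clm_apply contDiff_const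

lemma SmoothL2.memLp {u : (Fin M → ℝ) → ℝ} (hu : SmoothL2 u) : MemLp u 2 (gau M) := hu.2 []

lemma SmoothL2.differentiable {u : (Fin M → ℝ) → ℝ} (hu : SmoothL2 u) : Differentiable ℝ u :=
  hu.1.differentiable (by simp)

lemma SmoothL2.pd {u : (Fin M → ℝ) → ℝ} (hu : SmoothL2 u) (k : Fin M) : SmoothL2 (pd k u) :=
  ⟨contDiff_pd hu.1 k, fun l => hu.2 (k :: l)⟩

lemma SmoothL2.pd_iterate {u : (Fin M → ℝ) → ℝ} (hu : SmoothL2 u) (k : Fin M) (l : ℕ) :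
    SmoothL2 ((BTE.pd k)^[l] u) := by
  induction l with
  | zero => exact hu
  | succ l ih => rw [Function.iterate_succ_apply']; exact ih.pd k

lemma pd_add {u v : (Fin M → ℝ) → ℝ} (hu : Differentiable ℝ u) (hv : Differentiable ℝ v)
    (k : Fin M) : pd k (fun x => u x + v x) = fun x => pd k u x + pd k v x := by
  ext x
  simp only [pd]
  rw [fderiv_fun_add (hu x) (hv x)]
  rfl

lemma pd_const_mul {u : (Fin M → ℝ) → ℝ} (hu : Differentiable ℝ u) (a : ℝ)
    (k : Fin M) : pd k (fun x => a * u x) = fun x => a * pd k u x := by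
  ext x
  simp only [pd]
  rw [fderiv_const_mul (hu x)]
  rfl

lemma pd_mul {u v : (Fin M → ℝ) → ℝ} (hu : Differentiable ℝ u) (hv : Differentiable ℝ v)
    (k : Fin M) : pd k (fun x => u x * v x) = fun x => u x * pd k v x + v x * pd k u x := by
  ext x
  simp only [pd]
  rw [fderiv_fun_mul (hu x) (hv x)]
  simp

lemma foldl_pd_add (l : List (Fin M)) {u v : (Fin M → ℝ) → ℝ} (hu : ContDiff ℝ (⊤ : ℕ∞) u)
    (hv : ContDiff ℝ (⊤ : ℕ∞) v) : l.foldl (fun h k => pd k h) (fun x => u x + v x)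
      = fun x => l.foldl (fun h k => pd k h) u x + l.foldl (fun h k => pd k h) v x := by
  induction l generalizing u v with
  | nil => rfl
  | cons k l ih =>
    simp only [List.foldl_cons]
    rw [pd_add (hu.differentiable (by simp)) (hv.differentiable (by simp)),
      ih (contDiff_pd hu k) (contDiff_pd hv k)]

lemma foldl_pd_const_mul (l : List (Fin M)) {u : (Fin M → ℝ) → ℝ} (hu : ContDiff ℝ (⊤ : ℕ∞) u)
    (a : ℝ) : l.foldl (fun h k => pd k h) (fun x => a * u x)
      = fun x => a * l.foldl (fun h k => pd k h) u x := by
  induction l generalizing u with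
  | nil => rfl
  | cons k l ih =>
    simp only [List.foldl_cons]
    rw [pd_const_mul (hu.differentiable (by simp)), ih (contDiff_pd hu k)]

lemma SmoothL2.add {u v : (Fin M → ℝ) → ℝ} (hu : SmoothL2 u) (hv : SmoothL2 v) :
    SmoothL2 fun x => u x + v x :=
  ⟨hu.1.add hv.1, fun l => by rw [foldl_pd_add l hu.1 hv.1]; exact (hu.2 l).add (hv.2 l)⟩

lemma SmoothL2.const_mul {u : (Fin M → ℝ) → ℝ} (hu : SmoothL2 u) (a : ℝ) :
    SmoothL2 fun x => a * u x :=
  ⟨contDiff_const.mul hu.1, fun l => by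
    rw [foldl_pd_const_mul l hu.1]; exact (hu.2 l).const_mul a⟩

lemma pd_coord (j k : Fin M) : pd j (fun x => x k) = fun _ => if j = k then 1 else 0 := by
  ext x
  have : (fun x : Fin M → ℝ => x k) = ContinuousLinearMap.proj (R := ℝ) (φ := fun _ => ℝ) k := rfl
  simp only [pd, this, ContinuousLinearMap.fderiv]
  simp [Pi.single_apply, eq_comm]

/-- By the Leibniz rule each derivative of x_k u is again of the form x_k ∂u plus a multiple of u,
so the induction runs on the list of derivatives with u varying. -/
lemma SmoothL2.coord_mul {u : (Fin M → ℝ) → ℝ} (hu : SmoothL2 u) (k : Fin M) :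
    SmoothL2 fun x => x k * u x := by
  refine ⟨(contDiff_apply ℝ ℝ k).mul hu.1, fun l => ?_⟩
  induction l generalizing u with
  | nil => exact memLp_coord_mul hu.differentiable k hu.memLp (hu.pd k).memLp
  | cons j l ih =>
    simp only [List.foldl_cons]
    rw [pd_mul (by fun_prop) hu.differentiable, pd_coord]
    simp only [mul_comm (u _)]
    rw [foldl_pd_add l ((contDiff_apply ℝ ℝ k).mul (hu.pd j).1) (contDiff_const.mul hu.1),
      foldl_pd_const_mul l hu.1]
    exact (ih (hu.pd j)).add ((hu.2 l).const_mul _)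

lemma SmoothL2.eval_mul {u : (Fin M → ℝ) → ℝ} (hu : SmoothL2 u) (k : Fin M) (p : Polynomial ℝ) :
    SmoothL2 fun x => p.eval (x k) * u x := by
  induction p using Polynomial.induction_on' with
  | add p q hp hq => simpa [add_mul] using hp.add hq
  | monomial n a =>
    simp only [Polynomial.eval_monomial, mul_assoc]
    refine SmoothL2.const_mul ?_ a
    induction n with
    | zero => simpa using hu
    | succ n ih => simpa [pow_succ', mul_assoc] using ih.coord_mul k

end Parts

/-! ### Hermite coefficients of the terms of the expansion -/

section Terms

open Polynomial

lemma X_mul_hePoly (n : ℕ) : X * hePoly n = hePoly (n + 1) + (n : ℝ[X]) * hePoly (n - 1) := by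
  cases n with
  | zero => simp [hePoly]
  | succ n => rw [hePoly_add_two]; simp

lemma mem_span_hePoly (p : ℝ[X]) : p ∈ Submodule.span ℝ (Set.range hePoly) := by
  have hX : ∀ q ∈ Submodule.span ℝ (Set.range hePoly),
      X * q ∈ Submodule.span ℝ (Set.range hePoly) := by
    intro q hq
    induction hq using Submodule.span_induction with
    | mem q h =>
      obtain ⟨n, rfl⟩ := h
      rw [X_mul_hePoly, ← nsmul_eq_mul]
      have h : ∀ m, hePoly m ∈ Submodule.span ℝ (Set.range hePoly) :=
        fun m => Submodule.subset_span ⟨m, rfl⟩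
      exact add_mem (h _) (nsmul_mem (h _) n)
    | zero => simp
    | add q r _ _ hq hr => rw [mul_add]; exact add_mem hq hr
    | smul a q _ hq => rw [mul_smul_comm]; exact Submodule.smul_mem _ _ hq
  induction p using Polynomial.induction_on' with
  | add p q hp hq => exact add_mem hp hq
  | monomial n a =>
    rw [← C_mul_X_pow_eq_monomial, ← smul_eq_C_mul]
    refine Submodule.smul_mem _ _ ?_
    induction n with
    | zero => exact Submodule.subset_span ⟨0, by simp⟩
    | succ n ih => rw [pow_succ']; exact hX _ ih

lemma integrable_eval_mul_hb1 (p : ℝ[X]) (n : ℕ) :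
    Integrable (fun x => p.eval x * hb1 n x) (gaussianReal 0 1) := by
  refine ((integrable_eval (p * hePoly n)).mul_const (√(n.factorial : ℝ))⁻¹).congr
    (Eventually.of_forall fun x => ?_)
  simp only [hb1, he, eval_mul]
  ring

/-- The Hermite expansion of a polynomial. -/
lemma exists_eval_eq_sum (p : ℝ[X]) : ∃ R₀ : ℕ, ∀ R, R₀ ≤ R → ∀ x, p.eval x
    = ∑ n ∈ Finset.range R, (∫ y, p.eval y * hb1 n y ∂gaussianReal 0 1) * hb1 n x := by
  induction mem_span_hePoly p using Submodule.span_induction with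
  | mem q h =>
    obtain ⟨m, rfl⟩ := h
    refine ⟨m + 1, fun R hR x => ?_⟩
    have e : ∀ y, (hePoly m).eval y = √(m.factorial : ℝ) * hb1 m y := fun y => by
      have : √(m.factorial : ℝ) ≠ 0 := by positivity
      rw [hb1, he]; field_simp
    simp only [e, mul_assoc]
    simp_rw [integral_const_mul, integral_hb1_mul]
    simp only [mul_ite, mul_one, mul_zero, ite_mul, zero_mul, Finset.sum_ite_eq, Finset.mem_range]
    rw [if_pos (by omega)]
  | zero => exact ⟨0, fun R _ x => by simp⟩
  | add p q _ _ hp hq =>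
    obtain ⟨R₁, h₁⟩ := hp
    obtain ⟨R₂, h₂⟩ := hq
    refine ⟨max R₁ R₂, fun R hR x => ?_⟩
    rw [eval_add, h₁ R (le_of_max_le_left hR), h₂ R (le_of_max_le_right hR),
      ← Finset.sum_add_distrib]
    refine Finset.sum_congr rfl fun n _ => ?_
    simp only [eval_add, add_mul]
    rw [integral_add (integrable_eval_mul_hb1 p n) (integrable_eval_mul_hb1 q n)]
    ring
  | smul a p _ hp =>
    obtain ⟨R₁, h₁⟩ := hp
    refine ⟨R₁, fun R hR x => ?_⟩
    rw [eval_smul, h₁ R hR, smul_eq_mul, Finset.mul_sum]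
    refine Finset.sum_congr rfl fun n _ => ?_
    simp only [eval_smul, smul_eq_mul, mul_assoc]
    rw [integral_const_mul]
    ring

variable {M : ℕ}

/-- The polynomial p · hb1 (α k) has a finite Hermite expansion. Moving p onto the basis function
therefore gives a finite matrix acting on the k-th index, with no convergence question. -/
lemma exists_coef_eval_mul (p : ℝ[X]) (k : Fin M) {u : (Fin M → ℝ) → ℝ} (hu : MemLp u 2 (gau M))
    (α : Fin M → ℕ) : ∃ R₀ : ℕ, ∀ R, R₀ ≤ R → coef (fun x => p.eval (x k) * u x) α
      = ∑ n ∈ Finset.range R, (∫ y, p.eval y * (hb1 (α k) y * hb1 n y) ∂gaussianReal 0 1) *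
        coef u (Function.update α k n) := by
  obtain ⟨R₀, h⟩ := exists_eval_eq_sum (p * C (√((α k).factorial : ℝ))⁻¹ * hePoly (α k))
  have e : ∀ y, (p * C (√((α k).factorial : ℝ))⁻¹ * hePoly (α k)).eval y
      = p.eval y * hb1 (α k) y := fun y => by
    simp only [eval_mul, eval_C, hb1, he]; ring
  simp only [e] at h
  refine ⟨R₀, fun R hR => ?_⟩
  have e2 : ∀ x : Fin M → ℝ, p.eval (x k) * u x * hb α x = ∑ n ∈ Finset.range R,
      (∫ y, p.eval y * (hb1 (α k) y * hb1 n y) ∂gaussianReal 0 1) *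
        (u x * hb (Function.update α k n) x) := by
    intro x
    have h3 := h R hR (x k)
    simp only [mul_assoc] at h3
    rw [hb_eq α k]
    calc _ = p.eval (x k) * hb1 (α k) (x k) *
          (u x * ∏ i ∈ Finset.univ.erase k, hb1 (α i) (x i)) := by ring
      _ = _ := by
        rw [h3, Finset.sum_mul]
        refine Finset.sum_congr rfl fun n _ => ?_
        rw [hb_update]
        ring
  rw [coef]
  simp_rw [e2]
  rw [integral_finsetSum _ fun n _ => ((ExpBdd.hb _).integrable_mul hu).const_mul _]
  refine Finset.sum_congr rfl fun n _ => ?_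
  rw [integral_const_mul, coef]

/-- The polynomial function `gam l` as a polynomial. -/
noncomputable def gamPoly (l : ℕ) : ℝ[X] :=
  C ((-1) ^ l) * ∑ j ∈ Finset.range (l / 2 + 1),
    C (1 / ((j.factorial : ℝ) * ((l - 2 * j).factorial : ℝ))) * hePoly (l - 2 * j)

lemma eval_gamPoly (l : ℕ) (x : ℝ) : (gamPoly l).eval x = gam l x := by
  simp only [gamPoly, gam, eval_mul, eval_C, eval_finsetSum, he]

lemma coef_pd_iterate {u : (Fin M → ℝ) → ℝ} (hu : SmoothL2 u) (k : Fin M) (l : ℕ)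
    (α : Fin M → ℕ) : coef ((pd k)^[l] u) α
      = √((α k + l).factorial : ℝ) / √((α k).factorial : ℝ) *
        coef u (Function.update α k (α k + l)) := by
  induction l generalizing u with
  | zero =>
    have : √((α k).factorial : ℝ) ≠ 0 := by positivity
    simp [this]
  | succ l ih =>
    rw [Function.iterate_succ_apply, ih (hu.pd k),
      coef_pd hu.differentiable k hu.memLp (hu.pd k).memLp]
    simp only [Function.update_self, Function.update_idem]
    rw [← add_assoc, Nat.factorial_succ (α k + l)]
    push_cast
    rw [Real.sqrt_mul (by positivity)]
    ring

/-- The Hermite coefficients of `gam l (x k) * ∂ₖˡ u`. -/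
lemma coef_gam_mul_pd {u : (Fin M → ℝ) → ℝ} (hu : SmoothL2 u) (k : Fin M) (l : ℕ) :
    coef (fun x => gam l (x k) * (pd k)^[l] u x) = Gam l k (coef u) := by
  ext α
  simp only [← eval_gamPoly]
  obtain ⟨R₀, h⟩ := exists_coef_eval_mul (gamPoly l) k (hu.pd_iterate k l).memLp α
  -- The range must exceed the degree in the expansion of the product and the support of the matrix.
  -- The shift by l matches degree n of the l-th derivative with degree n + l of u.
  rw [h (max R₀ (α k + 2 * l + 1)) (le_max_left _ _),
    Gam_eq_sum_range (R := l + max R₀ (α k + 2 * l + 1)) k _ α (by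
      have := le_max_right R₀ (α k + 2 * l + 1); omega), Finset.sum_range_add,
    Finset.sum_eq_zero (s := Finset.range l), zero_add]
  · refine Finset.sum_congr rfl fun n _ => ?_
    rw [coef_pd_iterate hu, Function.update_self, Function.update_idem, Mx, if_pos (by omega),
      Nat.add_sub_cancel_left, add_comm n l]
    have e : ∀ y, gam l y * (he n y * he (α k) y) = √(n.factorial : ℝ) * √((α k).factorial : ℝ) *
        ((gamPoly l).eval y * (hb1 (α k) y * hb1 n y)) := fun y => by
      have h1 : √(n.factorial : ℝ) ≠ 0 := by positivity
      have h2 : √((α k).factorial : ℝ) ≠ 0 := by positivity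
      rw [eval_gamPoly, hb1, hb1]
      field_simp
    simp_rw [e]
    rw [integral_const_mul]
    have h1 : √(n.factorial : ℝ) ≠ 0 := by positivity
    have h2 : √((α k).factorial : ℝ) ≠ 0 := by positivity
    have h3 : (n.factorial : ℝ) = √(n.factorial : ℝ) * √(n.factorial : ℝ) :=
      (Real.mul_self_sqrt (by positivity)).symm
    rw [h3]
    simp only [Real.sqrt_mul_self (Real.sqrt_nonneg _)]
    field_simp
  · intro n hn
    rw [Mx, if_neg (by simpa using hn), zero_mul]

end Terms

/-! ### From the growth condition to exponential weights -/

section Growth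

variable {M : ℕ}

/-- One power of 1 + ∑ α_i is traded for one derivative: α_k c_α² is the squared coefficient of ∂_k
u at α - e_k, and the shift of the index costs at most the factor 2^P. -/
lemma tsum_pow_mul_coef_lt_top (P : ℕ) {u : (Fin M → ℝ) → ℝ} (hu : SmoothL2 u) :
    ∑' α : Fin M → ℕ, ENNReal.ofReal ((1 + ∑ i, (α i : ℝ)) ^ P * coef u α ^ 2) < ∞ := by
  induction P generalizing u with
  | zero =>
    simp only [pow_zero, one_mul]
    rw [← eLpNorm_sq_eq hu.memLp]
    exact ENNReal.pow_lt_top hu.memLp.2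
  | succ P ih =>
    have e : ∀ α : Fin M → ℕ, ENNReal.ofReal ((1 + ∑ i, (α i : ℝ)) ^ (P + 1) * coef u α ^ 2)
        = ENNReal.ofReal ((1 + ∑ i, (α i : ℝ)) ^ P * coef u α ^ 2) +
          ∑ k, ENNReal.ofReal ((1 + ∑ i, (α i : ℝ)) ^ P * ((α k : ℝ) * coef u α ^ 2)) := by
      intro α
      rw [← ENNReal.ofReal_sum_of_nonneg fun _ _ => by positivity,
        ← ENNReal.ofReal_add (by positivity) (Finset.sum_nonneg fun _ _ => by positivity),
        ← Finset.mul_sum, ← Finset.sum_mul]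
      congr 1
      ring
    simp_rw [e]
    rw [ENNReal.tsum_add, Summable.tsum_finsetSum fun _ _ => ENNReal.summable]
    refine ENNReal.add_lt_top.2 ⟨ih hu, ENNReal.sum_lt_top.2 fun k _ => ?_⟩
    rw [tsum_eq_update_add k 1 _ (fun α h => by simp [Nat.lt_one_iff.1 h])]
    refine lt_of_le_of_lt (b := ENNReal.ofReal (2 ^ P) * ∑' α : Fin M → ℕ,
      ENNReal.ofReal ((1 + ∑ i, (α i : ℝ)) ^ P * coef (pd k u) α ^ 2)) ?_
      (ENNReal.mul_lt_top ENNReal.ofReal_lt_top (ih (hu.pd k)))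
    rw [← ENNReal.tsum_mul_left]
    refine ENNReal.tsum_le_tsum fun α => ?_
    rw [← ENNReal.ofReal_mul (by positivity)]
    apply ENNReal.ofReal_le_ofReal
    rw [coef_pd hu.differentiable k hu.memLp (hu.pd k).memLp, mul_pow, Real.sq_sqrt (by positivity),
      Function.update_self]
    have hs : ∑ i, ((Function.update α k (α k + 1) i : ℕ) : ℝ) = 1 + ∑ i, (α i : ℝ) := by
      rw [← Finset.add_sum_erase _ _ (Finset.mem_univ k),
        ← Finset.add_sum_erase (a := k) (f := fun i => (α i : ℝ)) _ (Finset.mem_univ k)]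
      rw [Finset.sum_congr rfl fun i hi => by
        rw [Function.update_of_ne (Finset.ne_of_mem_erase hi)]]
      simp
      ring
    rw [hs]
    push_cast
    have h0 : (0 : ℝ) ≤ ∑ i, (α i : ℝ) := Finset.sum_nonneg fun _ _ => Nat.cast_nonneg _
    calc (1 + (1 + ∑ i, (α i : ℝ))) ^ P *
          (((α k : ℝ) + 1) * coef u (Function.update α k (α k + 1)) ^ 2)
        ≤ (2 * (1 + ∑ i, (α i : ℝ))) ^ P *
          (((α k : ℝ) + 1) * coef u (Function.update α k (α k + 1)) ^ 2) := by
          gcongr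
          linarith
      _ = _ := by rw [mul_pow]; ring

/-- The reciprocal of the weight in the growth condition for `L = 2 r`, `i = r`, normalised by
`(3 r)!`. -/
noncomputable def wt (r : ℕ) : ℝ :=
  ((3 * r).factorial : ℝ) * ((2 * r).factorial : ℝ) ^ 2 / (r.factorial : ℝ) ^ 7

lemma wt_pos (r : ℕ) : 0 < wt r := by unfold wt; positivity

/-- The ratio is 12(3r+1)(3r+2)(2r+1)²/(r+1)^4, which tends to 432; any bound above 7.23³ ≈ 377.9
suffices. -/
lemma wt_succ {r : ℕ} (hr : 20 ≤ r) : 380 * wt r ≤ wt (r + 1) := by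
  have e : wt (r + 1) = wt r * ((3 * r + 1) * (3 * r + 2) * (3 * r + 3) *
      ((2 * r + 1) * (2 * r + 2)) ^ 2 / (r + 1) ^ 7) := by
    rw [wt, wt, show 3 * (r + 1) = 3 * r + 1 + 1 + 1 by ring, show 2 * (r + 1) = 2 * r + 1 + 1 by ring]
    simp only [Nat.factorial_succ]
    push_cast
    field_simp
    ring
  rw [e, mul_comm]
  refine mul_le_mul_of_nonneg_left ?_ (wt_pos r).le
  rw [le_div_iff₀ (by positivity)]
  obtain ⟨s, rfl⟩ := Nat.exists_eq_add_of_le hr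
  push_cast
  have hs : (0 : ℝ) ≤ s := Nat.cast_nonneg s
  have key : 380 * ((20 : ℝ) + s + 1) ^ 4
      ≤ 12 * (3 * (20 + s) + 1) * (3 * (20 + s) + 2) * (2 * (20 + s) + 1) ^ 2 := by
    rw [← sub_nonneg]
    ring_nf
    positivity
  have key2 := mul_le_mul_of_nonneg_right key (show (0 : ℝ) ≤ ((20 : ℝ) + s + 1) ^ 3 by positivity)
  refine le_trans (le_of_eq ?_) (key2.trans (le_of_eq ?_)) <;> ring

lemma summable_div_wt : Summable fun r : ℕ => (723 / 100 : ℝ) ^ (3 * r) / wt r := by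
  refine summable_of_ratio_norm_eventually_le (r := (379 / 380 : ℝ)) (by norm_num) ?_
  filter_upwards [eventually_ge_atTop 20] with r hr
  rw [Real.norm_eq_abs, Real.norm_eq_abs, abs_of_pos (div_pos (by positivity) (wt_pos _)),
    abs_of_pos (div_pos (by positivity) (wt_pos _)), div_le_iff₀ (wt_pos _)]
  have h1 := wt_succ hr
  have h2 := wt_pos r
  calc (723 / 100 : ℝ) ^ (3 * (r + 1)) = (723 / 100) ^ (3 * r) * (723 / 100) ^ 3 := by
        rw [← pow_add]; ring
    _ ≤ (723 / 100) ^ (3 * r) * 379 := by gcongr; norm_num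
    _ = 379 / 380 * ((723 / 100) ^ (3 * r) / wt r) * (380 * wt r) := by field_simp
    _ ≤ _ := by gcongr

lemma sum_range_three_mul (f : ℕ → ℝ) (K : ℕ) : ∑ j ∈ Finset.range (3 * K), f j
    = ∑ r ∈ Finset.range K, (f (3 * r) + f (3 * r + 1) + f (3 * r + 2)) := by
  induction K with
  | zero => simp
  | succ K ih =>
    rw [show 3 * (K + 1) = 3 * K + 1 + 1 + 1 by ring, Finset.sum_range_succ, Finset.sum_range_succ,
      Finset.sum_range_succ, ih, Finset.sum_range_succ]
    ring

lemma choose_succ_le (n j : ℕ) : n.choose (j + 1) ≤ n * n.choose j := by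
  have h := Nat.choose_succ_right_eq n j
  calc n.choose (j + 1) ≤ n.choose (j + 1) * (j + 1) := Nat.le_mul_of_pos_right _ (by omega)
    _ = n.choose j * (n - j) := h
    _ ≤ n.choose j * n := Nat.mul_le_mul_left _ (Nat.sub_le _ _)
    _ = _ := mul_comm _ _

/-- In the binomial expansion of (1+y)^n the terms of index 3r+1 and 3r+2 exceed the one of index 3r
by at most n y and (n y)². Derivatives of order divisible by 3 are thus enough. -/
lemma pow_le_sum_choose {y : ℝ} (hy : 0 ≤ y) (n : ℕ) : (1 + y) ^ n ≤
    (1 + n * y) ^ 2 * ∑ r ∈ Finset.range (n + 1), y ^ (3 * r) * (n.choose (3 * r) : ℝ) := by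
  have e : (1 + y) ^ n = ∑ j ∈ Finset.range (3 * (n + 1)), y ^ j * (n.choose j : ℝ) := by
    rw [add_comm, add_pow]
    simp only [one_pow, mul_one]
    apply Finset.sum_subset
    · intro j; simp; omega
    · intro j _ hj
      rw [Nat.choose_eq_zero_of_lt (by simpa using hj)]
      simp
  rw [e, sum_range_three_mul, Finset.mul_sum]
  refine Finset.sum_le_sum fun r _ => ?_
  have h1 : (n.choose (3 * r + 1) : ℝ) ≤ n * n.choose (3 * r) := by
    exact_mod_cast choose_succ_le n (3 * r)
  have h2 : (n.choose (3 * r + 2) : ℝ) ≤ n * (n * n.choose (3 * r)) := by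
    refine le_trans ?_ (mul_le_mul_of_nonneg_left h1 (Nat.cast_nonneg n))
    exact_mod_cast choose_succ_le n (3 * r + 1)
  calc y ^ (3 * r) * (n.choose (3 * r) : ℝ) + y ^ (3 * r + 1) * (n.choose (3 * r + 1) : ℝ)
        + y ^ (3 * r + 2) * (n.choose (3 * r + 2) : ℝ)
      ≤ y ^ (3 * r) * (n.choose (3 * r) : ℝ) + y ^ (3 * r + 1) * (n * n.choose (3 * r))
        + y ^ (3 * r + 2) * (n * (n * n.choose (3 * r))) := by gcongr
    _ = (1 + n * y + (n * y) ^ 2) * (y ^ (3 * r) * (n.choose (3 * r) : ℝ)) := by ring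
    _ ≤ _ := by
        gcongr
        have : 0 ≤ (n : ℝ) * y := by positivity
        nlinarith

/-- Interpolation between exponential weights and powers. -/
lemma exists_weight_le (p : ℕ) : ∃ (K : ℝ) (P : ℕ), 0 ≤ K ∧ ∀ (n : ℕ) (T : ℝ), 1 + n ≤ T →
    T ^ p * (81 / 10 : ℝ) ^ n ≤ K * (∑ r ∈ Finset.range (n + 1),
      (723 / 100 : ℝ) ^ (3 * r) * (n.choose (3 * r) : ℝ) + T ^ P) := by
  -- Here 823/810 = 8.23/8.1 is the surplus of 1 + 7.23 over the target base. Either its n-th power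
  -- beats the polynomial 100 T^(p+2), and the binomial sum dominates, or it does not, and then
  -- 8.1^n is itself bounded by a power of T.
  obtain ⟨κ, hκ⟩ := pow_unbounded_of_one_lt (81 / 10 : ℝ) (show (1 : ℝ) < 823 / 810 by norm_num)
  refine ⟨100 ^ κ, p + (p + 2) * κ, by positivity, fun n T hT => ?_⟩
  have hn : (0 : ℝ) ≤ n := Nat.cast_nonneg n
  have hT0 : 0 < T := by linarith
  set S := ∑ r ∈ Finset.range (n + 1), (723 / 100 : ℝ) ^ (3 * r) * (n.choose (3 * r) : ℝ) with hS
  have hS0 : 0 ≤ S := Finset.sum_nonneg fun _ _ => by positivity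
  have h1 : (823 / 100 : ℝ) ^ n ≤ 100 * T ^ 2 * S := by
    have h := pow_le_sum_choose (show (0 : ℝ) ≤ 723 / 100 by norm_num) n
    rw [show (1 : ℝ) + 723 / 100 = 823 / 100 by norm_num] at h
    refine h.trans ?_
    gcongr
    calc (1 + (n : ℝ) * (723 / 100)) ^ 2 ≤ (10 * T) ^ 2 := by gcongr; linarith
      _ = 100 * T ^ 2 := by ring
  have hK1 : (1 : ℝ) ≤ 100 ^ κ := one_le_pow₀ (by norm_num)
  rcases le_or_gt (100 * T ^ (p + 2)) ((823 / 810 : ℝ) ^ n) with h | h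
  · have h2 : T ^ p * (81 / 10 : ℝ) ^ n ≤ S := by
      have h3 : (823 / 100 : ℝ) ^ n = (823 / 810) ^ n * (81 / 10) ^ n := by
        rw [← mul_pow]; norm_num
      have h4 : (100 * T ^ 2) * (T ^ p * (81 / 10 : ℝ) ^ n) ≤ (100 * T ^ 2) * S := by
        refine le_trans ?_ h1
        rw [h3]
        calc (100 * T ^ 2) * (T ^ p * (81 / 10 : ℝ) ^ n) = (100 * T ^ (p + 2)) * (81 / 10) ^ n := by
              ring
          _ ≤ _ := by gcongr
      exact le_of_mul_le_mul_left h4 (by positivity)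
    calc _ ≤ S := h2
      _ ≤ 1 * (S + T ^ (p + (p + 2) * κ)) := by rw [one_mul]; linarith [pow_pos hT0 (p + (p + 2) * κ)]
      _ ≤ _ := by gcongr
  · calc T ^ p * (81 / 10 : ℝ) ^ n ≤ T ^ p * ((823 / 810) ^ κ) ^ n := by gcongr
      _ = T ^ p * ((823 / 810) ^ n) ^ κ := by rw [← pow_mul, ← pow_mul, mul_comm κ]
      _ ≤ T ^ p * (100 * T ^ (p + 2)) ^ κ := by gcongr
      _ = 100 ^ κ * T ^ (p + (p + 2) * κ) := by rw [mul_pow, ← pow_mul, pow_add]; ring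
      _ ≤ _ := by gcongr; linarith

/-- A bound on the `L²` norms in the growth condition makes the coefficient family `Good`. -/
lemma good_of_growth {u : (Fin M → ℝ) → ℝ} (hu : SmoothL2 u) (B : ℝ)
    (hB : ∀ (k : Fin M) (r : ℕ), (eLpNorm ((pd k)^[3 * r] u) 2 (gau M)).toReal ^ 2 *
      (((2 * r).factorial : ℝ) ^ 2 / (r.factorial : ℝ) ^ 7) ≤ B) : Good (coef u) := by
  intro p k
  obtain ⟨K, P, hK, hw⟩ := exists_weight_le p
  have hchoose : ∀ r : ℕ, ∑' α : Fin M → ℕ,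
      ENNReal.ofReal (((α k).choose (3 * r) : ℝ) * coef u α ^ 2) ≤ ENNReal.ofReal (B / wt r) := by
    intro r
    have hm := (hu.pd_iterate k (3 * r)).memLp
    -- Parseval for the derivative of order 3r, using (n+3r)!/n! = (3r)! C(n+3r, 3r).
    have h1 : eLpNorm ((pd k)^[3 * r] u) 2 (gau M) ^ 2
        = ENNReal.ofReal ((3 * r).factorial) * ∑' α : Fin M → ℕ,
          ENNReal.ofReal (((α k).choose (3 * r) : ℝ) * coef u α ^ 2) := by
      rw [eLpNorm_sq_eq hm, ← ENNReal.tsum_mul_left, tsum_eq_update_add k (3 * r)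
        (fun α => ENNReal.ofReal ((3 * r).factorial) *
          ENNReal.ofReal (((α k).choose (3 * r) : ℝ) * coef u α ^ 2))
        (fun α h => by simp [Nat.choose_eq_zero_of_lt h])]
      refine tsum_congr fun α => ?_
      rw [← ENNReal.ofReal_mul (by positivity), coef_pd_iterate hu, Function.update_self, mul_pow,
        div_pow, Real.sq_sqrt (by positivity), Real.sq_sqrt (by positivity)]
      congr 1
      have := Nat.choose_mul_factorial_mul_factorial (show 3 * r ≤ α k + 3 * r by omega)
      rw [Nat.add_sub_cancel] at this
      rw [← this]
      push_cast
      field_simp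
    have h2 := hB k r
    rw [← ENNReal.toReal_pow, h1, ENNReal.toReal_mul, ENNReal.toReal_ofReal (by positivity)] at h2
    have hfin : ∑' α : Fin M → ℕ,
        ENNReal.ofReal (((α k).choose (3 * r) : ℝ) * coef u α ^ 2) ≠ ∞ := by
      intro htop
      rw [htop, ENNReal.mul_top (by simp [Nat.factorial_ne_zero])] at h1
      exact (ENNReal.pow_lt_top hm.2).ne h1
    rw [← ENNReal.ofReal_toReal hfin]
    apply ENNReal.ofReal_le_ofReal
    rw [le_div_iff₀ (wt_pos r)]
    refine le_trans (le_of_eq ?_) h2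
    rw [wt]
    ring
  have hB0 : 0 ≤ B := le_trans (by positivity) (hB k 0)
  have hS : ∑' α : Fin M → ℕ, ENNReal.ofReal ((∑ r ∈ Finset.range (α k + 1),
      (723 / 100 : ℝ) ^ (3 * r) * ((α k).choose (3 * r) : ℝ)) * coef u α ^ 2) < ∞ := by
    have e : ∀ α : Fin M → ℕ, ENNReal.ofReal ((∑ r ∈ Finset.range (α k + 1),
        (723 / 100 : ℝ) ^ (3 * r) * ((α k).choose (3 * r) : ℝ)) * coef u α ^ 2)
        ≤ ∑' r : ℕ, ENNReal.ofReal ((723 / 100 : ℝ) ^ (3 * r)) *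
          ENNReal.ofReal (((α k).choose (3 * r) : ℝ) * coef u α ^ 2) := by
      intro α
      rw [Finset.sum_mul, ENNReal.ofReal_sum_of_nonneg fun _ _ => by positivity]
      refine le_trans (le_of_eq ?_) (ENNReal.sum_le_tsum (Finset.range (α k + 1)))
      refine Finset.sum_congr rfl fun r _ => ?_
      rw [← ENNReal.ofReal_mul (by positivity), mul_assoc]
    refine lt_of_le_of_lt (ENNReal.tsum_le_tsum e) ?_
    rw [ENNReal.tsum_comm]
    simp_rw [ENNReal.tsum_mul_left]
    refine lt_of_le_of_lt (ENNReal.tsum_le_tsum fun r => mul_le_mul_right (hchoose r) _) ?_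
    have e2 : ∀ r : ℕ, ENNReal.ofReal ((723 / 100 : ℝ) ^ (3 * r)) * ENNReal.ofReal (B / wt r)
        = ENNReal.ofReal (B * ((723 / 100 : ℝ) ^ (3 * r) / wt r)) := fun r => by
      rw [← ENNReal.ofReal_mul (by positivity)]
      congr 1; ring
    simp_rw [e2]
    exact (summable_div_wt.mul_left B).tsum_ofReal_lt_top
  have hP := tsum_pow_mul_coef_lt_top P hu
  refine lt_of_le_of_lt (b := ENNReal.ofReal K * (∑' α : Fin M → ℕ,
    ENNReal.ofReal ((∑ r ∈ Finset.range (α k + 1), (723 / 100 : ℝ) ^ (3 * r) *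
      ((α k).choose (3 * r) : ℝ)) * coef u α ^ 2) + ∑' α : Fin M → ℕ,
      ENNReal.ofReal ((1 + ∑ i, (α i : ℝ)) ^ P * coef u α ^ 2))) ?_
    (ENNReal.mul_lt_top ENNReal.ofReal_lt_top (ENNReal.add_lt_top.2 ⟨hS, hP⟩))
  rw [← ENNReal.tsum_add, ← ENNReal.tsum_mul_left]
  refine ENNReal.tsum_le_tsum fun α => ?_
  have hsum0 : 0 ≤ ∑ r ∈ Finset.range (α k + 1), (723 / 100 : ℝ) ^ (3 * r) *
      ((α k).choose (3 * r) : ℝ) := Finset.sum_nonneg fun _ _ => by positivity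
  rw [← ENNReal.ofReal_add (mul_nonneg hsum0 (sq_nonneg _)) (by positivity),
    ← ENNReal.ofReal_mul hK]
  apply ENNReal.ofReal_le_ofReal
  have hT : 1 + (α k : ℝ) ≤ 1 + ∑ i, (α i : ℝ) := by
    gcongr
    exact Finset.single_le_sum (f := fun i => (α i : ℝ)) (fun i _ => Nat.cast_nonneg _)
      (Finset.mem_univ k)
  calc _ ≤ K * (∑ r ∈ Finset.range (α k + 1), (723 / 100 : ℝ) ^ (3 * r) *
        ((α k).choose (3 * r) : ℝ) + (1 + ∑ i, (α i : ℝ)) ^ P) * coef u α ^ 2 :=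
        mul_le_mul_of_nonneg_right (hw (α k) _ hT) (sq_nonneg _)
    _ = _ := by ring

end Growth

/-! ### Assembling the nested series on Gaussian space -/

section Iterated

variable {M : ℕ}

lemma ae_eq_of_coef_eq {u v : (Fin M → ℝ) → ℝ} (hu : MemLp u 2 (gau M)) (hv : MemLp v 2 (gau M))
    (h : coef u = coef v) : u =ᵐ[gau M] v := by
  have key : (fun x => u x - v x) =ᵐ[gau M] 0 := by
    apply ae_eq_zero_of_coef_eq_zero
    · intro g hg
      simp only [sub_mul]
      exact (hg.integrable_mul hu).sub (hg.integrable_mul hv)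
    · intro α
      rw [coef_sub ((ExpBdd.hb α).integrable_mul hu) ((ExpBdd.hb α).integrable_mul hv), h, sub_self]
  filter_upwards [key] with x hx
  simpa [sub_eq_zero] using hx

lemma Good.tsum_lt_top {c : (Fin M → ℕ) → ℝ} (hc : Good c) (k : Fin M) :
    ∑' α, ENNReal.ofReal (c α ^ 2) < ∞ := by
  refine lt_of_le_of_lt (ENNReal.tsum_le_tsum fun α => ENNReal.ofReal_le_ofReal ?_) (hc 0 k)
  rw [pow_zero, one_mul]
  exact le_mul_of_one_le_left (sq_nonneg _) (one_le_pow₀ (by norm_num))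

lemma tendsto_zero_of_sq {ι : Type*} {l : Filter ι} {f : ι → ℝ≥0∞}
    (h : Tendsto (fun i => f i ^ 2) l (𝓝 0)) : Tendsto f l (𝓝 0) := by
  rw [ENNReal.tendsto_nhds_zero] at h ⊢
  intro ε hε
  filter_upwards [h (ε ^ 2) (by positivity)] with i hi
  exact (ENNReal.pow_le_pow_left_iff two_ne_zero).1 hi

lemma coef_sum_sub {s : ℕ → (Fin M → ℝ) → ℝ} {S : (Fin M → ℝ) → ℝ}
    (hs : ∀ j, MemLp (s j) 2 (gau M)) (hS : MemLp S 2 (gau M)) (N : ℕ) (α : Fin M → ℕ) :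
    coef (fun x => ∑ j ∈ Finset.range N, s j x - S x) α
      = ∑ j ∈ Finset.range N, coef (s j) α - coef S α := by
  rw [coef_sub _ ((ExpBdd.hb α).integrable_mul hS)]
  · congr 1
    simp only [coef, Finset.sum_mul]
    exact integral_finsetSum _ fun j _ => (ExpBdd.hb α).integrable_mul (hs j)
  · simp only [Finset.sum_mul]
    exact integrable_finsetSum _ fun j _ => (ExpBdd.hb α).integrable_mul (hs j)

/-- Iterated summation of the operators `Gam` on the level of Hermite coefficients. -/
lemma hasIteratedL2Sum_of_coef {n : ℕ} {κ : Fin n → Fin M} (hκ : Function.Injective κ)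
    {c : (Fin M → ℕ) → ℝ} (hc : Good c) {a : (Fin n → ℕ) → (Fin M → ℝ) → ℝ} {S : (Fin M → ℝ) → ℝ}
    (ha : ∀ J, MemLp (a J) 2 (gau M)) (hac : ∀ J, coef (a J) = opIter n κ J c)
    (hS : MemLp S 2 (gau M)) (hSc : coef S = Qop κ c) : HasIteratedL2Sum (gau M) n a S := by
  induction n generalizing c S with
  | zero =>
    refine ae_eq_of_coef_eq hS (ha _) ?_
    rw [hSc, hac, opIter]
    ext α
    simp [Qop]
  | succ n ih =>
    have hne : ∀ i, Fin.tail κ i ≠ κ 0 := fun i h => Fin.succ_ne_zero i (hκ h)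
    have hQ : Good (Qop (Fin.tail κ) c) := hc.qop _
    -- The inner series for fixed outer index j should sum to the j-th operator applied to the
    -- family already averaged over the later coordinates. By commutation it is the same problem
    -- with n coordinates and c replaced by `Gam j (κ 0) c`, which is again `Good`.
    have hex : ∀ j, ∃ u, MemLp u 2 (gau M) ∧ coef u = Gam j (κ 0) (Qop (Fin.tail κ) c) :=
      fun j => exists_memLp_coef_eq ((hQ.gam j (κ 0)).tsum_lt_top (κ 0))
    choose s hs hsc using hex
    refine ⟨s, fun j => ?_, hs, hS, ?_⟩
    · refine ih (κ := Fin.tail κ) (fun i i' h => Fin.succ_injective _ (hκ h)) (hc.gam j (κ 0))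
        (fun J => ha _) (fun J => ?_) (hs j) ?_
      · rw [hac, opIter, Fin.tail_cons, Fin.cons_zero, Gam_opIter hne]
      · rw [hsc, Gam_Qop hne]
    · apply tendsto_zero_of_sq
      have e : ∀ N, eLpNorm (fun x => ∑ j ∈ Finset.range N, s j x - S x) 2 (gau M) ^ 2
          = ∑' α, ENNReal.ofReal ((∑ l ∈ Finset.range N, Gam l (κ 0) (Qop (Fin.tail κ) c) α
            - Qop (fun _ : Fin 1 => κ 0) (Qop (Fin.tail κ) c) α) ^ 2) := by
        intro N
        have hm : MemLp (fun x => ∑ j ∈ Finset.range N, s j x - S x) 2 (gau M) :=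
          (memLp_finsetSum _ fun j _ => hs j).sub hS
        rw [eLpNorm_sq_eq hm]
        refine tsum_congr fun α => ?_
        rw [coef_sum_sub hs hS, hSc, Qop_succ]
        simp_rw [hsc]
      simp_rw [e]
      exact tendsto_sum_Gam hQ (κ 0)

/-- The iterated partial derivatives `∂_{κ 0}^{J 0} ⋯ ∂_{κ (n-1)}^{J (n-1)} u`. -/
noncomputable def dIter : (n : ℕ) → (Fin n → Fin M) → (Fin n → ℕ) → ((Fin M → ℝ) → ℝ) →
    (Fin M → ℝ) → ℝ
  | 0, _, _, u => u
  | n + 1, κ, J, u => (pd (κ 0))^[J 0] (dIter n (Fin.tail κ) (Fin.tail J) u)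

lemma pd_eq_zero {R : (Fin M → ℝ) → ℝ} (hR : Differentiable ℝ R) {k : Fin M}
    (h : ∀ x (t : ℝ), R (x + t • Pi.single k 1) = R x) : pd k R = fun _ => 0 := by
  ext x
  have h1 := (hR x).hasFDerivAt.hasLineDerivAt (Pi.single k 1)
  refine h1.unique ?_
  unfold HasLineDerivAt
  simp_rw [h]
  exact hasDerivAt_const _ _

lemma pd_iterate_mul {R u : (Fin M → ℝ) → ℝ} (hR : ContDiff ℝ (⊤ : ℕ∞) R) {k : Fin M}
    (h : pd k R = fun _ => 0) (hu : ContDiff ℝ (⊤ : ℕ∞) u) (l : ℕ) :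
    (pd k)^[l] (fun x => R x * u x) = fun x => R x * (pd k)^[l] u x := by
  induction l generalizing u with
  | zero => rfl
  | succ l ih =>
    rw [Function.iterate_succ_apply, pd_mul (hR.differentiable (by simp))
      (hu.differentiable (by simp)), h]
    simp only [mul_zero, add_zero]
    rw [ih (contDiff_pd hu k)]
    rfl

lemma SmoothL2.dIter {u : (Fin M → ℝ) → ℝ} (hu : SmoothL2 u) {n : ℕ} (κ : Fin n → Fin M)
    (J : Fin n → ℕ) : SmoothL2 (dIter n κ J u) := by
  induction n with
  | zero => exact hu
  | succ n ih => exact (ih _ _).pd_iterate _ _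

/-- The expansion takes all derivatives first and multiplies afterwards. Because the coordinates are
distinct, ∂_{κ 0} does not see the factors `gam` in the other coordinates, so the term is a
composition of one-coordinate operators. -/
lemma smoothL2_term_and_coef {u : (Fin M → ℝ) → ℝ} (hu : SmoothL2 u) {n : ℕ} {κ : Fin n → Fin M}
    (hκ : Function.Injective κ) (J : Fin n → ℕ) :
    SmoothL2 (fun x => (∏ i, gam (J i) (x (κ i))) * dIter n κ J u x) ∧
      coef (fun x => (∏ i, gam (J i) (x (κ i))) * dIter n κ J u x) = opIter n κ J (coef u) := by
  induction n with
  | zero => simpa [dIter, opIter] using hu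
  | succ n ih =>
    obtain ⟨h1, h2⟩ := ih (κ := Fin.tail κ) (fun i i' h => Fin.succ_injective _ (hκ h)) (Fin.tail J)
    set R : (Fin M → ℝ) → ℝ := fun x => ∏ i, gam (Fin.tail J i) (x (Fin.tail κ i)) with hRdef
    have hR : ContDiff ℝ (⊤ : ℕ∞) R :=
      contDiff_prod fun i _ => (contDiff_gam _).comp (contDiff_apply ℝ ℝ _)
    have hR0 : pd (κ 0) R = fun _ => 0 := by
      refine pd_eq_zero (hR.differentiable (by simp)) fun x t => ?_
      refine Finset.prod_congr rfl fun i _ => ?_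
      have : Fin.tail κ i ≠ κ 0 := fun h => Fin.succ_ne_zero i (hκ h)
      simp [this]
    have e : (fun x => (∏ i, gam (J i) (x (κ i))) * BTE.dIter (n + 1) κ J u x)
        = fun x => gam (J 0) (x (κ 0)) *
          (pd (κ 0))^[J 0] (fun x => R x * BTE.dIter n (Fin.tail κ) (Fin.tail J) u x) x := by
      rw [pd_iterate_mul hR hR0 (hu.dIter _ _).1]
      ext x
      rw [Fin.prod_univ_succ, BTE.dIter]
      simp only [hRdef, Fin.tail]
      ring
    rw [e]
    constructor
    · simp only [← eval_gamPoly]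
      exact (h1.pd_iterate _ _).eval_mul _ _
    · rw [coef_gam_mul_pd h1, h2, opIter]

/-- The backward Taylor expansion on Gaussian space. -/
lemma hasIteratedL2Sum_gau {u : (Fin M → ℝ) → ℝ} (hu : SmoothL2 u) (hg : Good (coef u)) {n : ℕ}
    {κ : Fin n → Fin M} (hκ : Function.Injective κ) {S : (Fin M → ℝ) → ℝ}
    (hS : MemLp S 2 (gau M)) (hSc : coef S = Qop κ (coef u)) :
    HasIteratedL2Sum (gau M) n
      (fun J x => (∏ i, gam (J i) (x (κ i))) * dIter n κ J u x) S :=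
  hasIteratedL2Sum_of_coef hκ hg (fun J => (smoothL2_term_and_coef hu hκ J).1.memLp)
    (fun J => (smoothL2_term_and_coef hu hκ J).2) hS hSc

lemma HasIteratedL2Sum.comp {Ω E : Type*} [MeasurableSpace Ω] [MeasurableSpace E] {P : Measure Ω}
    {μ : Measure E} {X : Ω → E} (hX : MeasurePreserving X P μ) {n : ℕ}
    {a : (Fin n → ℕ) → Ω → ℝ} {b : (Fin n → ℕ) → E → ℝ} {S : Ω → ℝ} {T : E → ℝ}
    (h : HasIteratedL2Sum μ n b T) (hab : ∀ J, a J =ᵐ[P] b J ∘ X) (hST : S =ᵐ[P] T ∘ X) :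
    HasIteratedL2Sum P n a S := by
  induction n generalizing S T with
  | zero => exact hST.trans ((hX.quasiMeasurePreserving.ae_eq_comp h).trans (hab _).symm)
  | succ n ih =>
    obtain ⟨s, hs, h1, h2, h3⟩ := h
    refine ⟨fun j => s j ∘ X, fun j => ih (hs j) (fun J => hab _) (ae_eq_refl _),
      fun j => (h1 j).comp_measurePreserving hX,
      (h2.comp_measurePreserving hX).ae_eq hST.symm, ?_⟩
    refine h3.congr fun N => ?_
    have hm : MemLp (fun x => ∑ j ∈ Finset.range N, s j x - T x) 2 μ :=
      (memLp_finsetSum _ fun j _ => h1 j).sub h2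
    rw [← eLpNorm_comp_measurePreserving hm.1 hX]
    apply eLpNorm_congr_ae
    filter_upwards [hST] with ω hω
    simp [hω]

end Iterated

/-! ### Independence of later increments from the usual augmentation -/

section Brownian

variable {Ω : Type*} [mΩ : MeasurableSpace Ω] {P : Measure Ω} {W : ℝ≥0 → Ω → ℝ}

lemma exists_ae_eq_of_nullFiltration (hWm : ∀ t, Measurable (W t)) {t : ℝ≥0} {A : Set Ω}
    (hA : MeasurableSet[nullFiltration W hWm P t] A) :
    ∃ A', MeasurableSet[MeasurableSpace.comap (fun ω (s : Set.Iic t) => W s ω) inferInstance] A' ∧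
      A =ᵐ[P] A' := by
  have h : nullFiltration W hWm P t ≤ eventuallyMeasurableSpace
      (MeasurableSpace.comap (fun ω (s : Set.Iic t) => W s ω) inferInstance) (ae P) := by
    refine sup_le (le_trans ?_ (fun s hs => ⟨s, hs, EventuallyEq.rfl⟩)) (MeasurableSpace.generateFrom_le ?_)
    · refine iSup₂_le fun s hs => ?_
      have e : W s = (fun y : Set.Iic t → ℝ => y ⟨s, hs⟩) ∘ fun ω (s : Set.Iic t) => W s ω := rfl
      rw [e, ← MeasurableSpace.comap_comp]
      exact MeasurableSpace.comap_mono (measurable_pi_apply _).comap_le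
    · intro A hA
      exact ⟨∅, @MeasurableSet.empty _ (_), ae_eq_empty.2 hA.2⟩
  exact h A hA

/-- Increments after time `t` are independent of the null-augmented past. -/
lemma integral_indicator_shift (hWm : ∀ t, Measurable (W t)) (hW : IsBrownianReal W P)
    {ι : Type*} [Fintype ι] (τ : ι → ℝ≥0) {t : ℝ≥0} {A : Set Ω}
    (hA : MeasurableSet[nullFiltration W hWm P t] A) {f : (ι → ℝ) → ℝ} (hf : Measurable f) :
    ∫ ω in A, f (fun i => W (t + τ i) ω - W t ω) ∂P
      = P.real A * ∫ ω, f (fun i => W (t + τ i) ω - W t ω) ∂P := by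
  obtain ⟨A', ⟨B, hB, rfl⟩, hAA'⟩ := exists_ae_eq_of_nullFiltration hWm hA
  have hm : Measurable fun ω (s : Set.Iic t) => W s ω := measurable_pi_iff.2 fun s => hWm s
  have hBm : MeasurableSet ((fun ω (s : Set.Iic t) => W s ω) ⁻¹' B) := hm hB
  rw [setIntegral_congr_set hAA', measureReal_congr hAA', ← integral_indicator_one hBm]
  have hind := (hW.toIsPreBrownianReal.indepFun_shift t).comp
    (φ := fun y : ℝ≥0 → ℝ => f fun i => y (τ i))
    (ψ := Set.indicator B (1 : (Set.Iic t → ℝ) → ℝ))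
    (by fun_prop) (measurable_one.indicator hB)
  have := hind.integral_fun_mul_eq_mul_integral (by
      refine Measurable.aestronglyMeasurable ?_
      exact hf.comp (measurable_pi_iff.2 fun i => (hWm _).sub (hWm _)))
    (Measurable.aestronglyMeasurable ((measurable_one.indicator hB).comp hm))
  rw [mul_comm]
  simp only [Function.comp_def] at this
  convert this using 1
  · rw [← integral_indicator hBm]
    refine integral_congr_ae (ae_of_all _ fun ω => ?_)
    by_cases hω : (fun s : Set.Iic t => W s ω) ∈ B <;> simp [Set.indicator, hω]
  · congr 1

/-- Increments after time `t` are independent of the usual augmentation at time `t`. -/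
lemma indep_brownianFiltration [IsProbabilityMeasure P] (hWm : ∀ t, Measurable (W t)) (hW : IsBrownianReal W P)
    {ι : Type*} [Fintype ι] (τ : ι → ℝ≥0) (t : ℝ≥0) :
    Indep (MeasurableSpace.comap (fun ω i => W (t + τ i) ω - W t ω) inferInstance)
      (brownianFiltration W hWm P t) P := by
  have hYm : Measurable fun ω i => W (t + τ i) ω - W t ω :=
    measurable_pi_iff.2 fun i => (hWm _).sub (hWm _)
  rw [Indep_iff]
  rintro _ A ⟨B, hB, rfl⟩ hA
  have hA0 : MeasurableSet A := (brownianFiltration W hWm P).le t A hA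
  -- Right-continuity: an event of the augmentation at t belongs to the null-augmented past of every
  -- t + ε, hence is independent of the increments after t + ε. Bounded continuous test functions
  -- and path continuity then allow ε → 0.
  have hAε : ∀ ε : ℝ≥0, 0 < ε → MeasurableSet[nullFiltration W hWm P (t + ε)] A := by
    intro ε hε
    have : brownianFiltration W hWm P t ≤ nullFiltration W hWm P (t + ε) := by
      rw [brownianFiltration, Filtration.rightCont_eq]
      exact iInf₂_le _ (lt_add_of_pos_right t hε)
    exact this A hA
  set ε : ℕ → ℝ≥0 := fun n => 1 / ((n : ℝ≥0) + 1) with hεdef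
  have hεpos : ∀ n, 0 < ε n := fun n => by positivity
  have hε0 : Tendsto ε atTop (𝓝 0) := tendsto_one_div_add_atTop_nhds_zero_nat
  have key : (P.restrict A).map (fun ω i => W (t + τ i) ω - W t ω)
      = P A • P.map (fun ω i => W (t + τ i) ω - W t ω) := by
    have := Measure.smul_finite (P.map (fun ω i => W (t + τ i) ω - W t ω)) (measure_ne_top P A)
    apply ext_of_forall_integral_eq_of_IsFiniteMeasure
    intro f
    rw [integral_map hYm.aemeasurable f.continuous.aestronglyMeasurable, integral_smul_measure,
      integral_map hYm.aemeasurable f.continuous.aestronglyMeasurable]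
    have hlim : ∀ Q : Measure Ω, Q ≤ P → Tendsto (fun n => ∫ ω, f (fun i => W (t + ε n + τ i) ω
        - W (t + ε n) ω) ∂Q) atTop (𝓝 (∫ ω, f (fun i => W (t + τ i) ω - W t ω) ∂Q)) := by
      intro Q hQ
      have : IsFiniteMeasure Q := ⟨(hQ _).trans_lt (measure_lt_top _ _)⟩
      refine tendsto_integral_of_dominated_convergence (fun _ => ‖f‖) (fun n => ?_)
        (integrable_const _) (fun n => ae_of_all _ fun ω => f.norm_coe_le_norm _) ?_
      · exact (f.continuous.measurable.comp
          (measurable_pi_iff.2 fun i => (hWm _).sub (hWm _))).aestronglyMeasurable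
      · filter_upwards [(Measure.absolutelyContinuous_of_le hQ).ae_le hW.cont] with ω hω
        refine (f.continuous.tendsto _).comp (tendsto_pi_nhds.2 fun i => ?_)
        refine Tendsto.sub ((hω.tendsto _).comp ?_) ((hω.tendsto _).comp ?_)
        · simpa using (hε0.const_add t).add_const (τ i)
        · simpa using hε0.const_add t
    refine tendsto_nhds_unique (hlim (P.restrict A) Measure.restrict_le_self) ?_
    refine ((hlim P le_rfl).const_mul (P A).toReal).congr fun n => ?_
    exact (integral_indicator_shift hWm hW τ (hAε _ (hεpos n)) f.continuous.measurable).symm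
  have := congrArg (fun μ => μ B) key
  simp only [Measure.map_apply hYm hB, Measure.smul_apply, smul_eq_mul,
    Measure.restrict_apply (hYm hB)] at this
  rw [this, mul_comm]

end Brownian

/-! ### Conditional expectation as a projection in the Hermite basis -/

section CondExp

variable {Ω : Type*} {m₁ m₂ mΩ : MeasurableSpace Ω} {P : Measure Ω} [IsProbabilityMeasure P]
  {M : ℕ} {X : Ω → Fin M → ℝ}

/-- Conditional expectations of Hermite functions of independent coordinates. -/
lemma condExp_hb_comp (hX : MeasurePreserving X P (gau M)) (hm₁ : m₁ ≤ mΩ) (hm₂ : m₂ ≤ mΩ)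
    (hind : Indep m₁ m₂ P) (s : Finset (Fin M)) (hs₁ : ∀ k ∈ s, Measurable[m₁] fun ω => X ω k)
    (hs₂ : ∀ k ∉ s, Measurable[m₂] fun ω => X ω k) (α : Fin M → ℕ) :
    P[fun ω => hb α (X ω) | m₂] =ᵐ[P]
      fun ω => (if ∀ k ∈ s, α k = 0 then 1 else 0) * hb α (X ω) := by
  set β : Fin M → ℕ := fun k => if k ∈ s then α k else 0 with hβ
  set δ : Fin M → ℕ := fun k => if k ∈ s then 0 else α k with hδ
  have hint : ∀ η : Fin M → ℕ, Integrable (fun ω => hb η (X ω)) P := fun η =>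
    hX.integrable_comp_of_integrable (ExpBdd.hb η).integrable
  -- The part δ off s is measurable for the conditioning field and is pulled out; the part β on s is
  -- independent of it and has mean 1 or 0 according to whether β vanishes.
  have hprod : (fun ω => hb α (X ω)) = (fun ω => hb δ (X ω)) * fun ω => hb β (X ω) := by
    ext ω
    simp only [Pi.mul_apply, hb, ← Finset.prod_mul_distrib]
    refine Finset.prod_congr rfl fun k _ => ?_
    by_cases hk : k ∈ s <;> simp [hβ, hδ, hk, hb1_zero]
  have hδm : StronglyMeasurable[m₂] fun ω => hb δ (X ω) := by
    refine Finset.stronglyMeasurable_fun_prod _ fun k _ => ?_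
    by_cases hk : k ∈ s
    · simp only [hδ, hk, if_true, hb1_zero]
      exact stronglyMeasurable_const
    · exact ((continuous_hb1 _).measurable.comp (hs₂ k hk)).stronglyMeasurable
  have hβm : StronglyMeasurable[m₁] fun ω => hb β (X ω) := by
    refine Finset.stronglyMeasurable_fun_prod _ fun k _ => ?_
    by_cases hk : k ∈ s
    · exact ((continuous_hb1 _).measurable.comp (hs₁ k hk)).stronglyMeasurable
    · simp only [hβ, hk, if_false, hb1_zero]
      exact stronglyMeasurable_const
  have hE : ∫ ω, hb β (X ω) ∂P = if ∀ k ∈ s, α k = 0 then 1 else 0 := by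
    have h0 : ∀ x : Fin M → ℝ, hb (0 : Fin M → ℕ) x = 1 := fun x => by simp [hb, hb1_zero]
    have h1 := integral_hb_mul β 0
    simp only [h0, mul_one] at h1
    rw [← hX.map_eq, integral_map hX.aemeasurable (continuous_hb β).aestronglyMeasurable] at h1
    rw [h1]
    refine if_congr ⟨fun h k hk => ?_, fun h => ?_⟩ rfl rfl
    · simpa [hβ, hk] using congrFun h k
    · ext k
      by_cases hk : k ∈ s <;> simp [hβ, hk]
      exact h k hk
  have h1 := condExp_mul_of_stronglyMeasurable_left hδm (hprod ▸ hint α) (hint β)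
  have h2 := condExp_indep_eq hm₁ hm₂ hβm hind
  rw [hprod]
  filter_upwards [h1, h2] with ω h1 h2
  rw [h1, Pi.mul_apply, h2, hE]
  split_ifs with h
  · have : δ = α := by
      ext k
      by_cases hk : k ∈ s <;> simp [hδ, hk]
      exact (h k hk).symm
    simp [this]
  · simp

/-- Composition with X and conditional expectation are bounded on L², so it suffices to compare the
two sides term by term along the Hermite expansions of u and T. -/
lemma condExp_comp_ae_eq (hX : MeasurePreserving X P (gau M)) (hm₁ : m₁ ≤ mΩ) (hm₂ : m₂ ≤ mΩ)
    (hind : Indep m₁ m₂ P) (s : Finset (Fin M)) (hs₁ : ∀ k ∈ s, Measurable[m₁] fun ω => X ω k)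
    (hs₂ : ∀ k ∉ s, Measurable[m₂] fun ω => X ω k) {u T : (Fin M → ℝ) → ℝ}
    (hu : MemLp u 2 (gau M)) (hT : MemLp T 2 (gau M))
    (hTc : ∀ α, coef T α = if ∀ k ∈ s, α k = 0 then coef u α else 0) :
    P[u ∘ X | m₂] =ᵐ[P] T ∘ X := by
  set C : Lp ℝ 2 (gau M) →L[ℝ] Lp ℝ 2 P :=
    (Lp.compMeasurePreservingₗᵢ ℝ X hX).toContinuousLinearMap with hC
  set E : Lp ℝ 2 P →L[ℝ] Lp ℝ 2 P :=
    (lpMeas ℝ ℝ m₂ 2 P).subtypeL.comp (condExpL2 ℝ ℝ hm₂) with hE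
  have hCt : ∀ {v : (Fin M → ℝ) → ℝ} (hv : MemLp v 2 (gau M)),
      C (hv.toLp v) = (hv.comp_measurePreserving hX).toLp (v ∘ X) := fun hv => rfl
  have hEt : ∀ {f : Ω → ℝ} (hf : MemLp f 2 P), (E (hf.toLp f) : Ω → ℝ) =ᵐ[P] P[f | m₂] :=
    fun hf => hf.condExpL2_ae_eq_condExp hm₂
  have hsum : ∀ {v : (Fin M → ℝ) → ℝ} (hv : MemLp v 2 (gau M)),
      HasSum (fun α => coef v α • (memLp_hb α).toLp (hb α)) (hv.toLp v) := by
    intro v hv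
    have := (hbBasis M).hasSum_repr (hv.toLp v)
    simpa only [hbBasis_repr hv, hbBasis_apply] using this
  have h1 := (hsum hu).mapL (E.comp C)
  have h2 := (hsum hT).mapL C
  have hterm : ∀ α, E.comp C (coef u α • (memLp_hb α).toLp (hb α))
      = C (coef T α • (memLp_hb α).toLp (hb α)) := by
    intro α
    rw [map_smul, map_smul, ContinuousLinearMap.comp_apply, hCt, hTc]
    have hm := (memLp_hb α).comp_measurePreserving hX
    have : E (hm.toLp _) = (if ∀ k ∈ s, α k = 0 then (1 : ℝ) else 0) • hm.toLp (hb α ∘ X) := by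
      apply Lp.ext
      refine (hEt hm).trans ((condExp_hb_comp hX hm₁ hm₂ hind s hs₁ hs₂ α).trans ?_)
      refine EventuallyEq.trans ?_ (Lp.coeFn_smul _ _).symm
      filter_upwards [hm.coeFn_toLp] with ω hω
      simp [hω]
    rw [this]
    split_ifs <;> simp
  simp_rw [hterm] at h1
  have h3 := h1.unique h2
  rw [ContinuousLinearMap.comp_apply, hCt, hCt] at h3
  refine (hEt (hu.comp_measurePreserving hX)).symm.trans ?_
  rw [h3]
  exact MemLp.coeFn_toLp _

end CondExp

/-! ### Passing from Brownian motion to normalised increments -/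

section Transport

variable {Ω : Type*} [mΩ : MeasurableSpace Ω] {P : Measure Ω} {W : ℝ≥0 → Ω → ℝ} {M : ℕ}

/-- The normalised increments of `W` on the grid of step `Δ`. -/
noncomputable def incr (W : ℝ≥0 → Ω → ℝ) (Δ : ℝ≥0) (M : ℕ) (ω : Ω) (k : Fin M) : ℝ :=
  (W (((k : ℕ) + 1 : ℝ≥0) * Δ) ω - W ((k : ℕ) * Δ) ω) / √(Δ : ℝ)

/-- The values on the grid of step `Δ` as a function of the normalised increments. -/
noncomputable def gridPath (Δ : ℝ≥0) (M : ℕ) : (Fin M → ℝ) →L[ℝ] (Fin M → ℝ) :=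
  ContinuousLinearMap.pi fun i => √(Δ : ℝ) • ∑ j ∈ Finset.Iic i, ContinuousLinearMap.proj j

lemma gridPath_apply (Δ : ℝ≥0) (x : Fin M → ℝ) (i : Fin M) :
    gridPath Δ M x i = √(Δ : ℝ) * ∑ j ∈ Finset.Iic i, x j := by
  simp [gridPath]

lemma measurable_incr (hWm : ∀ t, Measurable (W t)) (Δ : ℝ≥0) : Measurable (incr W Δ M) :=
  measurable_pi_iff.2 fun _ => ((hWm _).sub (hWm _)).div_const _

lemma measurePreserving_incr [IsProbabilityMeasure P] (hWm : ∀ t, Measurable (W t))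
    (hW : IsPreBrownianReal W P) {Δ : ℝ≥0} (hΔ : 0 < Δ) :
    MeasurePreserving (incr W Δ M) P (gau M) := by
  refine ⟨measurable_incr hWm Δ, ?_⟩
  have h1 := hW.hasIndepIncrements.nat (t := fun n : ℕ => (n : ℝ≥0) * Δ)
    (fun a b hab => by dsimp only; gcongr)
  have h2 := (h1.precomp (Fin.val_injective (n := M))).comp (fun _ x => x / √(Δ : ℝ))
    (fun _ => measurable_id.div_const _)
  have h3 : iIndepFun (fun (k : Fin M) ω => incr W Δ M ω k) P := by
    convert h2 using 3 with k
    simp [incr]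
  rw [iIndepFun_iff_map_fun_eq_pi_map fun k =>
    ((measurable_pi_iff.1 (measurable_incr hWm Δ)) k).aemeasurable] at h3
  rw [show incr W Δ M = fun ω k => incr W Δ M ω k from rfl, h3]
  congr 1
  ext1 k
  have h4 := gaussianReal_div_const
    (hW.hasLaw_sub (((k : ℕ) + 1 : ℝ≥0) * Δ) ((k : ℕ) * Δ)) √(Δ : ℝ)
  have h5 := h4.map_eq
  simp only [Pi.sub_apply] at h5
  rw [show (fun ω => incr W Δ M ω k) = fun ω => (W (((k : ℕ) + 1 : ℝ≥0) * Δ) ω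
    - W ((k : ℕ) * Δ) ω) / √(Δ : ℝ) from rfl, h5, zero_div]
  congr 1
  apply NNReal.eq
  have : (Δ : ℝ) ≠ 0 := by positivity
  simp [add_mul, this]

lemma cyl_ae_eq [IsProbabilityMeasure P] (hW : IsPreBrownianReal W P) {Δ : ℝ≥0} (hΔ : 0 < Δ)
    (h : (Fin M → ℝ) → ℝ) :
    cyl W Δ h =ᵐ[P] (h ∘ gridPath Δ M) ∘ incr W Δ M := by
  filter_upwards [hW.eval_zero_ae_eq_zero] with ω hω
  simp only [cyl, Function.comp_apply]
  congr 1
  ext i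
  have hs : √(Δ : ℝ) ≠ 0 := by positivity
  simp only [gridPath_apply, incr, ← Finset.sum_div]
  rw [mul_div_cancel₀ _ hs]
  have e := Finset.sum_range_sub (fun n : ℕ => W ((n : ℝ≥0) * Δ) ω) (i + 1)
  rw [Nat.range_succ_eq_Iic, ← Fin.map_valEmbedding_Iic, Finset.sum_map] at e
  simpa [hω] using e.symm

/-- This is the indicator in the Malliavin derivative: raising the k-th increment moves exactly the
grid values i ≥ k, those with (k+1)Δ ≤ (i+1)Δ. -/
lemma gridPath_single (Δ : ℝ≥0) (k : Fin M) : gridPath Δ M (Pi.single k 1)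
    = √(Δ : ℝ) • ∑ i : Fin M, if k ≤ i then Pi.single i 1 else 0 := by
  ext i
  rw [gridPath_apply]
  simp only [Pi.smul_apply, Finset.sum_apply, smul_eq_mul]
  congr 1
  have : ∀ j : Fin M, (if k ≤ j then (Pi.single j 1 : Fin M → ℝ) else 0) i
      = if j = i then (if k ≤ i then 1 else 0) else 0 := by
    intro j
    by_cases hj : j = i
    · subst hj
      by_cases hk : k ≤ j <;> simp [hk]
    · by_cases hk : k ≤ j <;> simp [hk, hj, Ne.symm hj]
  simp [this, Pi.single_apply]

lemma contDiff_pd_iterate {u : (Fin M → ℝ) → ℝ} (hu : ContDiff ℝ (⊤ : ℕ∞) u) (k : Fin M) (p : ℕ) :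
    ContDiff ℝ (⊤ : ℕ∞) ((pd k)^[p] u) := by
  induction p with
  | zero => exact hu
  | succ p ih => rw [Function.iterate_succ_apply']; exact contDiff_pd ih k

lemma pd_iterate_const_mul {u : (Fin M → ℝ) → ℝ} (hu : ContDiff ℝ (⊤ : ℕ∞) u) (k : Fin M) (a : ℝ)
    (p : ℕ) : (pd k)^[p] (fun x => a * u x) = fun x => a * (pd k)^[p] u x := by
  induction p with
  | zero => rfl
  | succ p ih =>
    rw [Function.iterate_succ_apply', ih,
      pd_const_mul ((contDiff_pd_iterate hu k p).differentiable (by simp)),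
      Function.iterate_succ_apply']

lemma contDiff_malliavin {h : (Fin M → ℝ) → ℝ} (hh : ContDiff ℝ (⊤ : ℕ∞) h) (Δ s : ℝ≥0) :
    ContDiff ℝ (⊤ : ℕ∞) (malliavin Δ s h) := by
  refine ContDiff.sum fun i _ => ?_
  split_ifs
  · exact contDiff_pd hh i
  · exact contDiff_const

lemma malliavin_comp_gridPath {h : (Fin M → ℝ) → ℝ} (hh : ContDiff ℝ (⊤ : ℕ∞) h) {Δ : ℝ≥0}
    (hΔ : 0 < Δ) (k : Fin M) :
    malliavin Δ (((k : ℕ) + 1 : ℝ≥0) * Δ) h ∘ gridPath Δ M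
      = fun x => (√(Δ : ℝ))⁻¹ * pd k (h ∘ gridPath Δ M) x := by
  ext x
  have hs : √(Δ : ℝ) ≠ 0 := by positivity
  have hd : DifferentiableAt ℝ h (gridPath Δ M x) := hh.differentiable (by simp) _
  rw [pd, fderiv_comp x hd (gridPath Δ M).differentiableAt, (gridPath Δ M).fderiv,
    ContinuousLinearMap.comp_apply, gridPath_single, map_smul, smul_eq_mul,
    inv_mul_cancel_left₀ hs, map_sum]
  simp only [Function.comp_apply, malliavin]
  refine Finset.sum_congr rfl fun i _ => ?_
  have : ((k : ℕ) + 1 : ℝ≥0) * Δ ≤ ((i : ℕ) + 1 : ℝ≥0) * Δ ↔ k ≤ i := by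
    rw [mul_le_mul_iff_left₀ hΔ, add_le_add_iff_right, Nat.cast_le, Fin.val_fin_le]
  simp only [this]
  split_ifs <;> simp

lemma malliavin_iterate_comp_gridPath {h : (Fin M → ℝ) → ℝ} (hh : ContDiff ℝ (⊤ : ℕ∞) h)
    {Δ : ℝ≥0} (hΔ : 0 < Δ) (k : Fin M) (p : ℕ) :
    ContDiff ℝ (⊤ : ℕ∞) ((malliavin Δ (((k : ℕ) + 1 : ℝ≥0) * Δ))^[p] h) ∧
    (malliavin Δ (((k : ℕ) + 1 : ℝ≥0) * Δ))^[p] h ∘ gridPath Δ M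
      = fun x => (√(Δ : ℝ))⁻¹ ^ p * (pd k)^[p] (h ∘ gridPath Δ M) x := by
  have hu : ContDiff ℝ (⊤ : ℕ∞) (h ∘ gridPath Δ M) := hh.comp (gridPath Δ M).contDiff
  induction p with
  | zero => simpa [Function.comp_def] using hh
  | succ p ih =>
    rw [Function.iterate_succ_apply']
    refine ⟨contDiff_malliavin ih.1 _ _, ?_⟩
    rw [malliavin_comp_gridPath ih.1 hΔ, ih.2, pd_const_mul ((contDiff_pd_iterate hu k p).differentiable (by simp)),
      Function.iterate_succ_apply']
    ext x
    ring

lemma malliavinList_comp_gridPath {h : (Fin M → ℝ) → ℝ} (hh : ContDiff ℝ (⊤ : ℕ∞) h)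
    {Δ : ℝ≥0} (hΔ : 0 < Δ) (l : List (Fin M)) :
    malliavinList Δ (l.map fun k : Fin M => ((k : ℕ) + 1 : ℝ≥0) * Δ) h ∘ gridPath Δ M
      = fun x => (√(Δ : ℝ))⁻¹ ^ l.length *
        l.foldl (fun h k => pd k h) (h ∘ gridPath Δ M) x := by
  induction l generalizing h with
  | nil => simp [malliavinList, Function.comp_def]
  | cons k l ih =>
    have hu : ContDiff ℝ (⊤ : ℕ∞) (h ∘ gridPath Δ M) := hh.comp (gridPath Δ M).contDiff
    have := ih (contDiff_malliavin hh Δ (((k : ℕ) + 1 : ℝ≥0) * Δ))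
    rw [malliavin_comp_gridPath hh hΔ, foldl_pd_const_mul l (contDiff_pd hu k)] at this
    simp only [malliavinList, List.map_cons, List.foldl_cons, List.length_cons] at this ⊢
    rw [this]
    ext x
    ring

lemma contDiff_dIter {u : (Fin M → ℝ) → ℝ} (hu : ContDiff ℝ (⊤ : ℕ∞) u) {n : ℕ}
    (κ : Fin n → Fin M) (J : Fin n → ℕ) : ContDiff ℝ (⊤ : ℕ∞) (dIter n κ J u) := by
  induction n with
  | zero => exact hu
  | succ n ih => exact contDiff_pd_iterate (ih _ _) _ _

lemma mixedDeriv_comp_gridPath {h : (Fin M → ℝ) → ℝ} (hh : ContDiff ℝ (⊤ : ℕ∞) h)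
    {Δ : ℝ≥0} (hΔ : 0 < Δ) {m n : ℕ} (κ : Fin n → Fin M) (hκ : ∀ i, (κ i : ℕ) = m + i)
    (J : Fin n → ℕ) :
    ContDiff ℝ (⊤ : ℕ∞) (mixedDeriv Δ m n J h) ∧ mixedDeriv Δ m n J h ∘ gridPath Δ M
      = fun x => (∏ i, (√(Δ : ℝ))⁻¹ ^ J i) * dIter n κ J (h ∘ gridPath Δ M) x := by
  have hu : ContDiff ℝ (⊤ : ℕ∞) (h ∘ gridPath Δ M) := hh.comp (gridPath Δ M).contDiff
  induction n generalizing m with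
  | zero => simpa [mixedDeriv, dIter, Function.comp_def] using hh
  | succ n ih =>
    obtain ⟨h1, h2⟩ := ih (m := m + 1) (Fin.tail κ)
      (fun i => by rw [Fin.tail, hκ, Fin.val_succ]; ring) (Fin.tail J)
    have hm : (m : ℝ≥0) = ((κ 0 : ℕ) : ℝ≥0) := by simp [hκ]
    obtain ⟨h3, h4⟩ := malliavin_iterate_comp_gridPath h1 hΔ (κ 0) (J 0)
    rw [mixedDeriv, hm]
    refine ⟨h3, ?_⟩
    rw [h4, h2, pd_iterate_const_mul (contDiff_dIter hu _ _), Fin.prod_univ_succ, dIter]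
    ext x
    simp only [Fin.tail]
    ring

lemma gamma_eq {Ω : Type*} {W : ℝ≥0 → Ω → ℝ} (Δ : ℝ≥0) {m : ℕ} (k : Fin M) (hk : (k : ℕ) = m) (l : ℕ) (ω : Ω) :
    gamma W Δ m l ω = √(Δ : ℝ) ^ l * gam l (incr W Δ M ω k) := by
  have e : (Δ : ℝ) ^ ((l : ℝ) / 2) = √(Δ : ℝ) ^ l := by
    rw [Real.sqrt_eq_rpow, ← Real.rpow_natCast, ← Real.rpow_mul NNReal.zero_le_coe]
    congr 1
    ring
  subst hk
  simp only [gamma, gam, e, aeval_hermite, incr]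
  ring

end Transport

/-! ### Verification of the hypotheses and conclusion -/

section Main

variable {Ω : Type*} [mΩ : MeasurableSpace Ω] {P : Measure Ω} {W : ℝ≥0 → Ω → ℝ} {M : ℕ}

lemma memLp_gau_of_cyl [IsProbabilityMeasure P]
    (hWm : ∀ t, Measurable (W t)) (hW : IsPreBrownianReal W P)
    {Δ : ℝ≥0} (hΔ : 0 < Δ) {h : (Fin M → ℝ) → ℝ} (hh : Continuous h)
    (hL : MemLp (cyl W Δ h) 2 P) : MemLp (h ∘ gridPath Δ M) 2 (gau M) := by
  have hX := measurePreserving_incr (M := M) hWm hW hΔ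
  rw [← hX.map_eq, memLp_map_measure_iff
    (hh.comp (gridPath Δ M).continuous).aestronglyMeasurable hX.aemeasurable]
  exact hL.ae_eq (cyl_ae_eq hW hΔ h)

lemma eLpNorm_cyl [IsProbabilityMeasure P]
    (hWm : ∀ t, Measurable (W t)) (hW : IsPreBrownianReal W P)
    {Δ : ℝ≥0} (hΔ : 0 < Δ) {h : (Fin M → ℝ) → ℝ} (hh : Continuous h) :
    eLpNorm (cyl W Δ h) 2 P = eLpNorm (h ∘ gridPath Δ M) 2 (gau M) := by
  rw [eLpNorm_congr_ae (cyl_ae_eq hW hΔ h)]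
  exact eLpNorm_comp_measurePreserving
    (hh.comp (gridPath Δ M).continuous).aestronglyMeasurable (measurePreserving_incr hWm hW hΔ)

lemma contDiff_malliavinList {h : (Fin M → ℝ) → ℝ} (hh : ContDiff ℝ (⊤ : ℕ∞) h) (Δ : ℝ≥0)
    (s : List ℝ≥0) : ContDiff ℝ (⊤ : ℕ∞) (malliavinList Δ s h) := by
  induction s generalizing h with
  | nil => exact hh
  | cons t s ih => exact ih (contDiff_malliavin hh Δ t)

lemma memLp_cyl_malliavinList (hWm : ∀ t, Measurable (W t)) {Δ : ℝ≥0} {g : (Fin M → ℝ) → ℝ}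
    (hg : ContDiff ℝ (⊤ : ℕ∞) g) (hFD : IsInfMalliavinDiff W P Δ g) (l : List (Fin M)) :
    MemLp (cyl W Δ (malliavinList Δ (l.map fun k : Fin M => ((k : ℕ) + 1 : ℝ≥0) * Δ) g)) 2 P := by
  -- The empty list is F itself, covered by the separate L² assumption since the supremum bounds
  -- start at n = 1.
  rcases l.eq_nil_or_concat with rfl | hne
  · exact hFD.memLp
  have hl : 1 ≤ l.length := by
    obtain ⟨L, b, rfl⟩ := hne
    simp
  refine ⟨?_, ?_⟩
  · refine Measurable.aestronglyMeasurable ?_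
    exact (contDiff_malliavinList hg Δ _).continuous.measurable.comp
      (measurable_pi_iff.2 fun i => hWm _)
  rw [eLpNorm_lt_top_iff_lintegral_rpow_enorm_lt_top (by norm_num) (by norm_num)]
  have hs : ∀ k : Fin M, ((k : ℕ) + 1 : ℝ≥0) * Δ ∈ Set.Icc (0 : ℝ≥0) (M * Δ) := by
    intro k
    refine ⟨zero_le, ?_⟩
    gcongr
    exact_mod_cast k.2
  refine lt_of_le_of_lt (lintegral_mono fun ω => ?_) (hFD.sup_lt_top l.length hl)
  rw [ENNReal.toReal_ofNat, ENNReal.rpow_ofNat]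
  gcongr
  have e : (l.map fun k : Fin M => ((k : ℕ) + 1 : ℝ≥0) * Δ) = List.ofFn fun i : Fin l.length =>
      (((fun i => ⟨_, hs (l.get i)⟩ : Fin l.length → Set.Icc (0 : ℝ≥0) (M * Δ)) i : ℝ≥0)) := by
    apply List.ext_get <;> simp
  rw [e]
  exact le_iSup (fun s : Fin l.length → Set.Icc (0 : ℝ≥0) (M * Δ) =>
    ‖cyl W Δ (malliavinList Δ (List.ofFn fun i => (s i : ℝ≥0)) g) ω‖ₑ) _

lemma smoothL2_of_isInfMalliavinDiff [IsProbabilityMeasure P]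
    (hWm : ∀ t, Measurable (W t)) (hW : IsPreBrownianReal W P)
    {Δ : ℝ≥0} (hΔ : 0 < Δ) {g : (Fin M → ℝ) → ℝ} (hg : ContDiff ℝ (⊤ : ℕ∞) g)
    (hFD : IsInfMalliavinDiff W P Δ g) : SmoothL2 (g ∘ gridPath Δ M) := by
  refine ⟨hg.comp (gridPath Δ M).contDiff, fun l => ?_⟩
  have h1 := memLp_gau_of_cyl hWm hW hΔ (contDiff_malliavinList hg Δ _).continuous
    (memLp_cyl_malliavinList hWm hg hFD l)
  rw [malliavinList_comp_gridPath hg hΔ] at h1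
  have hs : √(Δ : ℝ) ≠ 0 := by positivity
  convert h1.const_mul (√(Δ : ℝ) ^ l.length) using 2 with x
  rw [← mul_assoc, ← mul_pow, mul_inv_cancel₀ hs, one_pow, one_mul]

lemma growth_term_eq [IsProbabilityMeasure P]
    (hWm : ∀ t, Measurable (W t)) (hW : IsPreBrownianReal W P)
    {Δ : ℝ≥0} (hΔ : 0 < Δ) {g : (Fin M → ℝ) → ℝ} (hg : ContDiff ℝ (⊤ : ℕ∞) g) (k : Fin M) (p : ℕ) :
    (eLpNorm (cyl W Δ ((malliavin Δ (((k : ℕ) + 1 : ℝ≥0) * Δ))^[p] g)) 2 P).toReal ^ 2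
      * (Δ : ℝ) ^ p = (eLpNorm ((pd k)^[p] (g ∘ gridPath Δ M)) 2 (gau M)).toReal ^ 2 := by
  obtain ⟨h1, h2⟩ := malliavin_iterate_comp_gridPath hg hΔ k p
  have hs : √(Δ : ℝ) ≠ 0 := by positivity
  have hΔ' : (Δ : ℝ) ≠ 0 := by positivity
  have h3 := eLpNorm_const_smul ((√(Δ : ℝ))⁻¹ ^ p) ((pd k)^[p] (g ∘ gridPath Δ M)) 2 (gau M)
  rw [eLpNorm_cyl hWm hW hΔ h1.continuous, h2]
  rw [show (fun x => (√(Δ : ℝ))⁻¹ ^ p * (pd k)^[p] (g ∘ gridPath Δ M) x)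
    = (√(Δ : ℝ))⁻¹ ^ p • (pd k)^[p] (g ∘ gridPath Δ M) from rfl, h3, ENNReal.toReal_mul,
    toReal_enorm, Real.norm_eq_abs, mul_pow, sq_abs, ← pow_mul, mul_comm p 2, pow_mul, inv_pow,
    Real.sq_sqrt NNReal.zero_le_coe, inv_pow]
  field_simp

lemma good_of_growthCondition [IsProbabilityMeasure P]
    (hWm : ∀ t, Measurable (W t)) (hW : IsPreBrownianReal W P)
    {Δ : ℝ≥0} (hΔ : 0 < Δ) {g : (Fin M → ℝ) → ℝ} (hg : ContDiff ℝ (⊤ : ℕ∞) g)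
    (hFD : IsInfMalliavinDiff W P Δ g) (hcond : ∀ m < M, GrowthCondition W P Δ g m) :
    Good (coef (g ∘ gridPath Δ M)) := by
  have hb : ∀ k : Fin M, ∃ B, ∀ r : ℕ,
      (eLpNorm ((pd k)^[3 * r] (g ∘ gridPath Δ M)) 2 (gau M)).toReal ^ 2 *
        (((2 * r).factorial : ℝ) ^ 2 / (r.factorial : ℝ) ^ 7) ≤ B := by
    intro k
    obtain ⟨B, hB⟩ := (hcond k k.2).bddAbove_range
    -- At L = 2r the summand i = r has derivative order 2L - i = 3r and weight C(2r, r)^4 r!/(2r)!²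
    -- = (2r)!²/r!^7. All summands are nonnegative, so it is at most the whole sum, which is bounded
    -- along a convergent sequence.
    refine ⟨B, fun r => le_trans ?_ (hB ⟨2 * r, rfl⟩)⟩
    have hmem : r ∈ Finset.range (2 * r + 1) := Finset.mem_range.2 (by omega)
    refine le_trans (le_of_eq ?_) (Finset.single_le_sum (fun i _ => by positivity) hmem)
    have e : 2 * (2 * r) - r = 3 * r := by omega
    rw [e, ← growth_term_eq hWm hW hΔ hg]
    have hc : ((2 * r).choose r : ℝ) = (2 * r).factorial / (r.factorial * r.factorial) := by
      rw [Nat.cast_choose ℝ (by omega : r ≤ 2 * r), show 2 * r - r = r by omega]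
    rw [hc]
    have h1 : (r.factorial : ℝ) ≠ 0 := by positivity
    have h2 : ((2 * r).factorial : ℝ) ≠ 0 := by positivity
    field_simp
  choose B hB using hb
  refine good_of_growth (smoothL2_of_isInfMalliavinDiff hWm hW hΔ hg hFD) (∑ k, |B k|) fun k r =>
    (hB k r).trans ((le_abs_self _).trans ?_)
  exact Finset.single_le_sum (f := fun k => |B k|) (fun i _ => abs_nonneg _) (Finset.mem_univ k)

lemma measurable_incr_past (hWm : ∀ t, Measurable (W t)) (Δ : ℝ≥0) {m : ℕ} {k : Fin M}
    (hk : (k : ℕ) < m) :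
    Measurable[brownianFiltration W hWm P (m * Δ)] fun ω => incr W Δ M ω k := by
  have h : ∀ s ≤ m * Δ, Measurable[brownianFiltration W hWm P (m * Δ)] (W s) := by
    intro s hs
    refine Measurable.mono (comap_measurable (W s)) ?_ le_rfl
    exact le_trans (le_trans (le_iSup₂_of_le s hs le_rfl) le_sup_left)
      ((nullFiltration W hWm P).le_rightCont (m * Δ))
  refine Measurable.div_const (Measurable.sub (h _ ?_) (h _ ?_)) _
  · gcongr
    exact_mod_cast hk
  · gcongr

/-- The vector runs over all grid indices; truncated subtraction makes its entries with index below
m equal to zero, and for indices j ≥ m they are W(jΔ) - W(mΔ), whose consecutive differences are the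
increments. -/
lemma measurable_incr_future {Ω : Type*} {W : ℝ≥0 → Ω → ℝ} (Δ : ℝ≥0) {m : ℕ} {k : Fin M} (hk : m ≤ (k : ℕ)) :
    Measurable[MeasurableSpace.comap (fun ω (i : Fin (M + 1)) =>
      W (m * Δ + ((i : ℕ) - m : ℕ) * Δ) ω - W (m * Δ) ω) inferInstance]
      fun ω => incr W Δ M ω k := by
  have e : (fun ω => incr W Δ M ω k) = (fun y : Fin (M + 1) → ℝ =>
      (y k.succ - y k.castSucc) / √(Δ : ℝ)) ∘ (fun ω (i : Fin (M + 1)) =>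
      W (m * Δ + ((i : ℕ) - m : ℕ) * Δ) ω - W (m * Δ) ω) := by
    have e1 : ∀ j : ℕ, m ≤ j → (m : ℝ≥0) * Δ + ((j - m : ℕ) : ℝ≥0) * Δ = j * Δ := by
      intro j hj
      rw [← add_mul, ← Nat.cast_add, Nat.add_sub_cancel' hj]
    ext ω
    simp only [Function.comp_apply, incr, Fin.val_succ, Fin.val_castSucc, e1 _ hk,
      e1 _ (hk.trans (Nat.le_succ _))]
    push_cast
    ring
  rw [e]
  exact Measurable.comp (by fun_prop) (comap_measurable _)

/-- The conditional expectation in terms of Hermite coefficients. -/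
lemma condExp_comp_incr [IsProbabilityMeasure P]
    (hWm : ∀ t, Measurable (W t)) (hW : IsBrownianReal W P)
    {Δ : ℝ≥0} (hΔ : 0 < Δ) (m : ℕ) {u T : (Fin M → ℝ) → ℝ}
    (hu : MemLp u 2 (gau M)) (hT : MemLp T 2 (gau M)) {n : ℕ} {κ : Fin n → Fin M}
    (hκ : ∀ k : Fin M, (∃ i, κ i = k) ↔ m ≤ (k : ℕ)) (hTc : coef T = Qop κ (coef u)) :
    P[u ∘ incr W Δ M | brownianFiltration W hWm P (m * Δ)] =ᵐ[P] T ∘ incr W Δ M := by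
  have hYm : Measurable fun ω (i : Fin (M + 1)) =>
      W (m * Δ + ((i : ℕ) - m : ℕ) * Δ) ω - W (m * Δ) ω :=
    measurable_pi_iff.2 fun i => (hWm _).sub (hWm _)
  refine condExp_comp_ae_eq (measurePreserving_incr hWm hW.toIsPreBrownianReal hΔ) hYm.comap_le
    ((brownianFiltration W hWm P).le _) (indep_brownianFiltration hWm hW _ _)
    (Finset.univ.filter fun k : Fin M => m ≤ (k : ℕ))
    (fun k hk => measurable_incr_future Δ (by simpa using hk))
    (fun k hk => measurable_incr_past hWm Δ (by simpa using hk)) hu hT fun α => ?_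
  rw [hTc, Qop]
  refine if_congr ⟨fun h k hk => ?_, fun h i => ?_⟩ rfl rfl
  · obtain ⟨i, rfl⟩ := (hκ k).2 (by simpa using hk)
    exact h i
  · exact h _ (by simpa using (hκ (κ i)).1 ⟨i, rfl⟩)

end Main

end BTE

theorem mainTheorem2 {Ω : Type*} [MeasurableSpace Ω] (P : Measure Ω) [IsProbabilityMeasure P]
    (W : ℝ≥0 → Ω → ℝ) (hWmeas : ∀ t, Measurable (W t)) (hW : IsBrownianReal W P)
    (M : ℕ) (hM : 1 ≤ M) (Δ : ℝ≥0) (hΔ : 0 < Δ)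
    (F : Ω → ℝ) (g : (Fin M → ℝ) → ℝ) (hg : ContDiff ℝ (⊤ : ℕ∞) g) (hF : F =ᵐ[P] BTE.cyl W Δ g)
    (hFD : BTE.IsInfMalliavinDiff W P Δ g)
    (hcond : ∀ m < M, BTE.GrowthCondition W P Δ g m) :
    ∀ m < M, BTE.HasIteratedL2Sum P (M - m)
      (fun J ω => (∏ k : Fin (M - m), BTE.gamma W Δ (m + k) (J k) ω) *
        BTE.cyl W Δ (BTE.mixedDeriv Δ m (M - m) J g) ω)
      (P[F | BTE.brownianFiltration W hWmeas P (m * Δ)]) := by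
  intro m hm
  have hB := hW.toIsPreBrownianReal
  have hu := BTE.smoothL2_of_isInfMalliavinDiff hWmeas hB hΔ hg hFD
  have hgood := BTE.good_of_growthCondition hWmeas hB hΔ hg hFD hcond
  set κ : Fin (M - m) → Fin M := fun i => ⟨m + i, by omega⟩ with hκ
  have hinj : Function.Injective κ := fun i j h => by
    simpa [hκ, Fin.ext_iff] using h
  -- T is defined by its coefficients, those of u averaged over the coordinates k ≥ m. It serves
  -- both as the sum of the nested series and, composed with the increments, as the conditional
  -- expectation.
  obtain ⟨T, hT, hTc⟩ := BTE.exists_memLp_coef_eq ((hgood.qop κ).tsum_lt_top ⟨m, hm⟩)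
  refine (BTE.hasIteratedL2Sum_gau hu hgood hinj hT hTc).comp
    (BTE.measurePreserving_incr hWmeas hB hΔ) (fun J => ?_) ?_
  · filter_upwards [BTE.cyl_ae_eq hB hΔ (BTE.mixedDeriv Δ m (M - m) J g)] with ω hω
    have hs : √(Δ : ℝ) ≠ 0 := by positivity
    rw [hω, (BTE.mixedDeriv_comp_gridPath hg hΔ κ (fun i => rfl) J).2]
    simp only [Function.comp_apply]
    rw [← mul_assoc, ← Finset.prod_mul_distrib]
    congr 1
    refine Finset.prod_congr rfl fun i _ => ?_
    -- The factor √Δ^(J i) of γ cancels the factor √Δ^(-J i) of the Malliavin derivatives.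
    rw [BTE.gamma_eq Δ (κ i) rfl, mul_right_comm, ← mul_pow, mul_inv_cancel₀ hs, one_pow, one_mul]
  · refine (condExp_congr_ae (hF.trans (BTE.cyl_ae_eq hB hΔ g))).trans ?_
    refine BTE.condExp_comp_incr hWmeas hW hΔ m hu.memLp hT (fun k => ⟨?_, fun h => ?_⟩) hTc
    · rintro ⟨i, rfl⟩
      exact Nat.le_add_right _ _
    · exact ⟨⟨k - m, by omega⟩, Fin.ext (by simp [hκ]; omega)⟩
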